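/- Let $(F,g)$ be a complete smooth Riemannian $2$-manifold (without boundary) whose sectional curvature is bounded above by a constant $K_0>0$, and put $R=\frac{\pi}{3\sqrt{K_0}}$. Let $B$ be the closed unit disc in $\mathbb{R}^2$ and let $\iota:B\to F$ be an immersion, smooth up to the boundary. Let $\epsilon<R/10$, and suppose that, for the pullback metric $\iota^*g$ on $B$, the length of the boundary circle $\gamma=\partial B$ is at most $\epsilon$ and the distance in $B$ of every point of $B$ to $\gamma$ is at most $\epsilon$. Then for every $y\in B$, with $x=\iota(y)$, there is a smooth map $\tilde\iota:B\to T_xF$ such that $\iota=\exp_x\circ\,\tilde\iota$ on $B$ and $\tilde\iota(y)=0$, where $\exp_x:T_xF\to F$ is the exponential map of $g$ at $x$. -/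

import Mathlib

open Set Bundle MeasureTheory
open scoped Manifold ContDiff ENNReal

noncomputable section

/-- The Euclidean plane `ℝ²`, the model space of all surfaces. -/
abbrev Plane : Type := EuclideanSpace ℝ (Fin 2)

/-! ### Riemannian geometry of a metric `G = (g_ij)` on an open subset of the plane -/

/-- The partial derivative `∂_k f` of a real function on the plane. -/
def planePartial (k : Fin 2) (f : Plane → ℝ) (u : Plane) : ℝ :=
  fderiv ℝ f u (EuclideanSpace.single k 1)

/-- The Christoffel symbols `Γ^k_ij = ½ ∑_l g^{kl} (∂_i g_jl + ∂_j g_il - ∂_l g_ij)`. -/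
def christoffelSymbol (G : Plane → Matrix (Fin 2) (Fin 2) ℝ) (i j k : Fin 2) (u : Plane) : ℝ :=
  (1 / 2 : ℝ) * ∑ l, (G u)⁻¹ k l *
    (planePartial i (fun w => G w j l) u + planePartial j (fun w => G w i l) u
      - planePartial l (fun w => G w i j) u)

/-- The components `R^l_ijk` of the Riemann tensor, `R(∂_i, ∂_j) ∂_k = ∑_l R^l_ijk ∂_l`, where
`R(X, Y) Z = ∇_X ∇_Y Z - ∇_Y ∇_X Z - ∇_[X, Y] Z`. -/
def riemannComponent (G : Plane → Matrix (Fin 2) (Fin 2) ℝ) (i j k l : Fin 2) (u : Plane) : ℝ :=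
  planePartial i (christoffelSymbol G j k l) u - planePartial j (christoffelSymbol G i k l) u
    + ∑ m, (christoffelSymbol G i m l u * christoffelSymbol G j k m u
      - christoffelSymbol G j m l u * christoffelSymbol G i k m u)

/-- The sectional curvature `⟨R(∂_0, ∂_1) ∂_1, ∂_0⟩ / (g_00 g_11 - g_01²)` of the metric `G`. -/
def planeCurvature (G : Plane → Matrix (Fin 2) (Fin 2) ℝ) (u : Plane) : ℝ :=
  (∑ l, riemannComponent G 0 1 1 l u * G u l 0) / (G u).det

/-! ### Curvature, geodesics and the exponential map of a Riemannian surface -/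

section Surface

variable {F : Type*} [TopologicalSpace F] [ChartedSpace Plane F]
  [RiemannianBundle (fun x : F => TangentSpace 𝓘(ℝ, Plane) x)]

/-- The matrix `g_ij` of the Riemannian metric in the chart `e`, as a function on the image
of the chart (its values outside of `e.target` are irrelevant). -/
def chartMetric (e : OpenPartialHomeomorph F Plane) (u : Plane) : Matrix (Fin 2) (Fin 2) ℝ :=
  Matrix.of fun i j => inner ℝ
    (mfderiv 𝓘(ℝ, Plane) 𝓘(ℝ, Plane) e.symm u (EuclideanSpace.single i (1 : ℝ) : Plane))
    (mfderiv 𝓘(ℝ, Plane) 𝓘(ℝ, Plane) e.symm u (EuclideanSpace.single j (1 : ℝ) : Plane))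

/-- The sectional (that is, Gaussian) curvature of a Riemannian surface at `p`, computed in the
preferred chart at `p`. -/
def surfaceCurvature (p : F) : ℝ :=
  planeCurvature (chartMetric (chartAt Plane p)) (chartAt Plane p p)

/-- `γ : ℝ → F` is a geodesic: it is smooth, and in every chart of the atlas it satisfies
`u_k'' + ∑_ij Γ^k_ij(u) u_i' u_j' = 0`. -/
def IsSurfaceGeodesic (γ : ℝ → F) : Prop :=
  ContMDiff 𝓘(ℝ, ℝ) 𝓘(ℝ, Plane) ∞ γ ∧
    ∀ e ∈ atlas Plane F, ∀ t : ℝ, γ t ∈ e.source → ∀ k : Fin 2,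
      deriv (deriv fun s => e (γ s) k) t
        + ∑ i, ∑ j, christoffelSymbol (chartMetric e) i j k (e (γ t))
          * deriv (fun s => e (γ s) i) t * deriv (fun s => e (γ s) j) t = 0

/-- `γ` starts at time `0` at the point `x` with velocity `v`. -/
def HasInitialVelocity (γ : ℝ → F) (x : F) (v : TangentSpace 𝓘(ℝ, Plane) x) : Prop :=
  (⟨γ 0, mfderiv 𝓘(ℝ, ℝ) 𝓘(ℝ, Plane) γ 0 (1 : ℝ)⟩ : TangentBundle 𝓘(ℝ, Plane) F) = ⟨x, v⟩

open Classical in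
/-- The exponential map `exp_x : T_x F → F` of a complete Riemannian surface: `exp_x v = γ 1`,
where `γ : ℝ → F` is the geodesic with `γ 0 = x` and `γ' 0 = v`. (On a complete surface this
geodesic exists and is unique for all `x` and `v`; the value `x` in the other case is a
placeholder.) -/
def surfaceExp (x : F) (v : TangentSpace 𝓘(ℝ, Plane) x) : F :=
  if h : ∃ γ : ℝ → F, IsSurfaceGeodesic γ ∧ HasInitialVelocity γ x v then h.choose 1 else x

/-! ### Immersed discs and the pullback metric -/

/-- The closed unit disc `B` in the plane. -/
def unitDisc : Set Plane := Metric.closedBall 0 1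

/-- The boundary circle `∂B` of the closed unit disc. -/
def unitDiscBoundary : Set Plane := Metric.sphere 0 1

/-- `ι` restricts to a smooth (up to the boundary) immersion of the closed unit disc into `F`.
Only the values of `ι` on the disc matter. -/
def IsImmersedDisc (ι : Plane → F) : Prop :=
  ContMDiffOn 𝓘(ℝ, Plane) 𝓘(ℝ, Plane) ∞ ι unitDisc ∧
    ∀ p ∈ unitDisc, Function.Injective (mfderivWithin 𝓘(ℝ, Plane) 𝓘(ℝ, Plane) ι unitDisc p)

/-- The norm `|v|_{ι^* g} = |dι_p v|_g` of the vector `v` at `p ∈ B` for the pullback metric. -/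
def pullbackENorm (ι : Plane → F) (p v : Plane) : ℝ≥0∞ :=
  ‖mfderivWithin 𝓘(ℝ, Plane) 𝓘(ℝ, Plane) ι unitDisc p v‖ₑ

/-- The length, for the pullback metric, of a curve `c : [a, b] → B`. -/
def pullbackELength (ι : Plane → F) (c : ℝ → Plane) (a b : ℝ) : ℝ≥0∞ :=
  ∫⁻ t in Icc a b, pullbackENorm ι (c t) (derivWithin c (Icc a b) t)

/-- The length of the boundary circle `∂B` for the pullback metric. -/
def pullbackBoundaryELength (ι : Plane → F) : ℝ≥0∞ :=
  pullbackELength ι (fun θ => !₂[Real.cos θ, Real.sin θ]) 0 (2 * Real.pi)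

/-- The distance between `p` and `q` in `B` for the pullback metric: the infimum of the lengths of
the `C¹` curves in `B` that join them. -/
def pullbackEDist (ι : Plane → F) (p q : Plane) : ℝ≥0∞ :=
  ⨅ (c : ℝ → Plane) (_ : ContDiffOn ℝ 1 c (Icc 0 1)) (_ : MapsTo c (Icc 0 1) unitDisc)
    (_ : c 0 = p) (_ : c 1 = q), pullbackELength ι c 0 1

/-- The distance from `p ∈ B` to the boundary circle `∂B` for the pullback metric. -/
def pullbackBoundaryEDist (ι : Plane → F) (p : Plane) : ℝ≥0∞ :=
  ⨅ q ∈ unitDiscBoundary, pullbackEDist ι p q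

end Surface

end

/-! Let Φ be `surfaceExp x` read through a linear isometry of the plane onto the tangent plane at x.
Two facts of Riemannian geometry make Φ liftable. By the Gauss lemma Φ does not shrink radial
components (`riemForm_sq_le_rawExp`), so the norm of a lift grows along a curve by at most the
length of that curve (`IsRadialImmersion.norm_lift_le`). By the Jacobi equation in dimension two and
Sturm comparison with curvature K₀, Φ is an immersion on the disc of radius π / √K₀ = 3R
(`injective_flatDeriv_rawExp`). Since geodesics are defined here by their equation in charts, their
local existence, smooth dependence, independence of charts and completeness are established
beforehand.

Every point of B is joined to y by a chain of curves of length little more than 3ε: go to the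
boundary, follow it, come back. As 3ε < R, lifts along such chains starting at 0 stay in the disc of
radius R. Φ need not be a covering, and lifts along longer curves may leave the disc where Φ is an
immersion; so the usual monodromy argument does not apply directly. Instead ι is lifted over a
compact connected set T, a finite union of nearly shortest curves from y that is as dense in B as
desired (`exists_isTreeLift`).

The lift over T is then spread over the disc (`exists_section_of_dense`). Each vertex of a fine grid
receives a value transported from a nearby point of T; the values have norm at most 2R < 3R. Points
of one fibre of Φ in that range are r-separated, so along an edge the values either nearly agree or
jump by a definite amount. A face of the grid cannot have exactly one jumping edge, and the edges
without jump connect the grid because T is connected and dense. Since a square has no first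
cohomology modulo 2, there are no jumps (`grid_edges_eq_empty`). The values therefore belong to one
continuous lift, and a continuous lift through an immersion between surfaces is smooth. -/

noncomputable section

/-! ### Smoothness of composition operators on spaces of continuous maps -/

section Superposition

open Metric

universe u

variable {K : Type*} [TopologicalSpace K] [CompactSpace K]
  {E F : Type u} [NormedAddCommGroup E] [NormedSpace ℝ E] [NormedAddCommGroup F] [NormedSpace ℝ F]

instance : NormedAddCommGroup C(K, E →L[ℝ] F) :=
  ContinuousMap.instNormedAddCommGroup (α := K) (E := E →L[ℝ] F)

/-- Pointwise application of a continuous family of linear maps to a continuous family of vectors. -/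
def pointwiseApply : C(K, E →L[ℝ] F) →L[ℝ] (C(K, E) →L[ℝ] C(K, F)) :=
  LinearMap.mkContinuous₂
    (LinearMap.mk₂ ℝ (fun (g : C(K, E →L[ℝ] F)) (h : C(K, E)) =>
        (⟨fun t => g t (h t), by fun_prop⟩ : C(K, F)))
      (fun g g' h => by ext t; simp) (fun c g h => by ext t; simp)
      (fun g h h' => by ext t; simp) (fun c g h => by ext t; simp)) 1
    (fun g h => by
      rw [one_mul, ContinuousMap.norm_le _ (by positivity)]
      intro t
      exact ((g t).le_opNorm (h t)).trans
        (mul_le_mul (g.norm_coe_le_norm t) (h.norm_coe_le_norm t) (norm_nonneg _) (norm_nonneg _)))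

lemma norm_pointwiseApply_le (g : C(K, E →L[ℝ] F)) : ‖pointwiseApply (K := K) g‖ ≤ ‖g‖ := by
  refine ContinuousLinearMap.opNorm_le_bound _ (norm_nonneg _) fun h => ?_
  rw [ContinuousMap.norm_le _ (by positivity)]
  intro t
  exact ((g t).le_opNorm (h t)).trans
    (mul_le_mul (g.norm_coe_le_norm t) (h.norm_coe_le_norm t) (norm_nonneg _) (norm_nonneg _))

/-- The superposition operator `ζ ↦ f ∘ ζ` of a `C¹` map is differentiable. -/
lemma hasFDerivAt_comp_continuousMap (f : C(E, F)) (f' : C(E, E →L[ℝ] F))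
    (hf : ∀ x, HasFDerivAt f (f' x) x) (ζ : C(K, E)) :
    HasFDerivAt (fun ζ : C(K, E) => f.comp ζ) (pointwiseApply (f'.comp ζ)) ζ := by
  rw [hasFDerivAt_iff_isLittleO_nhds_zero, Asymptotics.isLittleO_iff]
  intro c hc
  -- Only the range of ζ is compact, and E need not be locally compact: the continuity of f' is
  -- uniform for pairs with just the first point in the range.
  have hu := (isCompact_range ζ.continuous).uniformContinuousAt_of_continuousAt f'
    (fun a _ => f'.continuous.continuousAt) (Metric.dist_mem_uniformity hc)
  obtain ⟨δ, hδ, hδ'⟩ := Metric.mem_uniformity_dist.1 hu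
  filter_upwards [Metric.ball_mem_nhds (0 : C(K, E)) hδ] with h hh
  rw [ContinuousMap.norm_le _ (by positivity)]
  intro t
  have hht : ‖h t‖ < δ := (h.norm_coe_le_norm t).trans_lt (by simpa using hh)
  have key := (convex_ball (ζ t) δ).norm_image_sub_le_of_norm_hasFDerivWithin_le'
    (f := f) (f' := f') (φ := f' (ζ t)) (C := c) (x := ζ t) (y := ζ t + h t)
    (fun x _ => (hf x).hasFDerivWithinAt)
    (fun x hx => by
      have h2 : (ζ t, x) ∈ {x : E × E | x.1 ∈ range ζ →
        (f' x.1, f' x.2) ∈ {p : (E →L[ℝ] F) × (E →L[ℝ] F) | dist p.1 p.2 < c}} :=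
          hδ' (by rw [dist_comm]; exact hx)
      have h3 := h2 ⟨t, rfl⟩
      rw [← dist_eq_norm, dist_comm]
      exact le_of_lt h3)
    (mem_ball_self hδ) (by simpa using hht)
  simp only [add_sub_cancel_left] at key
  exact key.trans (mul_le_mul_of_nonneg_left (h.norm_coe_le_norm t) hc.le)

/-- The derivative of superposition by f is, up to the bounded linear map `pointwiseApply`,
superposition by f'. The induction replaces F by `E →L[ℝ] F`, which is why F is generalised and
shares its universe with E. -/
lemma contDiff_comp_continuousMap_nat (n : ℕ) : ∀ {F : Type u} [NormedAddCommGroup F]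
    [NormedSpace ℝ F] (f : C(E, F)), ContDiff ℝ n f →
      ContDiff ℝ n (fun ζ : C(K, E) => f.comp ζ) := by
  induction n with
  | zero =>
    intro F _ _ f _
    rw [Nat.cast_zero, contDiff_zero]
    exact ContinuousMap.continuous_postcomp f
  | succ n ih =>
    intro F _ _ f hf
    push_cast at hf ⊢
    rw [contDiff_succ_iff_hasFDerivAt] at hf ⊢
    obtain ⟨f', hf', hff'⟩ := hf
    refine ⟨fun ζ => pointwiseApply ((⟨f', hf'.continuous⟩ : C(E, E →L[ℝ] F)).comp ζ), ?_,
      fun ζ => hasFDerivAt_comp_continuousMap f ⟨f', hf'.continuous⟩ hff' ζ⟩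
    exact (pointwiseApply (K := K)).contDiff.comp (ih ⟨f', hf'.continuous⟩ hf')

/-- The superposition operator `ζ ↦ f ∘ ζ` of a smooth map is smooth. -/
lemma contDiff_comp_continuousMap (f : C(E, F)) (hf : ContDiff ℝ ∞ f) :
    ContDiff ℝ ∞ (fun ζ : C(K, E) => f.comp ζ) :=
  contDiff_infty.2 fun n => contDiff_comp_continuousMap_nat n f (contDiff_infty.1 hf n)

end Superposition

/-! ### Smooth local flows by the inverse function theorem -/

section SmoothFlow

open Metric

variable {E : Type*} [NormedAddCommGroup E]

/-- The time interval on which local solutions of differential equations are constructed. -/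
abbrev FlowTime : Type := Icc (-2 : ℝ) 2

lemma zero_mem_flowTime : (0 : ℝ) ∈ Icc (-2 : ℝ) 2 := by norm_num

/-- Extension of a curve on `[-2, 2]` to the real line by constants. -/
def flowExtend (g : C(FlowTime, E)) (t : ℝ) : E := g (projIcc (-2) 2 (by norm_num) t)

lemma continuous_flowExtend (g : C(FlowTime, E)) : Continuous (flowExtend g) :=
  g.continuous.comp continuous_projIcc

lemma norm_flowExtend_le (g : C(FlowTime, E)) (t : ℝ) : ‖flowExtend g t‖ ≤ ‖g‖ :=
  g.norm_coe_le_norm _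

variable [NormedSpace ℝ E]

/-- The primitive `t ↦ ∫₀ᵗ g` of a curve on `[-2, 2]`. -/
def flowPrimitive : C(FlowTime, E) →L[ℝ] C(FlowTime, E) :=
  LinearMap.mkContinuous
    { toFun := fun g => ⟨fun t => ∫ s in (0 : ℝ)..t, flowExtend g s, by
        have := intervalIntegral.continuous_primitive (μ := volume)
          (fun a b => (continuous_flowExtend g).intervalIntegrable a b) 0
        exact this.comp continuous_subtype_val⟩
      map_add' := fun g h => by
        ext t
        simp only [ContinuousMap.coe_mk, ContinuousMap.add_apply]
        rw [← intervalIntegral.integral_add ((continuous_flowExtend g).intervalIntegrable _ _)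
          ((continuous_flowExtend h).intervalIntegrable _ _)]
        rfl
      map_smul' := fun c g => by
        ext t
        simp only [ContinuousMap.coe_mk, ContinuousMap.smul_apply, RingHom.id_apply]
        rw [← intervalIntegral.integral_smul]
        rfl } 2
    (fun g => by
      rw [ContinuousMap.norm_le _ (by positivity)]
      intro t
      have h := intervalIntegral.norm_integral_le_of_norm_le_const (a := 0) (b := (t : ℝ))
        (f := flowExtend g) (C := ‖g‖) fun s _ => norm_flowExtend_le g s
      have ht : |(t : ℝ) - 0| ≤ 2 := by rw [sub_zero, abs_le]; exact t.2
      calc _ ≤ ‖g‖ * |(t : ℝ) - 0| := h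
        _ ≤ ‖g‖ * 2 := by gcongr
        _ = _ := mul_comm _ _)

lemma flowPrimitive_apply (g : C(FlowTime, E)) (t : FlowTime) :
    flowPrimitive g t = ∫ s in (0 : ℝ)..t, flowExtend g s := rfl

/-- Smooth dependence on initial values near a zero of a smooth vector field `X`: for a small
`l > 0` the solutions of `ζ' = l X(ζ)` near that zero exist for `|t| ≤ 2` and depend smoothly on
their initial values. -/
theorem exists_smooth_flow_near_zero [CompleteSpace E] (X : E → E) (hX : ContDiff ℝ ∞ X) (z₀ : E) (h₀ : X z₀ = 0)
    (O : Set E) (hO : O ∈ nhds z₀) :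
    ∃ l : ℝ, 0 < l ∧ ∃ U : Set E, IsOpen U ∧ z₀ ∈ U ∧ ∃ ζ : E → C(FlowTime, E), ContDiffOn ℝ ∞ ζ U ∧
      ∀ z ∈ U, ζ z ⟨0, zero_mem_flowTime⟩ = z ∧ (∀ t, ζ z t ∈ O) ∧
        ∀ t ∈ Ioo (-2 : ℝ) 2, HasDerivAt (flowExtend (ζ z)) (l • X (flowExtend (ζ z) t)) t := by
  classical
  let Xc : C(E, E) := ⟨X, hX.continuous⟩
  have hX' : ContDiff ℝ ∞ (fderiv ℝ X) := hX.fderiv_right (by simp)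
  let Xc' : C(E, E →L[ℝ] E) := ⟨fderiv ℝ X, hX'.continuous⟩
  have hXd : ∀ x, HasFDerivAt Xc (Xc' x) x := fun x =>
    (hX.differentiable (by simp) x).hasFDerivAt
  let c₀ : C(FlowTime, E) := ContinuousMap.const _ z₀
  -- The time interval is fixed, so smallness comes from slowing down the field: this l makes `D ζ`
  -- a contraction for ζ near the constant curve.
  obtain ⟨l, hl, hl'⟩ : ∃ l : ℝ, 0 < l ∧ l * (‖flowPrimitive (E := E)‖ * (‖Xc'.comp c₀‖ + 1)) < 1 := by
    refine ⟨1 / (‖flowPrimitive (E := E)‖ * (‖Xc'.comp c₀‖ + 1) + 1), by positivity, ?_⟩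
    rw [div_mul_eq_mul_div, one_mul, div_lt_one (by positivity)]
    linarith
  -- The integral equation with initial value z is N ζ = const z. Inverting N near its fixed point
  -- `c₀` and restricting to constant curves gives the solutions with smooth dependence on z.
  let N : C(FlowTime, E) → C(FlowTime, E) := fun ζ => ζ - l • flowPrimitive (Xc.comp ζ)
  let D : C(FlowTime, E) → (C(FlowTime, E) →L[ℝ] C(FlowTime, E)) := fun ζ =>
    l • flowPrimitive.comp (pointwiseApply (Xc'.comp ζ))
  have hN : ContDiff ℝ ∞ N :=
    contDiff_id.sub ((flowPrimitive.contDiff.comp (contDiff_comp_continuousMap Xc hX)).const_smul l)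
  have hND : ∀ ζ, HasFDerivAt N (ContinuousLinearMap.id ℝ _ - D ζ) ζ := fun ζ => by
    refine (hasFDerivAt_id ζ).sub ?_
    exact ((flowPrimitive.hasFDerivAt.comp ζ
      (hasFDerivAt_comp_continuousMap Xc Xc' hXd ζ)).const_smul l)
  have hD : ∀ ζ, ‖Xc'.comp ζ‖ < ‖Xc'.comp c₀‖ + 1 → ‖D ζ‖ < 1 := fun ζ hζ => by
    refine lt_of_le_of_lt ?_ hl'
    refine ContinuousLinearMap.opNorm_le_bound _ (by positivity) fun h => ?_
    have h1 : D ζ h = l • flowPrimitive (pointwiseApply (Xc'.comp ζ) h) := rfl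
    have h2 : ‖pointwiseApply (Xc'.comp ζ) h‖ ≤ (‖Xc'.comp c₀‖ + 1) * ‖h‖ :=
      ((pointwiseApply (Xc'.comp ζ)).le_opNorm h).trans
        (mul_le_mul_of_nonneg_right ((norm_pointwiseApply_le _).trans hζ.le) (norm_nonneg _))
    rw [h1, norm_smul, Real.norm_of_nonneg hl.le, mul_assoc, mul_assoc]
    gcongr
    exact (flowPrimitive.le_opNorm _).trans (mul_le_mul_of_nonneg_left h2 (norm_nonneg _))
  have hequiv : ∀ ζ, ‖Xc'.comp ζ‖ < ‖Xc'.comp c₀‖ + 1 →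
      ∃ e : C(FlowTime, E) ≃L[ℝ] C(FlowTime, E),
        (e : C(FlowTime, E) →L[ℝ] C(FlowTime, E)) = ContinuousLinearMap.id ℝ _ - D ζ :=
    fun ζ hζ => ⟨ContinuousLinearEquiv.ofUnit (Units.oneSub (D ζ) (hD ζ hζ)), rfl⟩
  obtain ⟨e₀, he₀⟩ := hequiv c₀ (by linarith)
  have hN₀ : HasFDerivAt N (e₀ : C(FlowTime, E) →L[ℝ] C(FlowTime, E)) c₀ := he₀ ▸ hND c₀
  let φ := hN.contDiffAt.toOpenPartialHomeomorph N hN₀ (by simp)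
  have hφ : (φ : C(FlowTime, E) → C(FlowTime, E)) = N := rfl
  have hc₀ : N c₀ = c₀ := by
    have : Xc.comp c₀ = 0 := by ext t; exact h₀
    simp only [N, this, map_zero, smul_zero, sub_zero]
  have hmem : c₀ ∈ φ.source := hN.contDiffAt.mem_toOpenPartialHomeomorph_source hN₀ (by simp)
  have htgt : c₀ ∈ φ.target := by
    have := φ.map_source hmem
    rwa [hφ, hc₀] at this
  have hsymm₀ : φ.symm c₀ = c₀ := by
    have := φ.left_inv hmem
    rwa [hφ, hc₀] at this
  let cst : E →L[ℝ] C(FlowTime, E) := ContinuousLinearMap.const ℝ FlowTime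
  have hcst : ∀ z t, cst z t = z := fun z t => rfl
  -- On this open set the derivative of N is invertible, so the local inverse is smooth at all
  -- nearby constants and not only at `c₀`; the second condition keeps the solutions in O.
  let good : Set C(FlowTime, E) :=
    {ζ | ‖Xc'.comp ζ‖ < ‖Xc'.comp c₀‖ + 1} ∩ {ζ | MapsTo ζ univ (interior O)}
  have hgood : IsOpen good := by
    refine IsOpen.inter ?_ (ContinuousMap.isOpen_setOfPred_mapsTo isCompact_univ isOpen_interior)
    exact isOpen_lt (continuous_norm.comp (ContinuousMap.continuous_postcomp Xc')) continuous_const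
  have hgood₀ : c₀ ∈ good := ⟨by simp, fun t _ => mem_interior_iff_mem_nhds.2 hO⟩
  let V : Set C(FlowTime, E) := φ.target ∩ φ.symm ⁻¹' good
  have hV : IsOpen V := φ.isOpen_inter_preimage_symm hgood
  refine ⟨l, hl, cst ⁻¹' V, hV.preimage cst.continuous, ⟨htgt, ?_⟩, fun z => φ.symm (cst z), ?_, ?_⟩
  · change φ.symm c₀ ∈ good
    rwa [hsymm₀]
  · intro z hz
    obtain ⟨e, he⟩ := hequiv _ hz.2.1
    have h1 : ContDiffAt ℝ ∞ φ.symm (cst z) :=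
      φ.contDiffAt_symm hz.1 (f₀' := e) (by rw [he]; exact hND _) hN.contDiffAt
    exact (h1.comp z cst.contDiff.contDiffAt).contDiffWithinAt
  · intro z hz
    have hsol : N (φ.symm (cst z)) = cst z := φ.right_inv hz.1
    set ζ := φ.symm (cst z) with hζ
    have hint : ∀ t : FlowTime, ζ t = z + l • ∫ s in (0 : ℝ)..t, X (flowExtend ζ s) := fun t => by
      have := congrArg (fun g : C(FlowTime, E) => g t) hsol
      simp only [N, ContinuousMap.sub_apply, ContinuousMap.smul_apply, flowPrimitive_apply,
        hcst] at this
      rw [← this]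
      simp [flowExtend, Xc]
    refine ⟨by rw [hint]; simp, fun t => interior_subset (hz.2.2 (mem_univ t)), fun t ht => ?_⟩
    have hcont : Continuous fun s => X (flowExtend ζ s) :=
      hX.continuous.comp (continuous_flowExtend ζ)
    have hd : HasDerivAt (fun t : ℝ => z + l • ∫ s in (0 : ℝ)..t, X (flowExtend ζ s))
        (l • X (flowExtend ζ t)) t :=
      ((intervalIntegral.integral_hasDerivAt_right (hcont.intervalIntegrable _ _)
        (hcont.stronglyMeasurableAtFilter _ _) hcont.continuousAt).const_smul l).const_add z
    refine hd.congr_of_eventuallyEq ?_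
    filter_upwards [Ioo_mem_nhds ht.1 ht.2] with s hs
    have hs' : s ∈ Icc (-2 : ℝ) 2 := ⟨hs.1.le, hs.2.le⟩
    have h2 : flowExtend ζ s = ζ ⟨s, hs'⟩ := by
      unfold flowExtend
      rw [projIcc_of_mem _ hs']
    rw [h2, hint]

end SmoothFlow

end

noncomputable section

/-! ### Metrics on plane domains: compatibility, area form, curvature -/

section PlaneMetric

open Topology

/-- `G` is a smooth Riemannian metric on the subset `Ω` of the plane. -/
structure IsSmoothMetricOn (G : Plane → Matrix (Fin 2) (Fin 2) ℝ) (Ω : Set Plane) : Prop where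
  smooth : ∀ i j, ContDiffOn ℝ ∞ (fun u => G u i j) Ω
  symm : ∀ u ∈ Ω, ∀ i j, G u i j = G u j i
  pos : ∀ u ∈ Ω, ∀ a : Plane, a ≠ 0 → 0 < ∑ i, ∑ j, G u i j * a i * a j

/-- The inner product of `a` and `b` for the metric `G` at `u`. -/
def metricForm (G : Plane → Matrix (Fin 2) (Fin 2) ℝ) (u a b : Plane) : ℝ :=
  ∑ i, ∑ j, G u i j * a i * b j

/-- The bilinear map `Γ_u(a, b)` with components `∑ Γ^k_ij a_i b_j`. -/
def christoffelForm (G : Plane → Matrix (Fin 2) (Fin 2) ℝ) (u a b : Plane) : Plane :=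
  WithLp.toLp 2 fun k => ∑ i, ∑ j, christoffelSymbol G i j k u * a i * b j

/-- The area form of the metric `G` at `u`. -/
def areaForm (G : Plane → Matrix (Fin 2) (Fin 2) ℝ) (u a b : Plane) : ℝ :=
  √(G u).det * (a 0 * b 1 - a 1 * b 0)

lemma christoffelForm_apply (G : Plane → Matrix (Fin 2) (Fin 2) ℝ) (u a b : Plane) (k : Fin 2) :
    christoffelForm G u a b k = ∑ i, ∑ j, christoffelSymbol G i j k u * a i * b j := rfl

lemma fderiv_eq_sum_planePartial (f : Plane → ℝ) (u v : Plane) :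
    fderiv ℝ f u v = v 0 * planePartial 0 f u + v 1 * planePartial 1 f u := by
  have hv : v = v 0 • EuclideanSpace.single (0 : Fin 2) (1 : ℝ)
      + v 1 • EuclideanSpace.single (1 : Fin 2) (1 : ℝ) := by
    ext i; fin_cases i <;> simp
  conv_lhs => rw [hv]
  simp [planePartial]

lemma hasDerivAt_comp_plane {f : Plane → ℝ} {x : ℝ → Plane} {x' : Plane} {t : ℝ}
    (hf : DifferentiableAt ℝ f (x t)) (hx : HasDerivAt x x' t) :
    HasDerivAt (fun s => f (x s))
      (x' 0 * planePartial 0 f (x t) + x' 1 * planePartial 1 f (x t)) t := by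
  rw [← fderiv_eq_sum_planePartial]
  exact hf.hasFDerivAt.comp_hasDerivAt t hx

lemma HasDerivAt.plane_apply {x : ℝ → Plane} {x' : Plane} {t : ℝ} (hx : HasDerivAt x x' t)
    (k : Fin 2) : HasDerivAt (fun s => x s k) (x' k) t :=
  (EuclideanSpace.proj (𝕜 := ℝ) k).hasFDerivAt.comp_hasDerivAt t hx

lemma hasDerivAt_plane {x : ℝ → Plane} {x' : Plane} {t : ℝ}
    (hx : ∀ k, HasDerivAt (fun s => x s k) (x' k) t) : HasDerivAt x x' t := by
  have h : HasDerivAt (fun s => (WithLp.ofLp (x s) : Fin 2 → ℝ)) (WithLp.ofLp x') t :=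
    hasDerivAt_pi.2 hx
  exact (PiLp.continuousLinearEquiv 2 ℝ (fun _ : Fin 2 => ℝ)).symm.hasFDerivAt.comp_hasDerivAt t h

lemma planePartial_congr {f g : Plane → ℝ} {u : Plane} (h : f =ᶠ[𝓝 u] g) (k : Fin 2) :
    planePartial k f u = planePartial k g u := by
  unfold planePartial; rw [h.fderiv_eq]

lemma ContDiffOn.planePartial {f : Plane → ℝ} {Ω : Set Plane} (hΩ : IsOpen Ω)
    (hf : ContDiffOn ℝ ∞ f Ω) (k : Fin 2) : ContDiffOn ℝ ∞ (planePartial k f) Ω :=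
  (hf.fderiv_of_isOpen hΩ (m := ∞) (by simp)).clm_apply contDiffOn_const

lemma planePartial_comm {f : Plane → ℝ} {Ω : Set Plane} (hΩ : IsOpen Ω)
    (hf : ContDiffOn ℝ ∞ f Ω) {u : Plane} (hu : u ∈ Ω) (i j : Fin 2) :
    planePartial i (planePartial j f) u = planePartial j (planePartial i f) u := by
  have hat : ContDiffAt ℝ ∞ f u := hf.contDiffAt (hΩ.mem_nhds hu)
  have hd : DifferentiableAt ℝ (fderiv ℝ f) u :=
    (hat.fderiv_right (m := 1) (by norm_cast)).differentiableAt (by simp)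
  have key : ∀ k l, planePartial k (planePartial l f) u =
      fderiv ℝ (fderiv ℝ f) u (EuclideanSpace.single k 1) (EuclideanSpace.single l 1) := by
    intro k l
    have : HasFDerivAt (planePartial l f)
        ((ContinuousLinearMap.apply ℝ ℝ (EuclideanSpace.single l (1 : ℝ) : Plane)).comp
          (fderiv ℝ (fderiv ℝ f) u)) u :=
      (ContinuousLinearMap.apply ℝ ℝ (EuclideanSpace.single l (1 : ℝ) : Plane)).hasFDerivAt.comp u
        hd.hasFDerivAt
    conv_lhs => unfold planePartial
    erw [this.fderiv]
    rfl
  rw [key, key]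
  exact (hat.isSymmSndFDerivAt (by simp; exact WithTop.coe_le_coe.2 le_top)).eq _ _

variable {G : Plane → Matrix (Fin 2) (Fin 2) ℝ} {Ω : Set Plane}

namespace IsSmoothMetricOn

variable (hG : IsSmoothMetricOn G Ω)
include hG

lemma det_eq {u : Plane} (hu : u ∈ Ω) :
    (G u).det = G u 0 0 * G u 1 1 - G u 0 1 * G u 0 1 := by
  rw [Matrix.det_fin_two, hG.symm u hu 1 0]

lemma metricForm_pos {u : Plane} (hu : u ∈ Ω) {a : Plane} (ha : a ≠ 0) :
    0 < metricForm G u a a := hG.pos u hu a ha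

lemma det_pos {u : Plane} (hu : u ∈ Ω) : 0 < (G u).det := by
  have h0 : 0 < G u 0 0 := by
    have := hG.pos u hu (EuclideanSpace.single 0 1) (by
      intro h; simpa using congrArg (fun v : Plane => v 0) h)
    simpa [Fin.sum_univ_two] using this
  have h1 := hG.pos u hu (WithLp.toLp 2 ![-G u 0 1, G u 0 0]) (by
    intro h
    have := congrArg (fun v : Plane => v 1) h
    simp at this
    exact h0.ne' this)
  simp [Fin.sum_univ_two] at h1
  rw [hG.det_eq hu]
  have h2 := hG.symm u hu 1 0
  rw [h2] at h1
  have : 0 < G u 0 0 * (G u 0 0 * G u 1 1 - G u 0 1 * G u 0 1) := by nlinarith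
  exact (mul_pos_iff_of_pos_left h0).1 this

lemma inv_apply {u : Plane} (hu : u ∈ Ω) (k l : Fin 2) :
    (G u)⁻¹ k l = (G u).det⁻¹ * (!![G u 1 1, -G u 0 1; -G u 0 1, G u 0 0] : Matrix _ _ ℝ) k l := by
  rw [Matrix.inv_def, Matrix.adjugate_fin_two, Ring.inverse_eq_inv', hG.symm u hu 1 0]
  simp

lemma differentiableAt (hΩ : IsOpen Ω) {u : Plane} (hu : u ∈ Ω) (i j : Fin 2) :
    DifferentiableAt ℝ (fun w => G w i j) u :=
  ((hG.smooth i j).contDiffAt (hΩ.mem_nhds hu)).differentiableAt (by simp)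

lemma planePartial_symm (hΩ : IsOpen Ω) {u : Plane} (hu : u ∈ Ω) (i j k : Fin 2) :
    planePartial k (fun w => G w i j) u = planePartial k (fun w => G w j i) u :=
  planePartial_congr (by filter_upwards [hΩ.mem_nhds hu] with w hw using hG.symm w hw i j) k

lemma contDiffOn_det : ContDiffOn ℝ ∞ (fun u => (G u).det) Ω := by
  have : ContDiffOn ℝ ∞ (fun u => G u 0 0 * G u 1 1 - G u 0 1 * G u 0 1) Ω :=
    ((hG.smooth 0 0).mul (hG.smooth 1 1)).sub ((hG.smooth 0 1).mul (hG.smooth 0 1))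
  exact this.congr fun u hu => hG.det_eq hu

lemma contDiffOn_christoffelSymbol (hΩ : IsOpen Ω) (i j k : Fin 2) :
    ContDiffOn ℝ ∞ (christoffelSymbol G i j k) Ω := by
  have hinv : ∀ k l, ContDiffOn ℝ ∞ (fun u => (G u)⁻¹ k l) Ω := by
    intro k l
    have h1 : ContDiffOn ℝ ∞ (fun u => (G u).det⁻¹ *
        (!![G u 1 1, -G u 0 1; -G u 0 1, G u 0 0] : Matrix _ _ ℝ) k l) Ω := by
      refine (hG.contDiffOn_det.inv fun u hu => (hG.det_pos hu).ne').mul ?_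
      fin_cases k <;> fin_cases l
      · exact hG.smooth 1 1
      · exact (hG.smooth 0 1).neg
      · exact (hG.smooth 0 1).neg
      · exact hG.smooth 0 0
    exact h1.congr fun u hu => hG.inv_apply hu k l
  have hp := fun i j k => (hG.smooth i j).planePartial hΩ k
  exact contDiffOn_const.mul (ContDiffOn.sum fun l _ =>
    (hinv k l).mul (((hp j l i).add (hp i l j)).sub (hp i j l)))

lemma differentiableAt_christoffelSymbol (hΩ : IsOpen Ω) {u : Plane} (hu : u ∈ Ω)
    (i j k : Fin 2) : DifferentiableAt ℝ (christoffelSymbol G i j k) u :=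
  ((hG.contDiffOn_christoffelSymbol hΩ i j k).contDiffAt (hΩ.mem_nhds hu)).differentiableAt
    (by simp)

lemma christoffelSymbol_symm (hΩ : IsOpen Ω) {u : Plane} (hu : u ∈ Ω) (i j k : Fin 2) :
    christoffelSymbol G i j k u = christoffelSymbol G j i k u := by
  unfold christoffelSymbol
  congr 1
  refine Finset.sum_congr rfl fun l _ => ?_
  rw [hG.planePartial_symm hΩ hu i j l]
  ring

/-- The Christoffel symbols of the first kind. -/
lemma lower_christoffelSymbol {u : Plane} (hu : u ∈ Ω) (i j p : Fin 2) :
    ∑ k, G u k p * christoffelSymbol G i j k u =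
      (1 / 2 : ℝ) * (planePartial i (fun w => G w j p) u + planePartial j (fun w => G w i p) u
      - planePartial p (fun w => G w i j) u) := by
  have hd : IsUnit (G u).det := (hG.det_pos hu).ne'.isUnit
  have h1 : ∀ l, ∑ k, G u k p * (G u)⁻¹ k l = if p = l then 1 else 0 := fun l => by
    rw [← Matrix.one_apply, ← Matrix.mul_nonsing_inv _ hd, Matrix.mul_apply]
    exact Finset.sum_congr rfl fun k _ => by rw [hG.symm u hu k p]
  have h2 : ∑ k, G u k p * christoffelSymbol G i j k u = (1 / 2 : ℝ) *
      ∑ l, (∑ k, G u k p * (G u)⁻¹ k l) *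
        (planePartial i (fun w => G w j l) u + planePartial j (fun w => G w i l) u
          - planePartial l (fun w => G w i j) u) := by
    simp only [christoffelSymbol, Fin.sum_univ_two]
    ring
  rw [h2]
  simp [h1]

/-- Compatibility of the Christoffel symbols with the metric. -/
lemma planePartial_metric (hΩ : IsOpen Ω) {u : Plane} (hu : u ∈ Ω) (m i j : Fin 2) :
    planePartial m (fun w => G w i j) u =
      ∑ k, (christoffelSymbol G m i k u * G u k j + christoffelSymbol G m j k u * G u k i) := by
  have h1 := hG.lower_christoffelSymbol hu m i j
  have h2 := hG.lower_christoffelSymbol hu m j i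
  have h3 := hG.planePartial_symm hΩ hu i j m
  have h4 : ∑ k, (christoffelSymbol G m i k u * G u k j + christoffelSymbol G m j k u * G u k i)
    = ∑ k, G u k j * christoffelSymbol G m i k u + ∑ k, G u k i * christoffelSymbol G m j k u := by
    rw [← Finset.sum_add_distrib]
    exact Finset.sum_congr rfl fun k _ => by ring
  rw [h4, h1, h2, h3]
  ring

/-- The metric is parallel: derivative of the inner product of two vector fields along a curve. -/
lemma hasDerivAt_metricForm (hΩ : IsOpen Ω) {x a b : ℝ → Plane} {x' a' b' : Plane} {t : ℝ}
    (hu : x t ∈ Ω) (hx : HasDerivAt x x' t) (ha : HasDerivAt a a' t) (hb : HasDerivAt b b' t) :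
    HasDerivAt (fun s => metricForm G (x s) (a s) (b s))
      (metricForm G (x t) (a' + christoffelForm G (x t) x' (a t)) (b t)
        + metricForm G (x t) (a t) (b' + christoffelForm G (x t) x' (b t))) t := by
  have h := fun i j : Fin 2 => ((hasDerivAt_comp_plane (hG.differentiableAt hΩ hu i j) hx).mul
    (ha.plane_apply i)).mul (hb.plane_apply j)
  have h2 := HasDerivAt.fun_sum (u := Finset.univ) fun (i : Fin 2) _ =>
    HasDerivAt.fun_sum (u := Finset.univ) fun (j : Fin 2) _ => h i j
  refine h2.congr_deriv ?_
  simp only [metricForm, christoffelForm_apply, PiLp.add_apply, Fin.sum_univ_two, Pi.mul_apply,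
    hG.planePartial_metric hΩ hu, hG.symm _ hu 1 0]
  ring

/-- The area form is parallel. -/
lemma hasDerivAt_areaForm (hΩ : IsOpen Ω) {x a b : ℝ → Plane} {x' a' b' : Plane} {t : ℝ}
    (hu : x t ∈ Ω) (hx : HasDerivAt x x' t) (ha : HasDerivAt a a' t) (hb : HasDerivAt b b' t) :
    HasDerivAt (fun s => areaForm G (x s) (a s) (b s))
      (areaForm G (x t) (a' + christoffelForm G (x t) x' (a t)) (b t)
        + areaForm G (x t) (a t) (b' + christoffelForm G (x t) x' (b t))) t := by
  have hdet := (hG.det_pos hu).ne'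
  have hev : ∀ᶠ s in 𝓝 t, x s ∈ Ω := hx.continuousAt.eventually_mem (hΩ.mem_nhds hu)
  have g := fun i j : Fin 2 => hasDerivAt_comp_plane (hG.differentiableAt hΩ hu i j) hx
  -- Jacobi's formula: the logarithmic derivative of the determinant is twice the trace of Γ(x', ·).
  -- Its half will be the trace that arises when Γ(x', ·) acts on both arguments of a 2-form.
  have h1 : HasDerivAt (fun s => (G (x s)).det)
      ((2 * ∑ m, ∑ k, x' m * christoffelSymbol G m k k (x t)) * (G (x t)).det) t := by
    have h2 := ((g 0 0).mul (g 1 1)).sub ((g 0 1).mul (g 0 1))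
    refine (h2.congr_of_eventuallyEq (hev.mono fun s hs => hG.det_eq hs)).congr_deriv ?_
    simp only [hG.planePartial_metric hΩ hu, Fin.sum_univ_two, hG.det_eq hu, hG.symm _ hu 1 0]
    ring
  have h3 := (h1.sqrt hdet).mul (((ha.plane_apply 0).mul (hb.plane_apply 1)).sub
    ((ha.plane_apply 1).mul (hb.plane_apply 0)))
  refine h3.congr_deriv ?_
  have h5 : 2 * (∑ m, ∑ k, x' m * christoffelSymbol G m k k (x t)) * (G (x t)).det /
      (2 * √(G (x t)).det) =
      (∑ m, ∑ k, x' m * christoffelSymbol G m k k (x t)) * √(G (x t)).det := by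
    have h6 : 0 < √(G (x t)).det := Real.sqrt_pos.2 (hG.det_pos hu)
    rw [div_eq_iff (by positivity)]
    have h7 := Real.mul_self_sqrt (hG.det_pos hu).le
    linear_combination (-2 * ∑ m, ∑ k, x' m * christoffelSymbol G m k k (x t)) * h7
  rw [h5]
  simp only [areaForm, christoffelForm_apply, PiLp.add_apply, Fin.sum_univ_two,
    Pi.sub_apply, Pi.mul_apply]
  ring

/-- The curvature endomorphism is skew-symmetric for the metric. -/
lemma riemannComponent_skew (hΩ : IsOpen Ω) {u : Plane} (hu : u ∈ Ω) (k p : Fin 2) :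
    ∑ l, riemannComponent G 0 1 k l u * G u l p +
      ∑ l, riemannComponent G 0 1 p l u * G u l k = 0 := by
  have hd := hG.differentiableAt hΩ hu
  have hc := hG.differentiableAt_christoffelSymbol hΩ hu
  -- Metric compatibility is differentiated once more; the equality of mixed second derivatives of
  -- g_kp is then the asserted skew-symmetry.
  have key : ∀ m n : Fin 2, planePartial n (planePartial m (fun w => G w k p)) u =
      ∑ l, (planePartial n (christoffelSymbol G m k l) u * G u l p
        + christoffelSymbol G m k l u * planePartial n (fun w => G w l p) u
        + (planePartial n (christoffelSymbol G m p l) u * G u l k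
        + christoffelSymbol G m p l u * planePartial n (fun w => G w l k) u)) := by
    intro m n
    have h1 : planePartial m (fun w => G w k p) =ᶠ[𝓝 u] fun w =>
        ∑ l, (christoffelSymbol G m k l w * G w l p + christoffelSymbol G m p l w * G w l k) := by
      filter_upwards [hΩ.mem_nhds hu] with w hw using hG.planePartial_metric hΩ hw m k p
    rw [planePartial_congr h1]
    have h2 : HasFDerivAt (fun w =>
        ∑ l, (christoffelSymbol G m k l w * G w l p + christoffelSymbol G m p l w * G w l k)) _ u :=
      HasFDerivAt.fun_sum (u := Finset.univ) fun l _ =>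
        ((hc m k l).hasFDerivAt.mul (hd l p).hasFDerivAt).add
          ((hc m p l).hasFDerivAt.mul (hd l k).hasFDerivAt)
    unfold planePartial
    rw [h2.fderiv]
    simp [Fin.sum_univ_two]
    ring
  have h := planePartial_comm hΩ (hG.smooth k p) hu 0 1
  rw [key, key] at h
  simp only [Fin.sum_univ_two, hG.planePartial_metric hΩ hu, hG.symm _ hu 1 0] at h
  simp only [riemannComponent, Fin.sum_univ_two]
  fin_cases k <;> fin_cases p <;>
    simp only [Fin.zero_eta, Fin.mk_one, hG.symm _ hu 1 0] at h ⊢ <;> linear_combination h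

/-- In dimension two the curvature endomorphism is determined by the Gaussian curvature. -/
lemma areaForm_riemann (hΩ : IsOpen Ω) {u : Plane} (hu : u ∈ Ω) (a : Plane) :
    areaForm G u a (WithLp.toLp 2 fun l => ∑ k, riemannComponent G 0 1 k l u * a k) =
      -(planeCurvature G u * metricForm G u a a * √(G u).det) := by
  have h00 := hG.riemannComponent_skew hΩ hu 0 0
  have h01 := hG.riemannComponent_skew hΩ hu 0 1
  have h11 := hG.riemannComponent_skew hΩ hu 1 1
  have hdet := (hG.det_pos hu).ne'
  unfold areaForm planeCurvature metricForm
  simp only [Fin.sum_univ_two, hG.symm u hu 1 0] at *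
  set D := (G u).det with hD
  rw [hG.det_eq hu] at hD
  set A := G u 0 0
  set B := G u 0 1
  set C := G u 1 1
  set r00 := riemannComponent G 0 1 0 0 u
  set r01 := riemannComponent G 0 1 0 1 u
  set r10 := riemannComponent G 0 1 1 0 u
  set r11 := riemannComponent G 0 1 1 1 u
  have e1 : r00 * A + r01 * B = 0 := by linarith
  have e2 : r10 * B + r11 * C = 0 := by linarith
  -- The skew-symmetry relations leave one free parameter in the curvature endomorphism, the one
  -- that also enters `planeCurvature`.
  have e3 : D * (a 0 * (r01 * a 0 + r11 * a 1) - a 1 * (r00 * a 0 + r10 * a 1)) =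
      -((r10 * A + r11 * B) * (A * a 0 * a 0 + B * a 0 * a 1 + (B * a 1 * a 0 + C * a 1 * a 1))) := by
    rw [hD]
    linear_combination (a 0 ^ 2) * (A * h01 - B * e1) + (a 1 ^ 2) * B * e2
      + a 0 * a 1 * (B * h01 + A * e2 - C * e1)
  rw [mul_comm, ← neg_mul]
  congr 1
  rw [← mul_right_inj' hdet, e3]
  field_simp

end IsSmoothMetricOn

end PlaneMetric

end

noncomputable section

/-! ### Partial derivatives of maps of two real variables -/

section TwoParameter

open Topology

variable {E : Type*} [NormedAddCommGroup E] [NormedSpace ℝ E]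

/-- The partial derivative `∂_s f` of a function of `(s, t)`. -/
def partialS (f : ℝ × ℝ → E) (p : ℝ × ℝ) : E := fderiv ℝ f p (1, 0)

/-- The partial derivative `∂_t f` of a function of `(s, t)`. -/
def partialT (f : ℝ × ℝ → E) (p : ℝ × ℝ) : E := fderiv ℝ f p (0, 1)

variable {f : ℝ × ℝ → E} {W : Set (ℝ × ℝ)}

lemma ContDiffOn.partialS (hW : IsOpen W) (hf : ContDiffOn ℝ ∞ f W) :
    ContDiffOn ℝ ∞ (partialS f) W :=
  (hf.fderiv_of_isOpen hW (m := ∞) (by simp)).clm_apply contDiffOn_const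

lemma ContDiffOn.partialT (hW : IsOpen W) (hf : ContDiffOn ℝ ∞ f W) :
    ContDiffOn ℝ ∞ (partialT f) W :=
  (hf.fderiv_of_isOpen hW (m := ∞) (by simp)).clm_apply contDiffOn_const

lemma partialS_partialT_comm (hW : IsOpen W) (hf : ContDiffOn ℝ ∞ f W) {p : ℝ × ℝ} (hp : p ∈ W) :
    partialS (partialT f) p = partialT (partialS f) p := by
  have hat : ContDiffAt ℝ ∞ f p := hf.contDiffAt (hW.mem_nhds hp)
  have hd : DifferentiableAt ℝ (fderiv ℝ f) p :=
    (hat.fderiv_right (m := 1) (by norm_cast)).differentiableAt (by simp)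
  have key : ∀ v w : ℝ × ℝ, fderiv ℝ (fun q => fderiv ℝ f q v) p w =
      fderiv ℝ (fderiv ℝ f) p w v := by
    intro v w
    have : HasFDerivAt (fun q => fderiv ℝ f q v)
        ((ContinuousLinearMap.apply ℝ E v).comp (fderiv ℝ (fderiv ℝ f) p)) p :=
      (ContinuousLinearMap.apply ℝ E v).hasFDerivAt.comp p hd.hasFDerivAt
    rw [this.fderiv]
    rfl
  have h1 : partialS (partialT f) p = fderiv ℝ (fderiv ℝ f) p (1, 0) (0, 1) := key _ _
  have h2 : partialT (partialS f) p = fderiv ℝ (fderiv ℝ f) p (0, 1) (1, 0) := key _ _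
  rw [h1, h2]
  exact (hat.isSymmSndFDerivAt (by simp; exact WithTop.coe_le_coe.2 le_top)).eq _ _

lemma hasDerivAt_partialT {s t : ℝ} (hf : DifferentiableAt ℝ f (s, t)) :
    HasDerivAt (fun t => f (s, t)) (partialT f (s, t)) t :=
  hf.hasFDerivAt.comp_hasDerivAt t ((hasDerivAt_const t s).prodMk (hasDerivAt_id t))

lemma hasDerivAt_partialS {s t : ℝ} (hf : DifferentiableAt ℝ f (s, t)) :
    HasDerivAt (fun s => f (s, t)) (partialS f (s, t)) s :=
  HasFDerivAt.comp_hasDerivAt (f := fun s : ℝ => (s, t)) s hf.hasFDerivAt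
    ((hasDerivAt_id s).prodMk (hasDerivAt_const s t))

lemma ContDiffOn.differentiableAt_of_isOpen (hW : IsOpen W) (hf : ContDiffOn ℝ ∞ f W)
    {p : ℝ × ℝ} (hp : p ∈ W) : DifferentiableAt ℝ f p :=
  (hf.contDiffAt (hW.mem_nhds hp)).differentiableAt (by simp)

end TwoParameter

/-! ### The Jacobi equation and local geodesics in a plane domain -/

section PlaneGeodesics

open Topology

variable {G : Plane → Matrix (Fin 2) (Fin 2) ℝ} {Ω : Set Plane}

/-- The directional derivative of the Christoffel map `Γ_u(a, b)` in its base point. -/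
def christoffelDeriv (G : Plane → Matrix (Fin 2) (Fin 2) ℝ) (u v a b : Plane) : Plane :=
  WithLp.toLp 2 fun k => ∑ i, ∑ j, (v 0 * planePartial 0 (christoffelSymbol G i j k) u
    + v 1 * planePartial 1 (christoffelSymbol G i j k) u) * a i * b j

lemma christoffelDeriv_apply (G : Plane → Matrix (Fin 2) (Fin 2) ℝ) (u v a b : Plane) (k : Fin 2) :
    christoffelDeriv G u v a b k =
      ∑ i, ∑ j, (v 0 * planePartial 0 (christoffelSymbol G i j k) u
    + v 1 * planePartial 1 (christoffelSymbol G i j k) u) * a i * b j := rfl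

namespace IsSmoothMetricOn

variable (hG : IsSmoothMetricOn G Ω)
include hG

lemma hasDerivAt_christoffelForm (hΩ : IsOpen Ω) {x a b : ℝ → Plane} {x' a' b' : Plane} {t : ℝ}
    (hu : x t ∈ Ω) (hx : HasDerivAt x x' t) (ha : HasDerivAt a a' t) (hb : HasDerivAt b b' t) :
    HasDerivAt (fun s => christoffelForm G (x s) (a s) (b s))
      (christoffelDeriv G (x t) x' (a t) (b t) + christoffelForm G (x t) a' (b t)
        + christoffelForm G (x t) (a t) b') t := by
  refine hasDerivAt_plane fun k => ?_
  have h := fun i j : Fin 2 => ((hasDerivAt_comp_plane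
    (hG.differentiableAt_christoffelSymbol hΩ hu i j k) hx).mul
    (ha.plane_apply i)).mul (hb.plane_apply j)
  have h2 := HasDerivAt.fun_sum (u := Finset.univ) fun (i : Fin 2) _ =>
    HasDerivAt.fun_sum (u := Finset.univ) fun (j : Fin 2) _ => h i j
  refine h2.congr_deriv ?_
  simp only [christoffelForm_apply, christoffelDeriv_apply, PiLp.add_apply, Fin.sum_univ_two,
    Pi.mul_apply]
  ring

lemma christoffelForm_comm (hΩ : IsOpen Ω) {u : Plane} (hu : u ∈ Ω) (a b : Plane) :
    christoffelForm G u a b = christoffelForm G u b a := by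
  ext k
  simp only [christoffelForm_apply, Fin.sum_univ_two, hG.christoffelSymbol_symm hΩ hu 1 0]
  ring

lemma metricForm_comm {u : Plane} (hu : u ∈ Ω) (a b : Plane) :
    metricForm G u a b = metricForm G u b a := by
  simp only [metricForm, Fin.sum_univ_two, hG.symm u hu 1 0]
  ring

/-- The Jacobi equation in dimension two: for a one-parameter family `u(s, ·)` of geodesics, the
area `z = ω(u_t, u_s)` satisfies `z'' = -K |u_t|² z`. -/
lemma hasDerivAt_areaForm_variation (hΩ : IsOpen Ω) {u : ℝ × ℝ → Plane} {W : Set (ℝ × ℝ)}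
    (hW : IsOpen W) (hu : ContDiffOn ℝ ∞ u W) (huΩ : MapsTo u W Ω)
    (hgeo : ∀ p ∈ W, partialT (partialT u) p =
      -christoffelForm G (u p) (partialT u p) (partialT u p)) {s t : ℝ} (hp : (s, t) ∈ W) :
    HasDerivAt (fun t => areaForm G (u (s, t)) (partialT u (s, t)) (partialS u (s, t)))
      (areaForm G (u (s, t)) (partialT u (s, t)) (partialT (partialS u) (s, t) +
        christoffelForm G (u (s, t)) (partialT u (s, t)) (partialS u (s, t)))) t ∧
    HasDerivAt (fun t => areaForm G (u (s, t)) (partialT u (s, t)) (partialT (partialS u) (s, t) +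
        christoffelForm G (u (s, t)) (partialT u (s, t)) (partialS u (s, t))))
      (-(planeCurvature G (u (s, t)) * metricForm G (u (s, t)) (partialT u (s, t))
        (partialT u (s, t)) *
          areaForm G (u (s, t)) (partialT u (s, t)) (partialS u (s, t)))) t := by
  have hT := hu.partialT hW
  have hS := hu.partialS hW
  have hTS := hS.partialT hW
  have dx := hasDerivAt_partialT (hu.differentiableAt_of_isOpen hW hp)
  have da := hasDerivAt_partialT (hT.differentiableAt_of_isOpen hW hp)
  have dj := hasDerivAt_partialT (hS.differentiableAt_of_isOpen hW hp)
  have db := hasDerivAt_partialT (hTS.differentiableAt_of_isOpen hW hp)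
  have hΩp := huΩ hp
  rw [hgeo _ hp] at da
  -- the third derivative `u_stt`
  have hb : partialT (partialT (partialS u)) (s, t) =
      -(christoffelDeriv G (u (s, t)) (partialS u (s, t)) (partialT u (s, t)) (partialT u (s, t))
        + christoffelForm G (u (s, t)) (partialT (partialS u) (s, t)) (partialT u (s, t))
        + christoffelForm G (u (s, t)) (partialT u (s, t)) (partialT (partialS u) (s, t))) := by
    have e1 : partialT (partialT (partialS u)) (s, t) = partialS (partialT (partialT u)) (s, t) := by
      rw [partialS_partialT_comm hW hT hp]
      unfold partialT
      congr 1
      refine Filter.EventuallyEq.fderiv_eq ?_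
      filter_upwards [hW.mem_nhds hp] with q hq
      exact (partialS_partialT_comm hW hu hq).symm
    have e2 := hasDerivAt_partialS ((hT.partialT hW).differentiableAt_of_isOpen hW hp)
    have e3 := hG.hasDerivAt_christoffelForm hΩ (x := fun s => u (s, t))
      (a := fun s => partialT u (s, t)) (b := fun s => partialT u (s, t)) (t := s) hΩp
      (hasDerivAt_partialS (hu.differentiableAt_of_isOpen hW hp))
      (hasDerivAt_partialS (hT.differentiableAt_of_isOpen hW hp))
      (hasDerivAt_partialS (hT.differentiableAt_of_isOpen hW hp))
    have hev : ∀ᶠ r in 𝓝 s, (r, t) ∈ W :=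
      (by fun_prop : Continuous fun r : ℝ => (r, t)).continuousAt.eventually_mem (hW.mem_nhds hp)
    have e4 := e3.neg.congr_of_eventuallyEq (hev.mono fun r hr => hgeo _ hr)
    rw [e1, e2.unique e4, partialS_partialT_comm hW hu hp]
  rw [hb] at db
  have dW := db.fun_add (hG.hasDerivAt_christoffelForm hΩ (x := fun t => u (s, t))
    (a := fun t => partialT u (s, t)) (b := fun t => partialS u (s, t)) (t := t) hΩp dx da dj)
  have A1 := hG.hasDerivAt_areaForm hΩ (x := fun t => u (s, t))
    (a := fun t => partialT u (s, t)) (b := fun t => partialS u (s, t)) (t := t) hΩp dx da dj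
  have A2 := hG.hasDerivAt_areaForm hΩ (x := fun t => u (s, t)) (t := t) hΩp dx da dW
  -- The covariant derivative of u_t along a geodesic vanishes, so in both product rules only the
  -- term with the derivative of the second argument survives.
  have z0 : ∀ c : Plane, areaForm G (u (s, t)) 0 c = 0 := fun c => by simp [areaForm]
  simp only [neg_add_cancel, z0, zero_add] at A1 A2
  refine ⟨A1, A2.congr_deriv ?_⟩
  set x := u (s, t)
  set a := partialT u (s, t)
  set j := partialS u (s, t)
  set b := partialT (partialS u) (s, t)
  -- The second covariant derivative of u_s along the geodesic equals R(u_t, u_s) u_t, and by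
  -- bilinearity and antisymmetry R(a, j) = (a₀ j₁ - a₁ j₀) R(∂₀, ∂₁).
  have key : -(christoffelDeriv G x j a a + christoffelForm G x b a + christoffelForm G x a b) +
      (christoffelDeriv G x a a j + christoffelForm G x (-christoffelForm G x a a) j +
        christoffelForm G x a b) + christoffelForm G x a (b + christoffelForm G x a j) =
      (a 0 * j 1 - a 1 * j 0) •
        (WithLp.toLp 2 fun l => ∑ k, riemannComponent G 0 1 k l x * a k : Plane) := by
    have hs : ∀ k, christoffelSymbol G 1 0 k x = christoffelSymbol G 0 1 k x := fun k =>
      hG.christoffelSymbol_symm hΩ hΩp 1 0 k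
    have hs' : ∀ k m, planePartial m (christoffelSymbol G 1 0 k) x =
        planePartial m (christoffelSymbol G 0 1 k) x := fun k m => by
      refine planePartial_congr ?_ m
      filter_upwards [hΩ.mem_nhds hΩp] with w hw using hG.christoffelSymbol_symm hΩ hw 1 0 k
    ext l
    simp only [christoffelForm_apply, christoffelDeriv_apply, PiLp.add_apply, PiLp.neg_apply,
      PiLp.smul_apply, smul_eq_mul, Fin.sum_univ_two, riemannComponent, hs, hs']
    ring
  rw [key]
  have hsm : ∀ (c : ℝ) (v : Plane), areaForm G x a (c • v) = c * areaForm G x a v := fun c v => by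
    simp [areaForm]; ring
  rw [hsm, hG.areaForm_riemann hΩ hΩp a]
  simp only [areaForm]
  ring

end IsSmoothMetricOn

/-- Local existence of geodesics, with smooth dependence on initial position and velocity. -/
theorem IsSmoothMetricOn.exists_local_exp (hG : IsSmoothMetricOn G Ω) (hΩ : IsOpen Ω) {u₀ : Plane}
    (hu₀ : u₀ ∈ Ω) :
    ∃ U : Set (Plane × Plane), IsOpen U ∧ (u₀, 0) ∈ U ∧
      ∃ c c' : Plane × Plane → ℝ → Plane, ContDiffOn ℝ ∞ (fun z => c z 1) U ∧
        ∀ z ∈ U, c z 0 = z.1 ∧ c' z 0 = z.2 ∧ ∀ t ∈ Ioo (-2 : ℝ) 2, c z t ∈ Ω ∧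
          HasDerivAt (c z) (c' z t) t ∧
          HasDerivAt (c' z) (-christoffelForm G (c z t) (c' z t) (c' z t)) t := by
  obtain ⟨r, hr, hrΩ⟩ := Metric.isOpen_iff.1 hΩ u₀ hu₀
  -- The cut-off extends the geodesic field smoothly to the whole plane. It equals 1 on the ball of
  -- radius r / 4, in which the solutions are kept.
  let χ : ContDiffBump u₀ := ⟨r / 4, r / 2, by positivity, by linarith⟩
  have hχΩ : tsupport χ ⊆ Ω := by
    rw [χ.tsupport_eq]
    exact (Metric.closedBall_subset_ball (by change r / 2 < r; linarith)).trans hrΩ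
  have hs : ∀ i j k, ContDiff ℝ ∞ (fun u => χ u * christoffelSymbol G i j k u) := fun i j k => by
    refine (contMDiff_of_tsupport (I := 𝓘(ℝ, Plane)) (I' := 𝓘(ℝ, ℝ)) fun x hx => ContDiffAt.contMDiffAt ?_).contDiff
    have hx' : x ∈ Ω := hχΩ (tsupport_mul_subset_left hx)
    exact χ.contDiff.contDiffAt.mul
      ((hG.contDiffOn_christoffelSymbol hΩ i j k).contDiffAt (hΩ.mem_nhds hx'))
  let X : Plane × Plane → Plane × Plane := fun z => (z.2, WithLp.toLp 2 fun k =>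
    -∑ i, ∑ j, χ z.1 * christoffelSymbol G i j k z.1 * z.2 i * z.2 j)
  have hX : ContDiff ℝ ∞ X := by
    refine contDiff_snd.prodMk ?_
    rw [contDiff_piLp]
    intro k
    refine ContDiff.neg (ContDiff.sum fun i _ => ContDiff.sum fun j _ => ?_)
    have hc : ∀ i : Fin 2, ContDiff ℝ ∞ fun z : Plane × Plane => z.2 i := fun i =>
      (EuclideanSpace.proj (𝕜 := ℝ) i).contDiff.comp contDiff_snd
    exact (((hs i j k).comp contDiff_fst).mul (hc i)).mul (hc j)
  have hX₀ : X (u₀, 0) = 0 := by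
    ext k <;> simp [X]
  obtain ⟨l, hl, U, hU, hU₀, ζ, hζ, hsol⟩ := exists_smooth_flow_near_zero X hX (u₀, 0) hX₀
    (Metric.ball u₀ (r / 4) ×ˢ univ)
    (prod_mem_nhds (Metric.ball_mem_nhds _ (by positivity)) Filter.univ_mem)
  -- If (p, q) solves ζ' = l X(ζ), then p has velocity l q and, Γ being quadratic in the velocity, p
  -- solves the unscaled geodesic equation. Initial velocity v thus requires q = l⁻¹ v at time 0.
  let sc : Plane × Plane → Plane × Plane := fun z => (z.1, l⁻¹ • z.2)
  have hsc : ContDiff ℝ ∞ sc := contDiff_fst.prodMk (contDiff_snd.const_smul _)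
  refine ⟨sc ⁻¹' U, hU.preimage hsc.continuous, by simpa [sc] using hU₀,
    fun z t => (flowExtend (ζ (sc z)) t).1, fun z t => l • (flowExtend (ζ (sc z)) t).2, ?_, ?_⟩
  · have h1 : ContDiffOn ℝ ∞ (fun z => ζ (sc z)) (sc ⁻¹' U) :=
      hζ.comp hsc.contDiffOn (fun z hz => hz)
    let ev : C(FlowTime, Plane × Plane) →L[ℝ] Plane × Plane :=
      ContinuousMap.evalCLM ℝ (projIcc (-2) 2 (by norm_num) 1)
    exact contDiff_fst.comp_contDiffOn (ev.contDiff.comp_contDiffOn h1)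
  · intro z hz
    obtain ⟨h0, hO, hd⟩ := hsol _ hz
    have h0' : flowExtend (ζ (sc z)) 0 = sc z := by
      unfold flowExtend
      rw [projIcc_of_mem _ zero_mem_flowTime, h0]
    refine ⟨by simp [h0', sc], by simp [h0', sc, hl.ne'], fun t ht => ?_⟩
    have hball : (flowExtend (ζ (sc z)) t).1 ∈ Metric.ball u₀ (r / 4) := (hO _).1
    have hχ1 : χ (flowExtend (ζ (sc z)) t).1 = 1 :=
      χ.one_of_mem_closedBall (Metric.ball_subset_closedBall hball)
    refine ⟨hrΩ (Metric.ball_subset_ball (by linarith) hball), (hd t ht).fst, ?_⟩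
    have h2 : HasDerivAt (fun t => (flowExtend (ζ (sc z)) t).2)
      (l • X (flowExtend (ζ (sc z)) t)).2 t := (hd t ht).snd
    refine (h2.const_smul l).congr_deriv ?_
    ext k
    simp only [X, Prod.smul_snd, PiLp.smul_apply, PiLp.neg_apply, smul_eq_mul,
      christoffelForm_apply, hχ1, Fin.sum_univ_two]
    ring

end PlaneGeodesics

end

noncomputable section

/-! ### The Riemannian metric in charts -/

section ChartMetric

open Topology

variable {F : Type*} [TopologicalSpace F] [ChartedSpace Plane F]

/-- The derivative of a map from a vector space to a surface, as a map to the model plane. -/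
def flatDeriv {E : Type*} [NormedAddCommGroup E] [NormedSpace ℝ E] (f : E → F) (p : E) :
    E →L[ℝ] Plane :=
  mfderiv 𝓘(ℝ, E) 𝓘(ℝ, Plane) f p

/-- The derivative of a chart, as a map of the model plane. -/
def chartDeriv (e : OpenPartialHomeomorph F Plane) (q : F) : Plane →L[ℝ] Plane :=
  mfderiv 𝓘(ℝ, Plane) 𝓘(ℝ, Plane) e q

section

variable [RiemannianBundle (fun x : F => TangentSpace 𝓘(ℝ, Plane) x)]

/-- The Riemannian inner product at `q` of two vectors of the model plane. -/
def riemForm (q : F) (a b : Plane) : ℝ := @inner ℝ (TangentSpace 𝓘(ℝ, Plane) q) _ a b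

lemma riemForm_add_left (q : F) (a b c : Plane) :
    riemForm q (a + b) c = riemForm q a c + riemForm q b c :=
  inner_add_left (E := TangentSpace 𝓘(ℝ, Plane) q) _ _ _

lemma riemForm_add_right (q : F) (a b c : Plane) :
    riemForm q a (b + c) = riemForm q a b + riemForm q a c :=
  inner_add_right (E := TangentSpace 𝓘(ℝ, Plane) q) _ _ _

lemma riemForm_smul_left (q : F) (r : ℝ) (a b : Plane) :
    riemForm q (r • a) b = r * riemForm q a b :=
  real_inner_smul_left (F := TangentSpace 𝓘(ℝ, Plane) q) _ _ _

lemma riemForm_smul_right (q : F) (r : ℝ) (a b : Plane) :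
    riemForm q a (r • b) = r * riemForm q a b :=
  real_inner_smul_right (F := TangentSpace 𝓘(ℝ, Plane) q) _ _ _

lemma riemForm_comm (q : F) (a b : Plane) : riemForm q a b = riemForm q b a :=
  real_inner_comm (F := TangentSpace 𝓘(ℝ, Plane) q) _ _

lemma riemForm_pos (q : F) {a : Plane} (ha : a ≠ 0) : 0 < riemForm q a a :=
  real_inner_self_pos (F := TangentSpace 𝓘(ℝ, Plane) q).2 ha

lemma riemForm_self_nonneg (q : F) (a : Plane) : 0 ≤ riemForm q a a :=
  real_inner_self_nonneg (F := TangentSpace 𝓘(ℝ, Plane) q)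

lemma riemForm_sq_le (q : F) (a b : Plane) :
    riemForm q a b * riemForm q a b ≤ riemForm q a a * riemForm q b b :=
  real_inner_mul_inner_self_le (F := TangentSpace 𝓘(ℝ, Plane) q) _ _

lemma enorm_tangentSpace_eq (q : F) (v : TangentSpace 𝓘(ℝ, Plane) q) :
    ‖v‖ₑ = ENNReal.ofReal √(riemForm q v v) := by
  rw [← ofReal_norm, norm_eq_sqrt_real_inner]
  rfl

lemma metricForm_chartMetric (e : OpenPartialHomeomorph F Plane) (u a b : Plane) :
    metricForm (chartMetric e) u a b =
      riemForm (e.symm u) (flatDeriv e.symm u a) (flatDeriv e.symm u b) := by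
  have hv : ∀ v : Plane, v = v 0 • EuclideanSpace.single (0 : Fin 2) (1 : ℝ)
      + v 1 • EuclideanSpace.single (1 : Fin 2) (1 : ℝ) := fun v => by
    ext i; fin_cases i <;> simp
  have h : ∀ i j, chartMetric e u i j =
      riemForm (e.symm u) (flatDeriv e.symm u (EuclideanSpace.single i 1))
        (flatDeriv e.symm u (EuclideanSpace.single j 1)) := fun i j => rfl
  conv_rhs => rw [hv a, hv b]
  simp only [metricForm, h, Fin.sum_univ_two, map_add, map_smul, riemForm_add_left,
    riemForm_add_right, riemForm_smul_left, riemForm_smul_right]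
  ring

end

variable [IsManifold 𝓘(ℝ, Plane) ∞ F] {e : OpenPartialHomeomorph F Plane}

lemma contMDiffOn_chart_of_mem_atlas (he : e ∈ atlas Plane F) :
    ContMDiffOn 𝓘(ℝ, Plane) 𝓘(ℝ, Plane) ∞ e e.source :=
  contMDiffOn_of_mem_maximalAtlas (IsManifold.subset_maximalAtlas he)

lemma contMDiffOn_chart_symm_of_mem_atlas (he : e ∈ atlas Plane F) :
    ContMDiffOn 𝓘(ℝ, Plane) 𝓘(ℝ, Plane) ∞ e.symm e.target :=
  contMDiffOn_symm_of_mem_maximalAtlas (IsManifold.subset_maximalAtlas he)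

section

variable {E : Type*} [NormedAddCommGroup E] [NormedSpace ℝ E] {f : E → F} {p : E}

lemma flatDeriv_eq_comp (he : e ∈ atlas Plane F) (hf : MDifferentiableAt 𝓘(ℝ, E) 𝓘(ℝ, Plane) f p)
    (hp : f p ∈ e.source) :
    flatDeriv f p = (flatDeriv e.symm (e (f p))).comp (fderiv ℝ (fun q => e (f q)) p) := by
  have he1 : MDifferentiableAt 𝓘(ℝ, Plane) 𝓘(ℝ, Plane) e (f p) :=
    ((contMDiffOn_chart_of_mem_atlas he).contMDiffAt (e.open_source.mem_nhds hp)).mdifferentiableAt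
      (by simp)
  have he2 : MDifferentiableAt 𝓘(ℝ, Plane) 𝓘(ℝ, Plane) e.symm (e (f p)) :=
    ((contMDiffOn_chart_symm_of_mem_atlas he).contMDiffAt
      (e.open_target.mem_nhds (e.map_source hp))).mdifferentiableAt (by simp)
  have h1 : f =ᶠ[𝓝 p] e.symm ∘ (fun q => e (f q)) := by
    filter_upwards [hf.continuousAt.eventually_mem (e.open_source.mem_nhds hp)] with q hq
    exact (e.left_inv hq).symm
  unfold flatDeriv
  rw [h1.mfderiv_eq]
  have h2 : MDifferentiableAt 𝓘(ℝ, E) 𝓘(ℝ, Plane) (fun q => e (f q)) p := he1.comp p hf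
  have h3 := mfderiv_comp (I := 𝓘(ℝ, E)) (I' := 𝓘(ℝ, Plane)) (I'' := 𝓘(ℝ, Plane)) p he2 h2
  rw [mfderiv_eq_fderiv] at h3
  exact h3

lemma fderiv_chart_comp (he : e ∈ atlas Plane F) (hf : MDifferentiableAt 𝓘(ℝ, E) 𝓘(ℝ, Plane) f p)
    (hp : f p ∈ e.source) :
    fderiv ℝ (fun q => e (f q)) p =
      (chartDeriv e (f p)).comp (flatDeriv f p) := by
  have he1 : MDifferentiableAt 𝓘(ℝ, Plane) 𝓘(ℝ, Plane) e (f p) :=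
    ((contMDiffOn_chart_of_mem_atlas he).contMDiffAt (e.open_source.mem_nhds hp)).mdifferentiableAt
      (by simp)
  have h3 := mfderiv_comp (I := 𝓘(ℝ, E)) (I' := 𝓘(ℝ, Plane)) (I'' := 𝓘(ℝ, Plane)) p he1 hf
  rw [mfderiv_eq_fderiv] at h3
  exact h3

lemma flatDeriv_chart_symm_injective (he : e ∈ atlas Plane F) {u : Plane} (hu : u ∈ e.target) :
    Function.Injective (flatDeriv e.symm u) := by
  have h1 : MDifferentiableAt 𝓘(ℝ, Plane) 𝓘(ℝ, Plane) e.symm u :=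
    ((contMDiffOn_chart_symm_of_mem_atlas he).contMDiffAt
      (e.open_target.mem_nhds hu)).mdifferentiableAt (by simp)
  have h2 := fderiv_chart_comp he h1 (e.map_target hu)
  have h3 : fderiv ℝ (fun q => e (e.symm q)) u = ContinuousLinearMap.id ℝ Plane := by
    have : (fun q => e (e.symm q)) =ᶠ[𝓝 u] id := by
      filter_upwards [e.open_target.mem_nhds hu] with q hq using e.right_inv hq
    rw [this.fderiv_eq, fderiv_id]
  rw [h3] at h2
  intro a b hab
  have := congrArg (fun L : Plane →L[ℝ] Plane => L a) h2
  have h5 := congrArg (fun L : Plane →L[ℝ] Plane => L b) h2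
  simp only [ContinuousLinearMap.id_apply, ContinuousLinearMap.comp_apply] at this h5
  rw [this, h5, hab]

lemma contDiffOn_chart_comp (he : e ∈ atlas Plane F) {s : Set E}
    (hf : ContMDiffOn 𝓘(ℝ, E) 𝓘(ℝ, Plane) ∞ f s) (hs : MapsTo f s e.source) :
    ContDiffOn ℝ ∞ (fun q => e (f q)) s :=
  ((contMDiffOn_chart_of_mem_atlas he).comp hf hs).contDiffOn

lemma contMDiffOn_chart_symm_comp (he : e ∈ atlas Plane F) {s : Set E} {g : E → Plane}
    (hg : ContDiffOn ℝ ∞ g s) (hs : MapsTo g s e.target) :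
    ContMDiffOn 𝓘(ℝ, E) 𝓘(ℝ, Plane) ∞ (fun q => e.symm (g q)) s :=
  (contMDiffOn_chart_symm_of_mem_atlas he).comp hg.contMDiffOn hs

end

variable [RiemannianBundle (fun x : F => TangentSpace 𝓘(ℝ, Plane) x)]

/-- The metric in a chart computes the Riemannian inner product of derivatives. -/
lemma riemForm_flatDeriv {E : Type*} [NormedAddCommGroup E] [NormedSpace ℝ E] {f : E → F} {p : E}
    (he : e ∈ atlas Plane F) (hf : MDifferentiableAt 𝓘(ℝ, E) 𝓘(ℝ, Plane) f p)
    (hp : f p ∈ e.source) (v w : E) :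
    riemForm (f p) (flatDeriv f p v) (flatDeriv f p w) =
      metricForm (chartMetric e) (e (f p)) (fderiv ℝ (fun q => e (f q)) p v)
        (fderiv ℝ (fun q => e (f q)) p w) := by
  rw [metricForm_chartMetric, flatDeriv_eq_comp he hf hp, e.left_inv hp]
  rfl

variable [IsContMDiffRiemannianBundle 𝓘(ℝ, Plane) ∞ Plane
  (fun x : F => TangentSpace 𝓘(ℝ, Plane) x)]

lemma isSmoothMetricOn_chartMetric (he : e ∈ atlas Plane F) :
    IsSmoothMetricOn (chartMetric e) e.target := by
  refine ⟨fun i j => ?_, fun u _ i j => riemForm_comm (e.symm u) _ _, fun u hu a ha => ?_⟩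
  · have h1 : ContMDiffOn 𝓘(ℝ, Plane).tangent 𝓘(ℝ, Plane).tangent ∞
        (tangentMapWithin 𝓘(ℝ, Plane) 𝓘(ℝ, Plane) e.symm e.target)
        (π Plane (TangentSpace 𝓘(ℝ, Plane)) ⁻¹' e.target) :=
      (contMDiffOn_chart_symm_of_mem_atlas he).contMDiffOn_tangentMapWithin (by simp)
        e.open_target.uniqueMDiffOn
    have h2 : ∀ v : Plane, ContMDiffOn 𝓘(ℝ, Plane) 𝓘(ℝ, Plane).tangent ∞
        (fun u => (⟨e.symm u, mfderiv 𝓘(ℝ, Plane) 𝓘(ℝ, Plane) e.symm u v⟩ :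
          TangentBundle 𝓘(ℝ, Plane) F)) e.target := by
      intro v
      have h3 : ContMDiff 𝓘(ℝ, Plane) 𝓘(ℝ, Plane).tangent ∞
          (fun u => (⟨u, v⟩ : TangentBundle 𝓘(ℝ, Plane) Plane)) := by
        intro u
        rw [contMDiffAt_totalSpace]
        refine ⟨contMDiffAt_id, ?_⟩
        simp
        exact contMDiffAt_const
      refine (h1.comp h3.contMDiffOn (fun u hu => hu)).congr fun u hu => ?_
      simp only [Function.comp, tangentMapWithin]
      congr 1
      rw [mfderivWithin_of_mem_nhds (e.open_target.mem_nhds hu)]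
    exact ((h2 (EuclideanSpace.single i 1)).inner_bundle
      (h2 (EuclideanSpace.single j 1))).contDiffOn
  · have h := metricForm_chartMetric e u a a
    unfold metricForm at h
    rw [h]
    refine riemForm_pos _ fun h0 => ha (flatDeriv_chart_symm_injective he hu ?_)
    rw [h0, map_zero]

end ChartMetric

end

noncomputable section

/-! ### The first variation identity -/

section Variation

open Topology

variable {G : Plane → Matrix (Fin 2) (Fin 2) ℝ} {Ω : Set Plane}

/-- The first variation identity
`∂_t G(u_t, u_s) - ½ ∂_s G(u_t, u_t) = G(u_tt + Γ(u_t, u_t), u_s)`. -/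
lemma IsSmoothMetricOn.first_variation (hG : IsSmoothMetricOn G Ω) (hΩ : IsOpen Ω)
    {u : ℝ × ℝ → Plane} {W : Set (ℝ × ℝ)} (hW : IsOpen W) (hu : ContDiffOn ℝ ∞ u W)
    (huΩ : MapsTo u W Ω) {s t : ℝ} (hp : (s, t) ∈ W) :
    ∃ A B : ℝ,
      HasDerivAt (fun τ => metricForm G (u (s, τ)) (partialT u (s, τ)) (partialS u (s, τ))) A t ∧
      HasDerivAt (fun σ => metricForm G (u (σ, t)) (partialT u (σ, t)) (partialT u (σ, t))) B s ∧
      A - B / 2 = metricForm G (u (s, t)) (partialT (partialT u) (s, t) +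
        christoffelForm G (u (s, t)) (partialT u (s, t)) (partialT u (s, t)))
        (partialS u (s, t)) := by
  have hT := (hu.partialT hW).differentiableAt_of_isOpen hW hp
  have hS := (hu.partialS hW).differentiableAt_of_isOpen hW hp
  have h0 := hu.differentiableAt_of_isOpen hW hp
  refine ⟨_, _, hG.hasDerivAt_metricForm hΩ (x := fun τ => u (s, τ)) (huΩ hp)
    (hasDerivAt_partialT h0) (hasDerivAt_partialT hT) (hasDerivAt_partialT hS),
    hG.hasDerivAt_metricForm hΩ (x := fun σ => u (σ, t)) (huΩ hp)
    (hasDerivAt_partialS h0) (hasDerivAt_partialS hT) (hasDerivAt_partialS hT), ?_⟩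
  rw [partialS_partialT_comm hW hu hp, hG.christoffelForm_comm hΩ (huΩ hp) (partialS u (s, t)),
    hG.metricForm_comm (huΩ hp) (partialT (partialS u) (s, t) + _)]
  ring

lemma partialT_eq_deriv {f : ℝ × ℝ → Plane} {W : Set (ℝ × ℝ)} (hW : IsOpen W)
    (hf : ContDiffOn ℝ ∞ f W) {s t : ℝ} (hp : (s, t) ∈ W) :
    partialT f (s, t) = deriv (fun τ => f (s, τ)) t :=
  (hasDerivAt_partialT (hf.differentiableAt_of_isOpen hW hp)).deriv.symm

lemma partialT_partialT_eq_deriv {f : ℝ × ℝ → Plane} {W : Set (ℝ × ℝ)} (hW : IsOpen W)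
    (hf : ContDiffOn ℝ ∞ f W) {s t : ℝ} (hp : (s, t) ∈ W) :
    partialT (partialT f) (s, t) = deriv (deriv fun τ => f (s, τ)) t := by
  rw [partialT_eq_deriv hW (hf.partialT hW) hp]
  refine Filter.EventuallyEq.deriv_eq ?_
  have : ∀ᶠ τ in 𝓝 t, (s, τ) ∈ W :=
    (by fun_prop : Continuous fun r : ℝ => (s, r)).continuousAt.eventually_mem (hW.mem_nhds hp)
  filter_upwards [this] with τ hτ using partialT_eq_deriv hW hf hτ

end Variation

/-! ### Geodesics of a surface and their independence of charts -/

section Geodesics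

open Topology

variable {F : Type*} [TopologicalSpace F] [ChartedSpace Plane F]
  [RiemannianBundle (fun x : F => TangentSpace 𝓘(ℝ, Plane) x)]

/-- The left-hand side `u'' + Γ(u', u')` of the geodesic equation in the chart `e`. -/
def geodesicDefect (e : OpenPartialHomeomorph F Plane) (γ : ℝ → F) (t : ℝ) : Plane :=
  deriv (deriv fun s => e (γ s)) t + christoffelForm (chartMetric e) (e (γ t))
    (deriv (fun s => e (γ s)) t) (deriv (fun s => e (γ s)) t)

/-- `γ` is a geodesic on the open set `s` of times. -/
structure IsGeodesicOn (γ : ℝ → F) (s : Set ℝ) : Prop where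
  smooth : ContMDiffOn 𝓘(ℝ, ℝ) 𝓘(ℝ, Plane) ∞ γ s
  defect : ∀ e ∈ atlas Plane F, ∀ t ∈ s, γ t ∈ e.source → geodesicDefect e γ t = 0

lemma IsGeodesicOn.mono {γ : ℝ → F} {s s' : Set ℝ} (h : IsGeodesicOn γ s) (hs : s' ⊆ s) :
    IsGeodesicOn γ s' :=
  ⟨h.smooth.mono hs, fun e he t ht hte => h.defect e he t (hs ht) hte⟩

lemma geodesicDefect_congr {e : OpenPartialHomeomorph F Plane} {γ γ' : ℝ → F} {t : ℝ}
    (h : γ =ᶠ[𝓝 t] γ') : geodesicDefect e γ t = geodesicDefect e γ' t := by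
  have h1 : (fun s => e (γ s)) =ᶠ[𝓝 t] fun s => e (γ' s) := h.mono fun s hs => by simp only [hs]
  unfold geodesicDefect
  rw [h1.deriv_eq, h1.deriv.deriv_eq, h.eq_of_nhds]

lemma isGeodesicOn_of_eventuallyEq {γ : ℝ → F} {s : Set ℝ}
    (h : ∀ t ∈ s, ∃ γ' s', IsOpen s' ∧ t ∈ s' ∧ IsGeodesicOn γ' s' ∧ γ =ᶠ[𝓝 t] γ') :
    IsGeodesicOn γ s := by
  refine ⟨fun t ht => ?_, fun e he t ht hte => ?_⟩
  · obtain ⟨γ', s', hs', ht', hγ', heq⟩ := h t ht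
    exact ((hγ'.smooth.contMDiffAt (hs'.mem_nhds ht')).congr_of_eventuallyEq
      heq).contMDiffWithinAt
  · obtain ⟨γ', s', hs', ht', hγ', heq⟩ := h t ht
    rw [geodesicDefect_congr heq]
    exact hγ'.defect e he t ht' (heq.eq_of_nhds ▸ hte)

variable [IsManifold 𝓘(ℝ, Plane) ∞ F] {e : OpenPartialHomeomorph F Plane}

/-- A smooth curve read in a chart, on an open set of times. -/
lemma exists_isOpen_contDiffOn_chart (he : e ∈ atlas Plane F) {γ : ℝ → F} {s : Set ℝ}
    (hs : IsOpen s) (hγ : ContMDiffOn 𝓘(ℝ, ℝ) 𝓘(ℝ, Plane) ∞ γ s) {t : ℝ} (ht : t ∈ s)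
    (hte : γ t ∈ e.source) :
    ∃ s' ⊆ s, IsOpen s' ∧ t ∈ s' ∧ MapsTo γ s' e.source ∧
      ContDiffOn ℝ ∞ (fun τ => e (γ τ)) s' := by
  have h1 : IsOpen (s ∩ γ ⁻¹' e.source) := hγ.continuousOn.isOpen_inter_preimage hs e.open_source
  exact ⟨_, inter_subset_left, h1, ⟨ht, hte⟩, fun τ hτ => hτ.2,
    contDiffOn_chart_comp he (hγ.mono inter_subset_left) fun τ hτ => hτ.2⟩

lemma hasDerivAt_of_contDiffOn {c : ℝ → Plane} {s : Set ℝ} (hs : IsOpen s)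
    (hc : ContDiffOn ℝ ∞ c s) {t : ℝ} (ht : t ∈ s) :
    HasDerivAt c (deriv c t) t ∧ HasDerivAt (deriv c) (deriv (deriv c) t) t := by
  have h1 : ContDiffOn ℝ ∞ (deriv c) s := hc.deriv_of_isOpen hs (by simp)
  exact ⟨((hc.contDiffAt (hs.mem_nhds ht)).differentiableAt (by simp)).hasDerivAt,
    ((h1.contDiffAt (hs.mem_nhds ht)).differentiableAt (by simp)).hasDerivAt⟩

lemma isSurfaceGeodesic_iff {γ : ℝ → F} : IsSurfaceGeodesic γ ↔ IsGeodesicOn γ univ := by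
  have key : ∀ (_ : ContMDiff 𝓘(ℝ, ℝ) 𝓘(ℝ, Plane) ∞ γ), ∀ e ∈ atlas Plane F, ∀ t, γ t ∈ e.source →
      ∀ k : Fin 2, deriv (deriv fun s => e (γ s) k) t
        + ∑ i, ∑ j, christoffelSymbol (chartMetric e) i j k (e (γ t))
          * deriv (fun s => e (γ s) i) t * deriv (fun s => e (γ s) j) t =
        geodesicDefect e γ t k := by
    intro hγ e he t hte k
    obtain ⟨s, -, hs, ht, -, hc⟩ := exists_isOpen_contDiffOn_chart he isOpen_univ
      hγ.contMDiffOn (mem_univ t) hte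
    have h1 : ∀ τ ∈ s, ∀ i, deriv (fun s => e (γ s) i) τ = deriv (fun s => e (γ s)) τ i :=
      fun τ hτ i => ((hasDerivAt_of_contDiffOn hs hc hτ).1.plane_apply i).deriv
    have h2 : deriv (deriv fun s => e (γ s) k) t = deriv (deriv fun s => e (γ s)) t k := by
      rw [← ((hasDerivAt_of_contDiffOn hs hc ht).2.plane_apply k).deriv]
      refine Filter.EventuallyEq.deriv_eq ?_
      filter_upwards [hs.mem_nhds ht] with τ hτ using h1 τ hτ k
    rw [h2, geodesicDefect, PiLp.add_apply, christoffelForm_apply]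
    simp only [h1 t ht]
  constructor
  · rintro ⟨h1, h2⟩
    refine ⟨h1.contMDiffOn, fun e he t _ hte => ?_⟩
    ext k
    rw [← key h1 e he t hte k]
    exact h2 e he t hte k
  · rintro ⟨h1, h2⟩
    refine ⟨contMDiffOn_univ.1 h1, fun e he t hte k => ?_⟩
    rw [key (contMDiffOn_univ.1 h1) e he t hte k, h2 e he t (mem_univ t) hte]
    rfl

variable [IsContMDiffRiemannianBundle 𝓘(ℝ, Plane) ∞ Plane
  (fun x : F => TangentSpace 𝓘(ℝ, Plane) x)]

/-- The first variation identity for a two-parameter map into a surface, in terms of the geodesic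
equation in a chart. -/
lemma first_variation_surface (he : e ∈ atlas Plane F) {U : ℝ × ℝ → F} {W : Set (ℝ × ℝ)}
    (hW : IsOpen W) (hU : ContMDiffOn 𝓘(ℝ, ℝ × ℝ) 𝓘(ℝ, Plane) ∞ U W) {s t : ℝ} (hp : (s, t) ∈ W)
    (hpe : U (s, t) ∈ e.source) :
    ∃ A B : ℝ,
      HasDerivAt (fun τ => riemForm (U (s, τ)) (flatDeriv U (s, τ) (0, 1))
        (flatDeriv U (s, τ) (1, 0))) A t ∧
      HasDerivAt (fun σ => riemForm (U (σ, t)) (flatDeriv U (σ, t) (0, 1))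
        (flatDeriv U (σ, t) (0, 1))) B s ∧
      A - B / 2 = metricForm (chartMetric e) (e (U (s, t)))
        (geodesicDefect e (fun τ => U (s, τ)) t) (partialS (fun q => e (U q)) (s, t)) := by
  set W' := W ∩ U ⁻¹' e.source with hW'
  have hW'o : IsOpen W' := hU.continuousOn.isOpen_inter_preimage hW e.open_source
  have hu : ContDiffOn ℝ ∞ (fun q => e (U q)) W' :=
    contDiffOn_chart_comp he (hU.mono inter_subset_left) fun q hq => hq.2
  have hp' : (s, t) ∈ W' := ⟨hp, hpe⟩
  obtain ⟨A, B, hA, hB, hAB⟩ := (isSmoothMetricOn_chartMetric he).first_variation e.open_target hW'o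
    hu (fun q hq => e.map_source hq.2) hp'
  have hd : ∀ q ∈ W', MDifferentiableAt 𝓘(ℝ, ℝ × ℝ) 𝓘(ℝ, Plane) U q := fun q hq =>
    (hU.contMDiffAt (hW.mem_nhds hq.1)).mdifferentiableAt (by simp)
  have e1 : ∀ᶠ τ in 𝓝 t, (s, τ) ∈ W' :=
    (by fun_prop : Continuous fun r : ℝ => (s, r)).continuousAt.eventually_mem (hW'o.mem_nhds hp')
  have e2 : ∀ᶠ σ in 𝓝 s, (σ, t) ∈ W' :=
    (by fun_prop : Continuous fun r : ℝ => (r, t)).continuousAt.eventually_mem (hW'o.mem_nhds hp')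
  refine ⟨A, B, hA.congr_of_eventuallyEq (e1.mono fun τ hτ => ?_),
    hB.congr_of_eventuallyEq (e2.mono fun σ hσ => ?_), ?_⟩
  · exact riemForm_flatDeriv he (hd _ hτ) hτ.2 _ _
  · exact riemForm_flatDeriv he (hd _ hσ) hσ.2 _ _
  · rw [hAB, partialT_eq_deriv hW'o hu hp', partialT_partialT_eq_deriv hW'o hu hp']
    rfl

/-- The geodesic equation does not depend on the chart. -/
lemma geodesicDefect_eq_zero_of_chart {e' : OpenPartialHomeomorph F Plane}
    (he : e ∈ atlas Plane F) (he' : e' ∈ atlas Plane F) {γ : ℝ → F} {s : Set ℝ} (hs : IsOpen s)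
    (hγ : ContMDiffOn 𝓘(ℝ, ℝ) 𝓘(ℝ, Plane) ∞ γ s) {t : ℝ} (ht : t ∈ s)
    (hte : γ t ∈ e.source) (hte' : γ t ∈ e'.source) (h : geodesicDefect e γ t = 0) :
    geodesicDefect e' γ t = 0 := by
  by_contra hne
  set ξ := geodesicDefect e' γ t with hξ
  obtain ⟨s', hs's, hs', hts', hms', hc⟩ := exists_isOpen_contDiffOn_chart he' hs hγ ht hte'
  -- The curve is varied in the direction of its own defect ξ in the chart `e'`, which is supposed
  -- nonzero.
  set V : ℝ × ℝ → Plane := fun q => e' (γ q.2) + q.1 • ξ with hV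
  have hV1 : ContDiffOn ℝ ∞ V (Prod.snd ⁻¹' s') :=
    (hc.comp contDiff_snd.contDiffOn fun q hq => hq).add
      (contDiff_fst.smul contDiff_const).contDiffOn
  have ho : IsOpen (Prod.snd ⁻¹' s' : Set (ℝ × ℝ)) := hs'.preimage continuous_snd
  set W := Prod.snd ⁻¹' s' ∩ V ⁻¹' e'.target with hWdef
  have hW : IsOpen W := hV1.continuousOn.isOpen_inter_preimage ho e'.open_target
  set U : ℝ × ℝ → F := fun q => e'.symm (V q) with hUdef
  have hU : ContMDiffOn 𝓘(ℝ, ℝ × ℝ) 𝓘(ℝ, Plane) ∞ U W :=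
    contMDiffOn_chart_symm_comp he' (hV1.mono inter_subset_left) fun q hq => hq.2
  have hV0 : ∀ τ, V (0, τ) = e' (γ τ) := fun τ => by simp [hV]
  have hp : ((0 : ℝ), t) ∈ W := ⟨hts', by
    change V (0, t) ∈ e'.target
    rw [hV0]; exact e'.map_source hte'⟩
  have hU0 : ∀ τ ∈ s', U (0, τ) = γ τ := fun τ hτ => by
    rw [hUdef]; simp only [hV0]; exact e'.left_inv (hms' hτ)
  have hU0e : (fun τ => U (0, τ)) =ᶠ[𝓝 t] γ := by
    filter_upwards [hs'.mem_nhds hts'] with τ hτ using hU0 τ hτ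
  have hpt : U (0, t) = γ t := hU0 t hts'
  obtain ⟨A, B, hA, hB, hAB⟩ := first_variation_surface he hW hU hp (hpt ▸ hte)
  obtain ⟨A', B', hA', hB', hAB'⟩ := first_variation_surface he' hW hU hp (hpt ▸ hte')
  rw [geodesicDefect_congr hU0e] at hAB hAB'
  -- A and B are derivatives of Riemannian inner products and do not see the chart. So the pairing
  -- of the defect with the variation field agrees in both charts; it is 0 in `e` and becomes the
  -- squared length of ξ in `e'`.
  rw [hA.unique hA', hB.unique hB', hAB', h] at hAB
  have hS : partialS (fun q => e' (U q)) (0, t) = ξ := by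
    have h1 : (fun q => e' (U q)) =ᶠ[𝓝 ((0 : ℝ), t)] V := by
      filter_upwards [hW.mem_nhds hp] with q hq using e'.right_inv hq.2
    have h2 : partialS (fun q => e' (U q)) (0, t) = partialS V (0, t) := by
      unfold partialS; rw [h1.fderiv_eq]
    have h3 := hasDerivAt_partialS (f := V) (s := 0) (t := t)
      (hV1.differentiableAt_of_isOpen ho hts')
    have h4 : HasDerivAt (fun σ : ℝ => V (σ, t)) ((1 : ℝ) • ξ) 0 :=
      ((hasDerivAt_id (0 : ℝ)).smul_const ξ).const_add (e' (γ t))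
    rw [h2, h3.unique h4, one_smul]
  rw [hS, hpt] at hAB
  have hpos := (isSmoothMetricOn_chartMetric he').metricForm_pos (e'.map_source hte') hne
  rw [← hξ] at hAB
  rw [hAB] at hpos
  simp [metricForm] at hpos

/-- A smooth curve is a geodesic if it satisfies the geodesic equation in one chart at each time. -/
lemma isGeodesicOn_of_exists_chart {γ : ℝ → F} {s : Set ℝ} (hs : IsOpen s)
    (hγ : ContMDiffOn 𝓘(ℝ, ℝ) 𝓘(ℝ, Plane) ∞ γ s)
    (h : ∀ t ∈ s, ∃ e ∈ atlas Plane F, γ t ∈ e.source ∧ geodesicDefect e γ t = 0) :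
    IsGeodesicOn γ s :=
  ⟨hγ, fun _ he' t ht hte' =>
    let ⟨_, he, hte, h0⟩ := h t ht
    geodesicDefect_eq_zero_of_chart he he' hs hγ ht hte hte' h0⟩

end Geodesics

end

noncomputable section

/-! ### Regularity and uniqueness for the geodesic equation -/

section PlaneODE

open Topology

variable {G : Plane → Matrix (Fin 2) (Fin 2) ℝ} {Ω : Set Plane}

lemma christoffelForm_smul_smul (G : Plane → Matrix (Fin 2) (Fin 2) ℝ) (u v : Plane) (r : ℝ) :
    christoffelForm G u (r • v) (r • v) = (r * r) • christoffelForm G u v v := by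
  ext k
  simp only [christoffelForm_apply, Fin.sum_univ_two, PiLp.smul_apply, smul_eq_mul]
  ring

lemma IsSmoothMetricOn.contDiffOn_christoffelForm (hG : IsSmoothMetricOn G Ω) (hΩ : IsOpen Ω)
    {E : Type*} [NormedAddCommGroup E] [NormedSpace ℝ E] {n : WithTop ℕ∞} (hn : n ≤ ((⊤ : ℕ∞) : WithTop ℕ∞))
    {x a b : E → Plane} {s : Set E} (hx : ContDiffOn ℝ n x s) (ha : ContDiffOn ℝ n a s)
    (hb : ContDiffOn ℝ n b s) (hs : MapsTo x s Ω) :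
    ContDiffOn ℝ n (fun z => christoffelForm G (x z) (a z) (b z)) s := by
  rw [contDiffOn_piLp]
  intro k
  have hc : ∀ {a : E → Plane} (i : Fin 2), ContDiffOn ℝ n a s → ContDiffOn ℝ n (fun z => a z i) s :=
    fun i ha => (EuclideanSpace.proj (𝕜 := ℝ) i).contDiff.comp_contDiffOn ha
  simp only [christoffelForm_apply]
  exact ContDiffOn.sum fun i _ => ContDiffOn.sum fun j _ =>
    ((((hG.contDiffOn_christoffelSymbol hΩ i j k).of_le hn).comp hx hs).mul (hc i ha)).mul (hc j hb)

/-- Bootstrapping: if c and c' are Cⁿ, then so are their derivatives c' and -Γ(c', c'), hence both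
are Cⁿ⁺¹. -/
lemma IsSmoothMetricOn.contDiffOn_of_geodesicODE (hG : IsSmoothMetricOn G Ω) (hΩ : IsOpen Ω)
    {c c' : ℝ → Plane} {s : Set ℝ} (hs : IsOpen s)
    (h : ∀ t ∈ s, c t ∈ Ω ∧ HasDerivAt c (c' t) t ∧
      HasDerivAt c' (-christoffelForm G (c t) (c' t) (c' t)) t) : ContDiffOn ℝ ∞ c s := by
  have step : ∀ {f f' : ℝ → Plane} (n : ℕ), (∀ t ∈ s, HasDerivAt f (f' t) t) →
      ContDiffOn ℝ n f' s → ContDiffOn ℝ (n + 1 : ℕ) f s := by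
    intro f f' n hf hf'
    push_cast
    rw [contDiffOn_succ_iff_deriv_of_isOpen hs]
    exact ⟨fun t ht => (hf t ht).differentiableAt.differentiableWithinAt, by simp,
      hf'.congr fun t ht => (hf t ht).deriv⟩
  have key : ∀ n : ℕ, ContDiffOn ℝ n c s ∧ ContDiffOn ℝ n c' s := by
    intro n
    induction n with
    | zero =>
      simp only [Nat.cast_zero, contDiffOn_zero]
      exact ⟨fun t ht => (h t ht).2.1.continuousAt.continuousWithinAt,
        fun t ht => (h t ht).2.2.continuousAt.continuousWithinAt⟩
    | succ n ih =>
      exact ⟨step n (fun t ht => (h t ht).2.1) ih.2, step n (fun t ht => (h t ht).2.2)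
        (hG.contDiffOn_christoffelForm hΩ (by exact_mod_cast (le_top : (n : ℕ∞) ≤ ⊤)) ih.1 ih.2 ih.2
          fun t ht => (h t ht).1).neg⟩
  exact contDiffOn_infty.2 fun n => (key n).1

/-- The equation is a first order system for (c, c') with a C¹ field, hence locally Lipschitz. -/
lemma IsSmoothMetricOn.geodesicODE_unique (hG : IsSmoothMetricOn G Ω) (hΩ : IsOpen Ω)
    {c₁ c₁' c₂ c₂' : ℝ → Plane} {t : ℝ} (ht : c₁ t ∈ Ω)
    (h₁ : ∀ᶠ τ in 𝓝 t, HasDerivAt c₁ (c₁' τ) τ ∧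
      HasDerivAt c₁' (-christoffelForm G (c₁ τ) (c₁' τ) (c₁' τ)) τ)
    (h₂ : ∀ᶠ τ in 𝓝 t, HasDerivAt c₂ (c₂' τ) τ ∧
      HasDerivAt c₂' (-christoffelForm G (c₂ τ) (c₂' τ) (c₂' τ)) τ)
    (h0 : c₁ t = c₂ t) (h0' : c₁' t = c₂' t) : c₁ =ᶠ[𝓝 t] c₂ := by
  let X : Plane × Plane → Plane × Plane := fun z => (z.2, -christoffelForm G z.1 z.2 z.2)
  have hX : ContDiffOn ℝ 1 X (Prod.fst ⁻¹' Ω) :=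
    contDiff_snd.contDiffOn.prodMk (hG.contDiffOn_christoffelForm hΩ
      (by exact_mod_cast (le_top : (1 : ℕ∞) ≤ ⊤))
      contDiff_fst.contDiffOn contDiff_snd.contDiffOn contDiff_snd.contDiffOn fun z hz => hz).neg
  have ho : IsOpen (Prod.fst ⁻¹' Ω : Set (Plane × Plane)) := hΩ.preimage continuous_fst
  obtain ⟨K, S, hS, hK⟩ := (hX.contDiffAt (x := (c₁ t, c₁' t))
    (ho.mem_nhds ht)).exists_lipschitzOnWith
  have hcont₁ : ContinuousAt (fun τ => (c₁ τ, c₁' τ)) t :=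
    h₁.self_of_nhds.1.continuousAt.prodMk h₁.self_of_nhds.2.continuousAt
  have hcont₂ : ContinuousAt (fun τ => (c₂ τ, c₂' τ)) t :=
    h₂.self_of_nhds.1.continuousAt.prodMk h₂.self_of_nhds.2.continuousAt
  have heq : (c₁ t, c₁' t) = (c₂ t, c₂' t) := by rw [h0, h0']
  have := ODE_solution_unique_of_eventually (v := fun _ => X) (s := fun _ => S) (K := K)
    (f := fun τ => (c₁ τ, c₁' τ)) (g := fun τ => (c₂ τ, c₂' τ)) (t₀ := t)
    (Filter.Eventually.of_forall fun _ => hK)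
    ((h₁.and (hcont₁.eventually_mem hS)).mono fun τ hτ => ⟨hτ.1.1.prodMk hτ.1.2, hτ.2⟩)
    ((h₂.and (hcont₂.eventually_mem (heq ▸ hS))).mono fun τ hτ => ⟨hτ.1.1.prodMk hτ.1.2, hτ.2⟩)
    heq
  exact this.mono fun τ hτ => congrArg Prod.fst hτ

end PlaneODE

/-! ### Uniqueness, constant speed and reparametrisation of geodesics -/

section GeodesicUniqueness

open Topology

variable {F : Type*} [TopologicalSpace F] [ChartedSpace Plane F]

/-- The velocity of a curve in a surface, as a vector of the model plane. -/
def velocity (γ : ℝ → F) (t : ℝ) : Plane := flatDeriv γ t 1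

variable [RiemannianBundle (fun x : F => TangentSpace 𝓘(ℝ, Plane) x)]
  [IsManifold 𝓘(ℝ, Plane) ∞ F] {e : OpenPartialHomeomorph F Plane} {γ γ' : ℝ → F} {s : Set ℝ}
  {t : ℝ}

lemma IsGeodesicOn.mdifferentiableAt (h : IsGeodesicOn γ s) (hs : IsOpen s) (ht : t ∈ s) :
    MDifferentiableAt 𝓘(ℝ, ℝ) 𝓘(ℝ, Plane) γ t :=
  (h.smooth.contMDiffAt (hs.mem_nhds ht)).mdifferentiableAt (by simp)

lemma IsGeodesicOn.continuousAt (h : IsGeodesicOn γ s) (hs : IsOpen s) (ht : t ∈ s) :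
    ContinuousAt γ t := (h.mdifferentiableAt hs ht).continuousAt

lemma IsGeodesicOn.deriv_chart (h : IsGeodesicOn γ s) (hs : IsOpen s) (ht : t ∈ s)
    (he : e ∈ atlas Plane F) (hte : γ t ∈ e.source) :
    deriv (fun τ => e (γ τ)) t = chartDeriv e (γ t) (velocity γ t) := by
  rw [← fderiv_apply_one_eq_deriv, fderiv_chart_comp he (h.mdifferentiableAt hs ht) hte]
  rfl

lemma IsGeodesicOn.eventually_chart (h : IsGeodesicOn γ s) (hs : IsOpen s) (ht : t ∈ s)
    (he : e ∈ atlas Plane F) (hte : γ t ∈ e.source) :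
    ∀ᶠ τ in 𝓝 t, HasDerivAt (fun τ => e (γ τ)) (deriv (fun τ => e (γ τ)) τ) τ ∧
      HasDerivAt (deriv fun τ => e (γ τ)) (-christoffelForm (chartMetric e) (e (γ τ))
        (deriv (fun τ => e (γ τ)) τ) (deriv (fun τ => e (γ τ)) τ)) τ := by
  obtain ⟨s', hs's, hs', hts', hms', hc⟩ := exists_isOpen_contDiffOn_chart he hs h.smooth ht hte
  filter_upwards [hs'.mem_nhds hts'] with τ hτ
  obtain ⟨h1, h2⟩ := hasDerivAt_of_contDiffOn hs' hc hτ
  refine ⟨h1, h2.congr_deriv ?_⟩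
  exact eq_neg_of_add_eq_zero_left (h.defect e he τ (hs's hτ) (hms' hτ))

variable [IsContMDiffRiemannianBundle 𝓘(ℝ, Plane) ∞ Plane
  (fun x : F => TangentSpace 𝓘(ℝ, Plane) x)]

lemma IsGeodesicOn.eventuallyEq_of_deriv_chart {s' : Set ℝ} (h : IsGeodesicOn γ s) (hs : IsOpen s)
    (h' : IsGeodesicOn γ' s') (hs' : IsOpen s') (ht : t ∈ s) (ht' : t ∈ s')
    (he : e ∈ atlas Plane F) (hte : γ t ∈ e.source) (h0 : γ t = γ' t)
    (h0' : deriv (fun τ => e (γ τ)) t = deriv (fun τ => e (γ' τ)) t) : γ =ᶠ[𝓝 t] γ' := by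
  have key := (isSmoothMetricOn_chartMetric he).geodesicODE_unique e.open_target
    (e.map_source hte) (h.eventually_chart hs ht he hte)
    (h'.eventually_chart hs' ht' he (h0 ▸ hte)) (by rw [h0]) h0'
  filter_upwards [key, (h.continuousAt hs ht).eventually_mem (e.open_source.mem_nhds hte),
    (h'.continuousAt hs' ht').eventually_mem (e.open_source.mem_nhds (h0 ▸ hte))] with τ h1 h2 h3
  exact e.injOn h2 h3 h1

lemma IsGeodesicOn.eventuallyEq_of_velocity {s' : Set ℝ} (h : IsGeodesicOn γ s) (hs : IsOpen s)
    (h' : IsGeodesicOn γ' s') (hs' : IsOpen s') (ht : t ∈ s) (ht' : t ∈ s')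
    (h0 : γ t = γ' t) (h0' : velocity γ t = velocity γ' t) : γ =ᶠ[𝓝 t] γ' := by
  have he : chartAt Plane (γ t) ∈ atlas Plane F := chart_mem_atlas _ _
  have hte : γ t ∈ (chartAt Plane (γ t)).source := mem_chart_source _ _
  refine h.eventuallyEq_of_deriv_chart hs h' hs' ht ht' he hte h0 ?_
  rw [h.deriv_chart hs ht he hte, h'.deriv_chart hs' ht' he (h0 ▸ hte), h0', h0]

/-- Uniqueness of geodesics. -/
theorem IsGeodesicOn.eqOn [T2Space F] (h : IsGeodesicOn γ s) (h' : IsGeodesicOn γ' s)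
    (hs : IsOpen s) (hc : IsPreconnected s) (ht : t ∈ s) (heq : γ =ᶠ[𝓝 t] γ') : EqOn γ γ' s := by
  -- The set of times near which the curves agree is open. At a limit of such times the positions
  -- and the chart velocities agree by continuity, so local uniqueness shows that the set is also
  -- closed in s.
  have key : s ⊆ {τ | γ =ᶠ[𝓝 τ] γ'} := by
    refine hc.subset_of_closure_inter_subset isOpen_setOfPred_eventually_nhds ⟨t, ht, heq⟩ ?_
    rintro τ ⟨hτ, hτs⟩
    have hfr : ∃ᶠ σ in 𝓝 τ, γ =ᶠ[𝓝 σ] γ' := mem_closure_iff_frequently.1 hτ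
    have h0 : γ τ = γ' τ := by
      by_contra hne
      have h1 : ∀ᶠ σ in 𝓝 τ, γ σ ≠ γ' σ :=
        ((h.continuousAt hs hτs).ne_iff_eventually_ne (h'.continuousAt hs hτs)).1 hne
      obtain ⟨σ, hσ, hσ'⟩ := (hfr.and_eventually h1).exists
      exact hσ' hσ.eq_of_nhds
    have he : chartAt Plane (γ τ) ∈ atlas Plane F := chart_mem_atlas _ _
    have hte : γ τ ∈ (chartAt Plane (γ τ)).source := mem_chart_source _ _
    refine h.eventuallyEq_of_deriv_chart hs h' hs hτs hτs he hte h0 ?_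
    have c1 := (h.eventually_chart hs hτs he hte).self_of_nhds.2.continuousAt
    have c2 := (h'.eventually_chart hs hτs he (h0 ▸ hte)).self_of_nhds.2.continuousAt
    by_contra hne
    have h1 := (c1.ne_iff_eventually_ne c2).1 hne
    obtain ⟨σ, hσ, hσ'⟩ := (hfr.and_eventually h1).exists
    refine hσ' (Filter.EventuallyEq.deriv_eq ?_)
    exact hσ.mono fun r hr => by simp only [hr]
  exact fun τ hτ => (key hτ).eq_of_nhds

/-- The speed of a geodesic is constant. -/
lemma IsGeodesicOn.speed_const (h : IsGeodesicOn γ s) (hs : IsOpen s) (hc : IsPreconnected s)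
    {t' : ℝ} (ht : t ∈ s) (ht' : t' ∈ s) :
    riemForm (γ t) (velocity γ t) (velocity γ t) =
      riemForm (γ t') (velocity γ t') (velocity γ t') := by
  have key : ∀ τ ∈ s, HasDerivAt (fun τ => riemForm (γ τ) (velocity γ τ) (velocity γ τ)) 0 τ := by
    intro τ hτ
    have he : chartAt Plane (γ τ) ∈ atlas Plane F := chart_mem_atlas _ _
    have hte : γ τ ∈ (chartAt Plane (γ τ)).source := mem_chart_source _ _
    obtain ⟨h1, h2⟩ := (h.eventually_chart hs hτ he hte).self_of_nhds
    have h3 := (isSmoothMetricOn_chartMetric he).hasDerivAt_metricForm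
      (chartAt Plane (γ τ)).open_target ((chartAt Plane (γ τ)).map_source hte) h1 h2 h2
    refine (h3.congr_deriv (by simp [metricForm])).congr_of_eventuallyEq ?_
    filter_upwards [hs.mem_nhds hτ, (h.continuousAt hs hτ).eventually_mem
      ((chartAt Plane (γ τ)).open_source.mem_nhds hte)] with σ hσ hσe
    rw [velocity, riemForm_flatDeriv he (h.mdifferentiableAt hs hσ) hσe, fderiv_apply_one_eq_deriv]
  exact hs.is_const_of_deriv_eq_zero hc
    (fun τ hτ => (key τ hτ).differentiableAt.differentiableWithinAt)
    (fun τ hτ => (key τ hτ).deriv) ht ht'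

lemma velocity_comp_affine (h : IsGeodesicOn γ s) (hs : IsOpen s) (a b : ℝ) (ht : a + b * t ∈ s) :
    velocity (fun τ => γ (a + b * τ)) t = b • velocity γ (a + b * t) := by
  have h1 : MDifferentiableAt 𝓘(ℝ, ℝ) 𝓘(ℝ, ℝ) (fun τ : ℝ => a + b * τ) t :=
    (by fun_prop : DifferentiableAt ℝ (fun τ : ℝ => a + b * τ) t).mdifferentiableAt
  have h2 := mfderiv_comp (I := 𝓘(ℝ, ℝ)) (I' := 𝓘(ℝ, ℝ)) (I'' := 𝓘(ℝ, Plane)) t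
    (h.mdifferentiableAt hs ht) h1
  have h3 : fderiv ℝ (fun τ : ℝ => a + b * τ) t 1 = b • (1 : ℝ) := by
    rw [fderiv_apply_one_eq_deriv]
    simp [deriv_const_add]
  have h4 : velocity (fun τ => γ (a + b * τ)) t =
      flatDeriv γ (a + b * t) (fderiv ℝ (fun τ : ℝ => a + b * τ) t 1) := by
    rw [mfderiv_eq_fderiv] at h2
    exact congrArg (fun L : ℝ →L[ℝ] Plane => L 1) h2
  rw [h4, h3, map_smul]
  rfl

lemma IsGeodesicOn.comp_affine (h : IsGeodesicOn γ s) (hs : IsOpen s) (a b : ℝ) :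
    IsGeodesicOn (fun τ => γ (a + b * τ)) ((fun τ => a + b * τ) ⁻¹' s) := by
  have hcd : ContDiff ℝ ∞ (fun τ : ℝ => a + b * τ) := by fun_prop
  refine ⟨h.smooth.comp hcd.contMDiff.contMDiffOn (fun τ hτ => hτ), fun e he t ht hte => ?_⟩
  obtain ⟨s', hs's, hs', hts', hms', hc⟩ := exists_isOpen_contDiffOn_chart he hs h.smooth ht hte
  have hd : ∀ τ, HasDerivAt (fun τ : ℝ => a + b * τ) b τ := fun τ => by
    simpa using ((hasDerivAt_id τ).const_mul b).const_add a
  have d1 : ∀ τ, a + b * τ ∈ s' → HasDerivAt (fun τ => e (γ (a + b * τ)))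
      (b • deriv (fun τ => e (γ τ)) (a + b * τ)) τ := fun τ hτ =>
    HasDerivAt.scomp (h := fun τ : ℝ => a + b * τ) τ (hasDerivAt_of_contDiffOn hs' hc hτ).1 (hd τ)
  have hev : (deriv fun τ => e (γ (a + b * τ))) =ᶠ[𝓝 t]
      fun τ => b • deriv (fun τ => e (γ τ)) (a + b * τ) := by
    filter_upwards [hcd.continuous.continuousAt.eventually_mem (hs'.mem_nhds hts')] with τ hτ
    exact (d1 τ hτ).deriv
  have d2 : HasDerivAt (fun τ => b • deriv (fun τ => e (γ τ)) (a + b * τ))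
      (b • b • deriv (deriv fun τ => e (γ τ)) (a + b * t)) t :=
    (HasDerivAt.scomp (h := fun τ : ℝ => a + b * τ) t (hasDerivAt_of_contDiffOn hs' hc hts').2
      (hd t)).const_smul b
  have hdef := h.defect e he _ ht hte
  unfold geodesicDefect at hdef ⊢
  rw [hev.deriv_eq, d2.deriv, (d1 t hts').deriv, christoffelForm_smul_smul, smul_smul, ← smul_add,
    hdef, smul_zero]

/-- A solution of the geodesic equation in a chart defines a geodesic. -/
lemma isGeodesicOn_chart_symm (he : e ∈ atlas Plane F) {c c' : ℝ → Plane} (hs : IsOpen s)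
    (h : ∀ t ∈ s, c t ∈ e.target ∧ HasDerivAt c (c' t) t ∧
      HasDerivAt c' (-christoffelForm (chartMetric e) (c t) (c' t) (c' t)) t) :
    IsGeodesicOn (fun t => e.symm (c t)) s ∧ ∀ t ∈ s, deriv (fun τ => e (e.symm (c τ))) t = c' t := by
  have hc := (isSmoothMetricOn_chartMetric he).contDiffOn_of_geodesicODE e.open_target hs h
  have h1 : ∀ t ∈ s, (fun τ => e (e.symm (c τ))) =ᶠ[𝓝 t] c := fun t ht => by
    filter_upwards [hs.mem_nhds ht] with τ hτ using e.right_inv (h τ hτ).1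
  have h2 : ∀ t ∈ s, deriv (fun τ => e (e.symm (c τ))) t = c' t := fun t ht => by
    rw [(h1 t ht).deriv_eq, (h t ht).2.1.deriv]
  refine ⟨isGeodesicOn_of_exists_chart hs
    (contMDiffOn_chart_symm_comp he hc fun t ht => (h t ht).1)
    fun t ht => ⟨e, he, e.map_target (h t ht).1, ?_⟩, h2⟩
  have h3 : deriv (fun τ => e (e.symm (c τ))) =ᶠ[𝓝 t] c' := by
    filter_upwards [hs.mem_nhds ht] with τ hτ using h2 τ hτ
  unfold geodesicDefect
  rw [h3.deriv_eq, (h t ht).2.2.deriv, h2 t ht, e.right_inv (h t ht).1, neg_add_cancel]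

/-- Local existence of geodesics near a point, with smooth dependence on initial values. -/
theorem exists_local_geodesics (he : e ∈ atlas Plane F) {p : F} (hp : p ∈ e.source) :
    ∃ U : Set (Plane × Plane), IsOpen U ∧ (e p, 0) ∈ U ∧ ∃ Q : Plane × Plane → Plane,
      ContDiffOn ℝ ∞ Q U ∧ ∀ z ∈ U, z.1 ∈ e.target ∧ Q z ∈ e.target ∧
        ∃ γ : ℝ → F, IsGeodesicOn γ (Ioo (-2) 2) ∧ γ 0 = e.symm z.1 ∧
          deriv (fun τ => e (γ τ)) 0 = z.2 ∧ γ 1 = e.symm (Q z) := by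
  obtain ⟨U, hU, hU0, c, c', hQ, h⟩ := (isSmoothMetricOn_chartMetric he).exists_local_exp
    e.open_target (e.map_source hp)
  refine ⟨U, hU, hU0, fun z => c z 1, hQ, fun z hz => ?_⟩
  obtain ⟨h0, h0', hc⟩ := h z hz
  obtain ⟨h1, h2⟩ := isGeodesicOn_chart_symm he isOpen_Ioo hc
  refine ⟨?_, (hc 1 (by norm_num)).1, fun t => e.symm (c z t), h1, congrArg e.symm h0, ?_, rfl⟩
  · rw [← h0]; exact (hc 0 (by norm_num)).1
  · rw [h2 0 (by norm_num), h0']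

end GeodesicUniqueness

end

noncomputable section

/-! ### A local lower bound for the metric -/

section LowerBound

open Topology

lemma norm_sq_plane (w : Plane) : ‖w‖ ^ 2 = w 0 ^ 2 + w 1 ^ 2 := by
  rw [EuclideanSpace.norm_sq_eq, Fin.sum_univ_two, Real.norm_eq_abs, Real.norm_eq_abs, sq_abs,
    sq_abs]

/-- The quotient det / trace is at most the smaller eigenvalue of the metric and is continuous, so
half its value at `u₀` is a lower bound nearby. The bound serves to control chart velocities by
Riemannian speeds. -/
lemma IsSmoothMetricOn.exists_lower_bound {G : Plane → Matrix (Fin 2) (Fin 2) ℝ} {Ω : Set Plane}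
    (hG : IsSmoothMetricOn G Ω) (hΩ : IsOpen Ω) {u₀ : Plane} (hu₀ : u₀ ∈ Ω) :
    ∃ m : ℝ, 0 < m ∧ ∀ᶠ u in 𝓝 u₀, ∀ w : Plane, m * ‖w‖ ^ 2 ≤ metricForm G u w w := by
  have htr : ∀ u ∈ Ω, 0 < G u 0 0 + G u 1 1 := fun u hu => by
    have h0 := hG.metricForm_pos hu (a := EuclideanSpace.single 0 1)
      (fun h => by simpa using congrArg (fun v : Plane => v 0) h)
    have h1 := hG.metricForm_pos hu (a := EuclideanSpace.single 1 1)
      (fun h => by simpa using congrArg (fun v : Plane => v 1) h)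
    simp [metricForm] at h0 h1
    linarith
  have hpos : 0 < (G u₀).det / (G u₀ 0 0 + G u₀ 1 1) := div_pos (hG.det_pos hu₀) (htr u₀ hu₀)
  have hcont : ContinuousAt (fun u => (G u).det / (G u 0 0 + G u 1 1)) u₀ :=
    (hG.contDiffOn_det.continuousOn.continuousAt (hΩ.mem_nhds hu₀)).div
      (((hG.smooth 0 0).add (hG.smooth 1 1)).continuousOn.continuousAt (hΩ.mem_nhds hu₀))
      (htr u₀ hu₀).ne'
  refine ⟨_, half_pos hpos, ?_⟩
  filter_upwards [hcont.tendsto.eventually_const_lt (half_lt_self hpos), hΩ.mem_nhds hu₀] with u hu huΩ w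
  have h1 : (G u).det * ‖w‖ ^ 2 ≤ (G u 0 0 + G u 1 1) * metricForm G u w w := by
    rw [norm_sq_plane, hG.det_eq huΩ]
    simp only [metricForm, Fin.sum_univ_two, hG.symm u huΩ 1 0]
    -- By Cayley–Hamilton the difference of the two sides is the squared Euclidean norm of G w.
    nlinarith [sq_nonneg (G u 0 0 * w 0 + G u 0 1 * w 1), sq_nonneg (G u 0 1 * w 0 + G u 1 1 * w 1)]
  have h2 := htr u huΩ
  calc _ ≤ (G u).det / (G u 0 0 + G u 1 1) * ‖w‖ ^ 2 := by gcongr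
    _ ≤ _ := by
      rw [div_mul_eq_mul_div, div_le_iff₀ h2, mul_comm (metricForm G u w w)]
      exact h1

end LowerBound

/-! ### Geodesics on a complete surface exist for all times -/

section Completeness

open Topology Manifold

lemma chartDeriv_injective {F : Type*} [TopologicalSpace F] [ChartedSpace Plane F]
    [IsManifold 𝓘(ℝ, Plane) ∞ F] {e : OpenPartialHomeomorph F Plane} (he : e ∈ atlas Plane F)
    {q : F} (hq : q ∈ e.source) : Function.Injective (chartDeriv e q) := by
  have he1 : MDifferentiableAt 𝓘(ℝ, Plane) 𝓘(ℝ, Plane) e q :=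
    ((contMDiffOn_chart_of_mem_atlas he).contMDiffAt (e.open_source.mem_nhds hq)).mdifferentiableAt
      (by simp)
  have he2 : MDifferentiableAt 𝓘(ℝ, Plane) 𝓘(ℝ, Plane) e.symm (e q) :=
    ((contMDiffOn_chart_symm_of_mem_atlas he).contMDiffAt
      (e.open_target.mem_nhds (e.map_source hq))).mdifferentiableAt (by simp)
  have h1 := mfderiv_comp (I := 𝓘(ℝ, Plane)) (I' := 𝓘(ℝ, Plane)) (I'' := 𝓘(ℝ, Plane)) q he2 he1
  have h2 : (e.symm ∘ e) =ᶠ[𝓝 q] id := by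
    filter_upwards [e.open_source.mem_nhds hq] with r hr using e.left_inv hr
  have h3 : (flatDeriv e.symm (e q)).comp (chartDeriv e q) = ContinuousLinearMap.id ℝ Plane := by
    refine Eq.trans (Eq.symm h1) ?_
    rw [h2.mfderiv_eq, mfderiv_id]
    rfl
  intro a b hab
  have ha := congrArg (fun L : Plane →L[ℝ] Plane => L a) h3
  have hb := congrArg (fun L : Plane →L[ℝ] Plane => L b) h3
  simp only [ContinuousLinearMap.comp_apply, ContinuousLinearMap.id_apply] at ha hb
  rw [← ha, ← hb, hab]

variable {F : Type*} [EMetricSpace F] [ChartedSpace Plane F] [IsManifold 𝓘(ℝ, Plane) ∞ F]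
  [RiemannianBundle (fun x : F => TangentSpace 𝓘(ℝ, Plane) x)]
  [IsContMDiffRiemannianBundle 𝓘(ℝ, Plane) ∞ Plane (fun x : F => TangentSpace 𝓘(ℝ, Plane) x)]
  {γ : ℝ → F}

lemma IsGeodesicOn.edist_le [IsRiemannianManifold 𝓘(ℝ, Plane) F] {a b : ℝ}
    (h : IsGeodesicOn γ (Ioo a b)) {s t r : ℝ} (hs : s ∈ Ioo a b) (ht : t ∈ Ioo a b)
    (hr : r ∈ Ioo a b) (hst : s ≤ t) :
    edist (γ s) (γ t) ≤
      ENNReal.ofReal √(riemForm (γ r) (velocity γ r) (velocity γ r)) * ENNReal.ofReal (t - s) := by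
  have hsub : Icc s t ⊆ Ioo a b := fun τ hτ => ⟨hs.1.trans_le hτ.1, hτ.2.trans_lt ht.2⟩
  rw [IsRiemannianManifold.out (I := 𝓘(ℝ, Plane)) (γ s) (γ t)]
  refine (riemannianEDist_le_pathELength ((h.smooth.mono hsub).of_le ?_) rfl rfl hst).trans ?_
  · exact_mod_cast (le_top : (1 : ℕ∞) ≤ ⊤)
  rw [pathELength_eq_lintegral_mfderiv_Icc]
  have : ∀ τ ∈ Icc s t, ‖mfderiv 𝓘(ℝ, ℝ) 𝓘(ℝ, Plane) γ τ 1‖ₑ =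
      ENNReal.ofReal √(riemForm (γ r) (velocity γ r) (velocity γ r)) := fun τ hτ => by
    rw [enorm_tangentSpace_eq, h.speed_const isOpen_Ioo isPreconnected_Ioo hr (hsub hτ)]
    rfl
  rw [setLIntegral_congr_fun measurableSet_Icc this, setLIntegral_const, Real.volume_Icc]

/-- A geodesic has constant speed, so it is Lipschitz for the Riemannian distance and its values
form a Cauchy filter at the end time. -/
lemma IsGeodesicOn.exists_limit_right [IsRiemannianManifold 𝓘(ℝ, Plane) F] [CompleteSpace F]
    {a b : ℝ} (hab : a < b) (h : IsGeodesicOn γ (Ioo a b)) :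
    ∃ p, Filter.Tendsto γ (𝓝[<] b) (𝓝 p) := by
  have hr : (a + b) / 2 ∈ Ioo a b := ⟨by linarith, by linarith⟩
  set C : NNReal := Real.toNNReal √(riemForm (γ ((a + b) / 2)) (velocity γ ((a + b) / 2))
    (velocity γ ((a + b) / 2))) with hC
  have hlip : LipschitzOnWith C γ (Ioo a b) := by
    have key : ∀ s ∈ Ioo a b, ∀ t ∈ Ioo a b, s ≤ t → edist (γ s) (γ t) ≤ C * edist s t := by
      intro s hs t ht hst
      refine (h.edist_le hs ht hr hst).trans_eq ?_
      rw [edist_comm, edist_dist, Real.dist_eq, abs_of_nonneg (sub_nonneg.2 hst)]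
      rfl
    intro s hs t ht
    rcases le_total s t with hst | hst
    · exact key s hs t ht hst
    · rw [edist_comm, edist_comm s t]
      exact key t ht s hs hst
  have hu := hlip.uniformContinuousOn
  have hcau : Cauchy (Filter.map γ (𝓝[<] b)) := by
    refine ⟨inferInstance, ?_⟩
    rw [Filter.prod_map_map_eq]
    refine Filter.Tendsto.mono_left hu ?_
    refine le_inf ?_ ?_
    · exact (Filter.prod_mono nhdsWithin_le_nhds nhdsWithin_le_nhds).trans (cauchy_nhds).2
    · rw [← Filter.prod_principal_principal]
      have : 𝓝[<] b ≤ Filter.principal (Ioo a b) :=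
        Filter.le_principal_iff.2 (Ioo_mem_nhdsLT hab)
      exact Filter.prod_mono this this
  exact CompleteSpace.complete hcau

/-- On a complete surface a geodesic can be extended beyond a finite end time. -/
lemma IsGeodesicOn.extend_right [IsRiemannianManifold 𝓘(ℝ, Plane) F] [CompleteSpace F]
    {a b : ℝ} (hab : a < b) (h : IsGeodesicOn γ (Ioo a b)) :
    ∃ b' > b, ∃ γ', IsGeodesicOn γ' (Ioo a b') ∧ EqOn γ' γ (Ioo a b) := by
  obtain ⟨p, hp⟩ := h.exists_limit_right hab
  set e := chartAt Plane p with he_def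
  have he : e ∈ atlas Plane F := chart_mem_atlas _ _
  have hpe : p ∈ e.source := mem_chart_source _ _
  obtain ⟨U, hU, hU0, Q, -, hgeo⟩ := exists_local_geodesics he hpe
  obtain ⟨ρ, hρ, hρU⟩ := Metric.isOpen_iff.1 hU _ hU0
  obtain ⟨m, hm, hmb⟩ := (isSmoothMetricOn_chartMetric he).exists_lower_bound e.open_target
    (e.map_source hpe)
  have hr : (a + b) / 2 ∈ Ioo a b := ⟨by linarith, by linarith⟩
  set C := riemForm (γ ((a + b) / 2)) (velocity γ ((a + b) / 2)) (velocity γ ((a + b) / 2)) with hC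
  have hC0 : 0 ≤ C := riemForm_self_nonneg _ _
  -- Near p the chart velocity is at most √(C / m), so multiplied by δ it has norm less than ρ and
  -- is admissible for the local existence theorem. Undoing the scaling, the local geodesic runs for
  -- |τ - t| < 2δ.
  set δ := ρ / (√(C / m) + 1) with hδ
  have hδ0 : 0 < δ := by positivity
  have hce : Filter.Tendsto (fun τ => e (γ τ)) (𝓝[<] b) (𝓝 (e p)) :=
    (e.continuousAt hpe).tendsto.comp hp
  obtain ⟨t, ⟨ht1, ht2⟩, htδ, hte, htm, htρ⟩ : ∃ t, t ∈ Ioo a b ∧ b - δ < t ∧ γ t ∈ e.source ∧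
      (∀ w : Plane, m * ‖w‖ ^ 2 ≤ metricForm (chartMetric e) (e (γ t)) w w) ∧
      dist (e (γ t)) (e p) < ρ := by
    have e1 : ∀ᶠ t in 𝓝[<] b, t ∈ Ioo a b := Ioo_mem_nhdsLT hab
    have e2 : ∀ᶠ t in 𝓝[<] b, t ∈ Ioo (b - δ) b := Ioo_mem_nhdsLT (by linarith)
    have e3 := hp.eventually_mem (e.open_source.mem_nhds hpe)
    have e4 := hce.eventually hmb
    have e5 := hce.eventually_mem (Metric.ball_mem_nhds _ hρ)
    obtain ⟨t, h1, h2, h3, h4, h5⟩ := (e1.and (e2.and (e3.and (e4.and e5)))).exists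
    exact ⟨t, h1, h2.1, h3, h4, h5⟩
  have ht : t ∈ Ioo a b := ⟨ht1, ht2⟩
  set w := deriv (fun τ => e (γ τ)) t with hw
  have hwC : ‖w‖ ≤ √(C / m) := by
    refine Real.le_sqrt_of_sq_le ?_
    rw [le_div_iff₀ hm, mul_comm]
    refine (htm w).trans_eq ?_
    rw [hC, h.speed_const isOpen_Ioo isPreconnected_Ioo hr ht, velocity,
      riemForm_flatDeriv he (h.mdifferentiableAt isOpen_Ioo ht) hte, fderiv_apply_one_eq_deriv]
  have hz : (e (γ t), δ • w) ∈ U := by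
    apply hρU
    rw [Metric.mem_ball, Prod.dist_eq, max_lt_iff]
    refine ⟨htρ, ?_⟩
    rw [dist_zero_right, norm_smul, Real.norm_of_nonneg hδ0.le, hδ, div_mul_eq_mul_div,
      div_lt_iff₀ (by positivity)]
    nlinarith
  obtain ⟨-, -, σ₀, hσ₀, h0, h0', -⟩ := hgeo _ hz
  have hσ := hσ₀.comp_affine isOpen_Ioo (-t / δ) δ⁻¹
  set σ : ℝ → F := fun τ => σ₀ (-t / δ + δ⁻¹ * τ) with hσdef
  have hpre : Ioo (t - 2 * δ) (t + 2 * δ) ⊆ (fun τ => -t / δ + δ⁻¹ * τ) ⁻¹' Ioo (-2) 2 := by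
    intro τ hτ
    have : -t / δ + δ⁻¹ * τ = (τ - t) / δ := by field_simp; ring
    rw [mem_preimage, this]
    exact ⟨by rw [lt_div_iff₀ hδ0]; linarith [hτ.1], by rw [div_lt_iff₀ hδ0]; linarith [hτ.2]⟩
  have hσ' : IsGeodesicOn σ (Ioo (t - 2 * δ) (t + 2 * δ)) := hσ.mono hpre
  have htσ : t ∈ Ioo (t - 2 * δ) (t + 2 * δ) := ⟨by linarith, by linarith⟩
  have hz0 : -t / δ + δ⁻¹ * t = 0 := by field_simp; ring
  have hσt : σ t = γ t := by
    rw [hσdef]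
    simp only [hz0, h0]
    exact e.left_inv hte
  have hσt' : deriv (fun τ => e (σ τ)) t = w := by
    have h1 : σ₀ 0 ∈ e.source := by rw [h0]; exact e.map_target (e.map_source hte)
    rw [hσ'.deriv_chart isOpen_Ioo htσ he (hσt ▸ hte), hσdef,
      velocity_comp_affine hσ₀ isOpen_Ioo (-t / δ) δ⁻¹ (by rw [hz0]; norm_num), map_smul]
    simp only [hz0]
    rw [← hσ₀.deriv_chart isOpen_Ioo (by norm_num) he h1, h0', smul_smul,
      inv_mul_cancel₀ hδ0.ne', one_smul]
  have hev : γ =ᶠ[𝓝 t] σ := h.eventuallyEq_of_deriv_chart isOpen_Ioo hσ' isOpen_Ioo ht htσ he hte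
    hσt.symm hσt'.symm
  have hEq : EqOn γ σ (Ioo (max a (t - 2 * δ)) b) := by
    refine (h.mono (Ioo_subset_Ioo_left (le_max_left _ _))).eqOn
      (hσ'.mono (Ioo_subset_Ioo (le_max_right _ _) (by linarith))) isOpen_Ioo isPreconnected_Ioo
      ⟨max_lt ht1 (by linarith), ht2⟩ hev
  -- As t > b - δ, the new end time exceeds b + δ.
  refine ⟨t + 2 * δ, by linarith, fun τ => if τ < b then γ τ else σ τ, ?_, ?_⟩
  · refine isGeodesicOn_of_eventuallyEq fun τ hτ => ?_
    by_cases hτb : τ < b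
    · refine ⟨γ, Ioo a b, isOpen_Ioo, ⟨hτ.1, hτb⟩, h, ?_⟩
      filter_upwards [Iio_mem_nhds hτb] with r hr
      exact if_pos hr
    · refine ⟨σ, Ioo (t - 2 * δ) (t + 2 * δ), isOpen_Ioo, ⟨by linarith, hτ.2⟩, hσ', ?_⟩
      filter_upwards [Ioi_mem_nhds (show max a (t - 2 * δ) < τ from
        (max_lt ht1 (by linarith)).trans (ht2.trans_le (not_lt.1 hτb)))] with r hr
      by_cases hrb : r < b
      · rw [if_pos hrb]; exact hEq ⟨hr, hrb⟩
      · rw [if_neg hrb]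
  · intro τ hτ
    exact if_pos hτ.2

/-- This is `IsGeodesicOn.extend_right` for the time-reversed curve. -/
lemma IsGeodesicOn.extend_left [IsRiemannianManifold 𝓘(ℝ, Plane) F] [CompleteSpace F]
    {a b : ℝ} (hab : a < b) (h : IsGeodesicOn γ (Ioo a b)) :
    ∃ a' < a, ∃ γ', IsGeodesicOn γ' (Ioo a' b) ∧ EqOn γ' γ (Ioo a b) := by
  have h1 := (h.comp_affine isOpen_Ioo 0 (-1)).mono
    (s' := Ioo (-b) (-a)) (fun τ hτ => ⟨by linarith [hτ.2], by linarith [hτ.1]⟩)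
  obtain ⟨b', hb', γ', hγ', heq⟩ := h1.extend_right (by linarith)
  refine ⟨-b', by linarith, fun τ => γ' (0 + -1 * τ), (hγ'.comp_affine isOpen_Ioo 0 (-1)).mono
    (fun τ hτ => ⟨by linarith [hτ.2], by linarith [hτ.1]⟩), fun τ hτ => ?_⟩
  have := heq (x := 0 + -1 * τ) ⟨by linarith [hτ.2], by linarith [hτ.1]⟩
  simp only [this]
  congr 1
  ring

/-- Local existence requires a small initial velocity. A geodesic with velocity δ v on (-2, 2)
becomes one with velocity v on (-2δ, 2δ). -/
lemma exists_short_geodesic (x : F) (v : Plane) :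
    ∃ r > 0, ∃ γ : ℝ → F, IsGeodesicOn γ (Ioo (-r) r) ∧ γ 0 = x ∧ velocity γ 0 = v := by
  set e := chartAt Plane x with he_def
  have he : e ∈ atlas Plane F := chart_mem_atlas _ _
  have hxe : x ∈ e.source := mem_chart_source _ _
  obtain ⟨U, hU, hU0, Q, -, hgeo⟩ := exists_local_geodesics he hxe
  have hc : ContinuousAt (fun δ : ℝ => (e x, δ • chartDeriv e x v)) 0 := by fun_prop
  have hev := hc.eventually_mem (hU.mem_nhds (by simpa using hU0))
  obtain ⟨δ, hδU, hδ0⟩ : ∃ δ : ℝ, (e x, δ • chartDeriv e x v) ∈ U ∧ 0 < δ :=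
    ((hev.filter_mono nhdsWithin_le_nhds).and
      (self_mem_nhdsWithin : ∀ᶠ δ in 𝓝[>] (0 : ℝ), δ ∈ Ioi 0)).exists
  obtain ⟨-, -, σ, hσ, h0, h0', -⟩ := hgeo _ hδU
  have h1 : σ 0 = x := by rw [h0]; exact e.left_inv hxe
  have h2 : velocity σ 0 = δ • v := by
    have h3 := hσ.deriv_chart isOpen_Ioo (t := 0) (by norm_num) he (h1 ▸ hxe)
    rw [h0', h1, ← map_smul] at h3
    exact (chartDeriv_injective he hxe h3).symm
  refine ⟨2 * δ, by positivity, fun τ => σ (0 + δ⁻¹ * τ),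
    (hσ.comp_affine isOpen_Ioo 0 δ⁻¹).mono fun τ hτ => ?_, by simpa using h1, ?_⟩
  · rw [mem_preimage, zero_add, inv_mul_eq_div]
    exact ⟨by rw [lt_div_iff₀ hδ0]; linarith [hτ.1], by rw [div_lt_iff₀ hδ0]; linarith [hτ.2]⟩
  · rw [velocity_comp_affine hσ isOpen_Ioo 0 δ⁻¹ (by simp)]
    simp only [mul_zero, add_zero]
    rw [h2, smul_smul, inv_mul_cancel₀ hδ0.ne', one_smul]

/-- On a complete surface every geodesic is defined for all times. -/
theorem exists_complete_geodesic [IsRiemannianManifold 𝓘(ℝ, Plane) F] [CompleteSpace F]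
    (x : F) (v : Plane) :
    ∃ γ : ℝ → F, IsGeodesicOn γ univ ∧ γ 0 = x ∧ velocity γ 0 = v := by
  -- By uniqueness the geodesics on these symmetric intervals glue. If the half-lengths had a finite
  -- supremum, the glued curve could be continued past both ends.
  set A : Set ℝ := {b | 0 < b ∧ ∃ γ : ℝ → F, IsGeodesicOn γ (Ioo (-b) b) ∧ γ 0 = x ∧
    velocity γ 0 = v} with hA
  obtain ⟨r, hr, hrA⟩ := exists_short_geodesic x v
  have hrA' : r ∈ A := ⟨hr, hrA⟩
  have hch : ∀ b : A, ∃ γ : ℝ → F, IsGeodesicOn γ (Ioo (-b) b) ∧ γ 0 = x ∧ velocity γ 0 = v :=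
    fun b => b.2.2
  choose Γ hΓ hΓ0 hΓ1 using hch
  have hmem0 : ∀ b : A, (0 : ℝ) ∈ Ioo (-(b : ℝ)) b := fun b => ⟨by linarith [b.2.1], b.2.1⟩
  have hcons : ∀ (b b' : A) (t : ℝ), |t| < b → |t| < b' → Γ b t = Γ b' t := by
    have key : ∀ (b b' : A) (t : ℝ), (b : ℝ) ≤ b' → |t| < b → Γ b t = Γ b' t := by
      intro b b' t hbb' ht
      have hsub : Ioo (-(b : ℝ)) b ⊆ Ioo (-(b' : ℝ)) b' := Ioo_subset_Ioo (by linarith) hbb'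
      exact (hΓ b).eqOn ((hΓ b').mono hsub) isOpen_Ioo isPreconnected_Ioo (hmem0 b)
        ((hΓ b).eventuallyEq_of_velocity isOpen_Ioo (hΓ b') isOpen_Ioo (hmem0 b) (hmem0 b')
          ((hΓ0 b).trans (hΓ0 b').symm) ((hΓ1 b).trans (hΓ1 b').symm)) (abs_lt.1 ht)
    intro b b' t hb hb'
    rcases le_total (b : ℝ) b' with h | h
    · exact key b b' t h hb
    · exact (key b' b t h hb').symm
  classical
  set S : Set ℝ := {t | ∃ b : A, |t| < b} with hS
  let γ : ℝ → F := fun t => if h : ∃ b : A, |t| < b then Γ h.choose t else x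
  have hγ : ∀ (b : A) (t : ℝ), |t| < b → γ t = Γ b t := by
    intro b t ht
    have h : ∃ b : A, |t| < b := ⟨b, ht⟩
    simp only [γ, dif_pos h]
    exact hcons _ _ t h.choose_spec ht
  have hγev : ∀ (b : A) (t : ℝ), |t| < b → γ =ᶠ[𝓝 t] Γ b := fun b t ht => by
    filter_upwards [isOpen_Ioo.mem_nhds (abs_lt.1 ht)] with τ hτ using hγ b τ (abs_lt.2 hτ)
  have hγS : IsGeodesicOn γ S := isGeodesicOn_of_eventuallyEq fun t ⟨b, hb⟩ =>
    ⟨Γ b, _, isOpen_Ioo, abs_lt.1 hb, hΓ b, hγev b t hb⟩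
  have hr0 : |(0 : ℝ)| < ((⟨r, hrA'⟩ : A) : ℝ) := by simpa using hr
  have hγ0 : γ 0 = x := (hγ ⟨r, hrA'⟩ 0 hr0).trans (hΓ0 _)
  have hvel : ∀ {γ₁ γ₂ : ℝ → F}, γ₁ =ᶠ[𝓝 0] γ₂ → velocity γ₁ 0 = velocity γ₂ 0 := fun h => by
    unfold velocity flatDeriv
    exact congrArg (fun L : ℝ →L[ℝ] Plane => L 1) (Filter.EventuallyEq.mfderiv_eq h)
  have hγ1 : velocity γ 0 = v := (hvel (hγev ⟨r, hrA'⟩ 0 hr0)).trans (hΓ1 _)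
  by_cases hbdd : BddAbove A
  · exfalso
    set B := sSup A with hB
    have hrB : r ≤ B := le_csSup hbdd hrA'
    have hSB : Ioo (-B) B ⊆ S := fun t ht => by
      obtain ⟨b, hb, hlt⟩ := exists_lt_of_lt_csSup ⟨r, hrA'⟩ (abs_lt.2 ht)
      exact ⟨⟨b, hb⟩, hlt⟩
    have h1 := hγS.mono hSB
    obtain ⟨b', hb', γ', hγ', heq'⟩ := h1.extend_right (by linarith)
    obtain ⟨a', ha', γ'', hγ'', heq''⟩ := hγ'.extend_left (by linarith)
    have hev : γ'' =ᶠ[𝓝 0] γ := by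
      filter_upwards [isOpen_Ioo.mem_nhds (show (0 : ℝ) ∈ Ioo (-B) B from
        ⟨by linarith, by linarith⟩)] with τ hτ
      rw [heq'' ⟨hτ.1, hτ.2.trans hb'⟩, heq' hτ]
    have hmem : min (-a') b' ∈ A := by
      refine ⟨lt_min (by linarith) (by linarith), γ'', hγ''.mono (Ioo_subset_Ioo ?_ ?_),
        hev.eq_of_nhds.trans hγ0, (hvel hev).trans hγ1⟩
      · linarith [min_le_left (-a') b']
      · exact min_le_right _ _
    have : B < min (-a') b' := lt_min (by linarith) hb'
    exact absurd (le_csSup hbdd hmem) (not_le.2 this)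
  · have hSu : S = univ := by
      refine eq_univ_of_forall fun t => ?_
      obtain ⟨b, hb, hlt⟩ := not_bddAbove_iff.1 hbdd |t|
      exact ⟨⟨b, hb⟩, hlt⟩
    exact ⟨γ, hSu ▸ hγS, hγ0, hγ1⟩

end Completeness

end

noncomputable section
-- The exponential map and its smoothness
section Exponential
open Topology

variable {F : Type*} [EMetricSpace F] [ChartedSpace Plane F]
  [IsManifold 𝓘(ℝ, Plane) ∞ F]
  [RiemannianBundle (fun x : F => TangentSpace 𝓘(ℝ, Plane) x)]
  [IsContMDiffRiemannianBundle 𝓘(ℝ, Plane) ∞ Plane (fun x : F => TangentSpace 𝓘(ℝ, Plane) x)]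

lemma IsGeodesicOn.eq_of_initial {γ γ' : ℝ → F} (h : IsGeodesicOn γ univ)
    (h' : IsGeodesicOn γ' univ) (h0 : γ 0 = γ' 0) (hv : velocity γ 0 = velocity γ' 0) : γ = γ' := by
  funext t
  exact h.eqOn h' isOpen_univ isPreconnected_univ (mem_univ (0 : ℝ))
    (h.eventuallyEq_of_velocity isOpen_univ h' isOpen_univ (mem_univ _) (mem_univ _) h0 hv)
    (mem_univ t)

/-- A geodesic is propagated by the local solution map `Q` of the geodesic equation. -/
lemma IsGeodesicOn.eq_chart_symm {e : OpenPartialHomeomorph F Plane} (he : e ∈ atlas Plane F)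
    {U : Set (Plane × Plane)} {Q : Plane × Plane → Plane}
    (hQ : ∀ z ∈ U, z.1 ∈ e.target ∧ Q z ∈ e.target ∧
        ∃ γ : ℝ → F, IsGeodesicOn γ (Ioo (-2) 2) ∧ γ 0 = e.symm z.1 ∧
          deriv (fun τ => e (γ τ)) 0 = z.2 ∧ γ 1 = e.symm (Q z))
    {γ : ℝ → F} (h : IsGeodesicOn γ univ) {t τ : ℝ} (ht : γ t ∈ e.source)
    (hU : (e (γ t), (τ - t) • deriv (fun τ => e (γ τ)) t) ∈ U) :
    γ τ = e.symm (Q (e (γ t), (τ - t) • deriv (fun τ => e (γ τ)) t)) ∧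
      Q (e (γ t), (τ - t) • deriv (fun τ => e (γ τ)) t) ∈ e.target := by
  obtain ⟨-, hQt, σ, hσ, hσ0, hσ1, hσ2⟩ := hQ _ hU
  refine ⟨?_, hQt⟩
  simp only [e.left_inv ht] at hσ0
  have h1 := h.comp_affine isOpen_univ t (τ - t)
  simp only [preimage_univ] at h1
  have h00 : t + (τ - t) * 0 = t := by ring
  have h2 : deriv (fun s => e (γ (t + (τ - t) * s))) 0 = (τ - t) • deriv (fun τ => e (γ τ)) t := by
    rw [h1.deriv_chart isOpen_univ (mem_univ _) he (by simpa using ht),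
      velocity_comp_affine h isOpen_univ t (τ - t) (mem_univ _),
      h.deriv_chart isOpen_univ (mem_univ _) he ht, map_smul, h00]
  have h3 := h1.eventuallyEq_of_deriv_chart isOpen_univ hσ isOpen_Ioo (mem_univ (0 : ℝ))
    (by norm_num) he (by simpa using ht) (by simp [hσ0]) (h2.trans hσ1.symm)
  have h4 := (h1.mono (subset_univ (Ioo (-2 : ℝ) 2))).eqOn hσ isOpen_Ioo isPreconnected_Ioo
    (by norm_num) h3 (show (1 : ℝ) ∈ Ioo (-2 : ℝ) 2 by norm_num)
  simp only [mul_one, add_sub_cancel] at h4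
  rw [h4, hσ2]

variable [IsRiemannianManifold 𝓘(ℝ, Plane) F] [CompleteSpace F]

/-- The geodesic with initial point `x` and initial velocity `v`. -/
def geodesicFrom (x : F) (v : Plane) : ℝ → F := (exists_complete_geodesic x v).choose

lemma isGeodesicOn_geodesicFrom (x : F) (v : Plane) : IsGeodesicOn (geodesicFrom x v) univ :=
  (exists_complete_geodesic x v).choose_spec.1

@[simp] lemma geodesicFrom_zero (x : F) (v : Plane) : geodesicFrom x v 0 = x :=
  (exists_complete_geodesic x v).choose_spec.2.1

@[simp] lemma velocity_geodesicFrom (x : F) (v : Plane) : velocity (geodesicFrom x v) 0 = v :=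
  (exists_complete_geodesic x v).choose_spec.2.2

lemma IsGeodesicOn.eq_geodesicFrom {γ : ℝ → F} (h : IsGeodesicOn γ univ) :
    γ = geodesicFrom (γ 0) (velocity γ 0) :=
  h.eq_of_initial (isGeodesicOn_geodesicFrom _ _) (geodesicFrom_zero _ _).symm
    (velocity_geodesicFrom _ _).symm

lemma geodesicFrom_smul (x : F) (v : Plane) (r t : ℝ) :
    geodesicFrom x (r • v) t = geodesicFrom x v (r * t) := by
  have h := (isGeodesicOn_geodesicFrom x v).comp_affine isOpen_univ 0 r
  have h' := velocity_comp_affine (isGeodesicOn_geodesicFrom x v) isOpen_univ 0 r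
    (mem_univ (0 + r * 0))
  simp only [preimage_univ, zero_add, mul_zero, velocity_geodesicFrom] at h h'
  have := h.eq_geodesicFrom
  simp only [mul_zero, geodesicFrom_zero, h'] at this
  rw [← this]

lemma surfaceExp_eq (x : F) (v : Plane) : surfaceExp x v = geodesicFrom x v 1 := by
  have hiff : ∀ γ : ℝ → F, HasInitialVelocity γ x v ↔ γ 0 = x ∧ velocity γ 0 = v := by
    intro γ
    unfold HasInitialVelocity
    constructor
    · intro h
      have h1 : γ 0 = x := congrArg TotalSpace.proj h
      refine ⟨h1, ?_⟩
      have h2 := (TotalSpace.mk.injEq .. ▸ h : _ ∧ _).2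
      exact eq_of_heq h2
    · rintro ⟨h1, h2⟩
      subst h1
      subst h2
      rfl
  have hex : ∃ γ : ℝ → F, IsSurfaceGeodesic γ ∧ HasInitialVelocity γ x v :=
    ⟨geodesicFrom x v, isSurfaceGeodesic_iff.2 (isGeodesicOn_geodesicFrom x v),
      (hiff _).2 ⟨geodesicFrom_zero x v, velocity_geodesicFrom x v⟩⟩
  unfold surfaceExp
  rw [dif_pos hex]
  obtain ⟨h1, h2⟩ := hex.choose_spec
  obtain ⟨h3, h4⟩ := (hiff _).1 h2
  have := (isSurfaceGeodesic_iff.1 h1).eq_geodesicFrom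
  rw [h3, h4] at this
  exact congrFun this 1

/-- Position at time t' is a smooth function Q of position and velocity at time t. Hence smooth
dependence of these data on the initial velocity passes from t to t', jointly with the time. -/
lemma contMDiffAt_geodesicFrom_propagate (x : F) (v : Plane) {e : OpenPartialHomeomorph F Plane}
    (he : e ∈ atlas Plane F) {U : Set (Plane × Plane)} (hUo : IsOpen U)
    {Q : Plane × Plane → Plane} (hQs : ContDiffOn ℝ ∞ Q U)
    (hQ : ∀ z ∈ U, z.1 ∈ e.target ∧ Q z ∈ e.target ∧
        ∃ γ : ℝ → F, IsGeodesicOn γ (Ioo (-2) 2) ∧ γ 0 = e.symm z.1 ∧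
          deriv (fun τ => e (γ τ)) 0 = z.2 ∧ γ 1 = e.symm (Q z)) {t t' : ℝ}
    (hU : (e (geodesicFrom x v t), (t' - t) • deriv (fun τ => e (geodesicFrom x v τ)) t) ∈ U)
    (hs : ContDiffAt ℝ ∞ (fun w => e (geodesicFrom x w t)) v)
    (hd : ContDiffAt ℝ ∞ (fun w => deriv (fun τ => e (geodesicFrom x w τ)) t) v)
    (hc : ∀ᶠ w in 𝓝 v, geodesicFrom x w t ∈ e.source) :
    ContMDiffAt 𝓘(ℝ, ℝ × Plane) 𝓘(ℝ, Plane) ∞ (fun z : ℝ × Plane => geodesicFrom x z.2 z.1)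
      (t', v) := by
  let ψ : ℝ × Plane → Plane × Plane := fun z =>
    (e (geodesicFrom x z.2 t), (z.1 - t) • deriv (fun τ => e (geodesicFrom x z.2 τ)) t)
  have hψ : ContDiffAt ℝ ∞ ψ (t', v) :=
    (ContDiffAt.comp (t', v) hs contDiffAt_snd).prodMk
      ((contDiffAt_fst.sub contDiffAt_const).smul (ContDiffAt.comp (t', v) hd contDiffAt_snd))
  have h1 : ContDiffAt ℝ ∞ (fun z => Q (ψ z)) (t', v) :=
    ContDiffAt.comp (t', v) (hQs.contDiffAt (hUo.mem_nhds hU)) hψ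
  have hev : ∀ᶠ z in 𝓝 (t', v), ψ z ∈ U ∧ geodesicFrom x z.2 t ∈ e.source :=
    (hψ.continuousAt.eventually_mem (hUo.mem_nhds hU)).and
      ((continuousAt_snd (p := (t', v))).eventually hc)
  have h2 : ContMDiffAt 𝓘(ℝ, ℝ × Plane) 𝓘(ℝ, Plane) ∞ (fun z => e.symm (Q (ψ z))) (t', v) :=
    ContMDiffAt.comp (t', v) ((contMDiffOn_chart_symm_of_mem_atlas he).contMDiffAt
      (e.open_target.mem_nhds (hQ _ hU).2.1)) h1.contMDiffAt
  refine h2.congr_of_eventuallyEq ?_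
  filter_upwards [hev] with z hz
  exact ((isGeodesicOn_geodesicFrom x z.2).eq_chart_symm he hQ hz.2 hz.1).1

lemma contMDiffAt_geodesicFrom_zero (x : F) (v : Plane) :
    ContMDiffAt 𝓘(ℝ, ℝ × Plane) 𝓘(ℝ, Plane) ∞ (fun z : ℝ × Plane => geodesicFrom x z.2 z.1)
      (0, v) := by
  have he : chartAt Plane x ∈ atlas Plane F := chart_mem_atlas _ _
  have hx : x ∈ (chartAt Plane x).source := mem_chart_source _ _
  obtain ⟨U, hUo, hU0, Q, hQs, hQ⟩ := exists_local_geodesics he hx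
  have hd : ∀ w, deriv (fun τ => chartAt Plane x (geodesicFrom x w τ)) 0 =
      chartDeriv (chartAt Plane x) x w := fun w => by
    rw [(isGeodesicOn_geodesicFrom x w).deriv_chart isOpen_univ (mem_univ _) he (by simp [hx]),
      velocity_geodesicFrom, geodesicFrom_zero]
  refine contMDiffAt_geodesicFrom_propagate x v he hUo hQs hQ (t := 0)
    (by simpa using hU0) ?_ ?_ ?_
  · simp only [geodesicFrom_zero]; exact contDiffAt_const
  · simp only [hd]; exact (chartDeriv (chartAt Plane x) x).contDiff.contDiffAt
  · simp [hx]

/-- A single chart and a single local solution map serve for all pairs of times near `t₁`, since the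
scaled velocity (t' - t) γ' is then small. Uniformity in both times is what lets smoothness pass to
limit times. -/
lemma contMDiffAt_geodesicFrom_step (x : F) (v : Plane) (t₁ : ℝ) :
    ∀ᶠ q : ℝ × ℝ in 𝓝 (t₁, t₁),
      ContMDiffAt 𝓘(ℝ, ℝ × Plane) 𝓘(ℝ, Plane) ∞ (fun z : ℝ × Plane => geodesicFrom x z.2 z.1)
        (q.1, v) →
      ContMDiffAt 𝓘(ℝ, ℝ × Plane) 𝓘(ℝ, Plane) ∞ (fun z : ℝ × Plane => geodesicFrom x z.2 z.1)
        (q.2, v) := by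
  set γ := geodesicFrom x v with hγ
  have hg : IsGeodesicOn γ univ := isGeodesicOn_geodesicFrom x v
  set e := chartAt Plane (γ t₁) with he'
  have he : e ∈ atlas Plane F := chart_mem_atlas _ _
  have hx : γ t₁ ∈ e.source := mem_chart_source _ _
  obtain ⟨U, hUo, hU0, Q, hQs, hQ⟩ := exists_local_geodesics he hx
  obtain ⟨h1, h2⟩ := (hg.eventually_chart isOpen_univ (mem_univ _) he hx).self_of_nhds
  have hc1 : ContinuousAt (fun q : ℝ × ℝ =>
      (e (γ q.1), (q.2 - q.1) • deriv (fun τ => e (γ τ)) q.1)) (t₁, t₁) :=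
    (ContinuousAt.comp (x := (t₁, t₁)) (f := Prod.fst) (g := fun τ => e (γ τ)) h1.continuousAt
      continuousAt_fst).prodMk ((continuousAt_snd.sub continuousAt_fst).smul
      (ContinuousAt.comp (x := (t₁, t₁)) (f := Prod.fst) (g := deriv fun τ => e (γ τ))
        h2.continuousAt continuousAt_fst))
  have hev1 := hc1.eventually_mem (s := U) (hUo.mem_nhds (by simpa using hU0))
  have hev2 : ∀ᶠ q : ℝ × ℝ in 𝓝 (t₁, t₁), γ q.1 ∈ e.source :=
    (ContinuousAt.comp (x := (t₁, t₁)) (f := Prod.fst) (g := γ)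
      (hg.continuousAt isOpen_univ (mem_univ _)) continuousAt_fst).eventually_mem
      (e.open_source.mem_nhds hx)
  filter_upwards [hev1, hev2] with q hq1 hq2 hs
  have hf : ContDiffAt ℝ ∞ (fun z : ℝ × Plane => e (geodesicFrom x z.2 z.1)) (q.1, v) :=
    (ContMDiffAt.comp (q.1, v) ((contMDiffOn_chart_of_mem_atlas he).contMDiffAt
      (e.open_source.mem_nhds hq2)) hs).contDiffAt
  have hi : ContDiffAt ℝ ∞ (fun w : Plane => (q.1, w)) v := contDiffAt_const.prodMk contDiffAt_id
  refine contMDiffAt_geodesicFrom_propagate x v he hUo hQs hQ hq1 ?_ ?_ ?_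
  · exact ContDiffAt.comp v (f := fun w : Plane => (q.1, w)) hf hi
  · have hf' : ContDiffAt ℝ ∞ (fun w : Plane =>
        fderiv ℝ (fun z : ℝ × Plane => e (geodesicFrom x z.2 z.1)) (q.1, w) (1, 0)) v :=
      (ContDiffAt.comp v (f := fun w : Plane => (q.1, w))
        (hf.fderiv_right (m := ∞) (by simp)) hi).clm_apply contDiffAt_const
    refine hf'.congr_of_eventuallyEq ?_
    have hdiff : ∀ᶠ z in 𝓝 (q.1, v),
        DifferentiableAt ℝ (fun z : ℝ × Plane => e (geodesicFrom x z.2 z.1)) z := by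
      have h1 : ContDiffAt ℝ 1 (fun z : ℝ × Plane => e (geodesicFrom x z.2 z.1)) (q.1, v) :=
        hf.of_le (by exact_mod_cast (le_top : (1 : ℕ∞) ≤ ⊤))
      exact (h1.eventually (by simp)).mono fun z hz => hz.differentiableAt (by simp)
    filter_upwards [hi.continuousAt.eventually hdiff] with w hw
    have hl : HasDerivAt (fun τ : ℝ => (τ, w)) ((1 : ℝ), (0 : Plane)) q.1 :=
      (hasDerivAt_id q.1).prodMk (hasDerivAt_const q.1 w)
    exact (HasFDerivAt.comp_hasDerivAt (f := fun τ : ℝ => (τ, w)) q.1 hw.hasFDerivAt hl).deriv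
  · exact (ContinuousAt.comp (x := v) (f := fun w : Plane => (q.1, w)) hs.continuousAt
      hi.continuousAt).eventually_mem (e.open_source.mem_nhds hq2)

/-- Geodesics depend smoothly on time and initial velocity. -/
theorem contMDiff_geodesicFrom (x : F) :
    ContMDiff 𝓘(ℝ, ℝ × Plane) 𝓘(ℝ, Plane) ∞ (fun z : ℝ × Plane => geodesicFrom x z.2 z.1) := by
  rintro ⟨t, v⟩
  let S : Set ℝ := {t | ContMDiffAt 𝓘(ℝ, ℝ × Plane) 𝓘(ℝ, Plane) ∞
    (fun z : ℝ × Plane => geodesicFrom x z.2 z.1) (t, v)}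
  -- For the closed part, `t₁` is reached by one step from some nearby time in S; for the open part,
  -- nearby times are reached by one step from `t₁`.
  have hS : IsClopen S := by
    constructor
    · refine isClosed_of_closure_subset fun t₁ ht₁ => ?_
      have h := contMDiffAt_geodesicFrom_step x v t₁
      rw [nhds_prod_eq] at h
      obtain ⟨τ, hτ, hτS⟩ := ((Filter.Eventually.curry h).and_frequently
        (mem_closure_iff_frequently.1 ht₁)).exists
      exact hτ.self_of_nhds hτS
    · refine isOpen_iff_mem_nhds.2 fun t₁ ht₁ => ?_
      have h := contMDiffAt_geodesicFrom_step x v t₁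
      rw [nhds_prod_eq] at h
      have h2 := (Filter.Eventually.curry h).self_of_nhds
      filter_upwards [h2] with τ hτ using hτ ht₁
  have : S = univ := hS.eq_univ ⟨0, contMDiffAt_geodesicFrom_zero x v⟩
  exact (this.symm ▸ mem_univ t : t ∈ S)

end Exponential
end

noncomputable section
-- Sturm comparison
section Comparison
open Topology

/-- Sturm comparison with `S'' = -k S` for `Y = z²`, where `z'' = -κ z` with `κ ≤ k`, and `z` is
only given locally. -/
lemma sturm_comparison_pos {Y : ℝ → ℝ} {k : ℝ} (hk : 0 < k)
    (h : ∀ t₀, ∃ z z' : ℝ → ℝ, (∀ᶠ t in 𝓝 t₀, Y t = z t ^ 2 ∧ HasDerivAt z (z' t) t) ∧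
      ∃ κ ≤ k, HasDerivAt z' (-(κ * z t₀)) t₀)
    (h0 : ∃ z z' : ℝ → ℝ, (∀ᶠ t in 𝓝 0, Y t = z t ^ 2 ∧ HasDerivAt z (z' t) t) ∧
      ContinuousAt z' 0 ∧ z 0 = 0 ∧ z' 0 ≠ 0) {t : ℝ} (ht : t ∈ Ioo 0 (Real.pi / √k)) : 0 < Y t := by
  have hY0 : ∀ t, 0 ≤ Y t := fun t => by
    obtain ⟨z, z', hz, -⟩ := h t
    rw [hz.self_of_nhds.1]; positivity
  have hYc : Continuous Y := continuous_iff_continuousAt.2 fun t => by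
    obtain ⟨z, z', hz, -⟩ := h t
    exact (hz.self_of_nhds.2.continuousAt.pow 2).congr (hz.mono fun s hs => hs.1.symm)
  -- Only the square of z matters, so its sign can be chosen with z'(0) > 0.
  have h0' : ∃ z z' : ℝ → ℝ, (∀ᶠ t in 𝓝 0, Y t = z t ^ 2 ∧ HasDerivAt z (z' t) t) ∧
      ContinuousAt z' 0 ∧ z 0 = 0 ∧ 0 < z' 0 := by
    obtain ⟨z, z', hz, hc, hz0, hz1⟩ := h0
    rcases hz1.lt_or_gt with hlt | hgt
    · exact ⟨fun t => -z t, fun t => -z' t, hz.mono fun t ht => ⟨by rw [ht.1]; ring, ht.2.neg⟩,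
        hc.neg, by simp [hz0], by simpa using hlt⟩
    · exact ⟨z, z', hz, hc, hz0, hgt⟩
  obtain ⟨z, z', hz, hzc, hz0, hz1⟩ := h0'
  obtain ⟨δ, hδ, hball⟩ : ∃ δ > 0, ∀ t ∈ Ioo (0 : ℝ) δ, 0 < z t ∧ Y t = z t ^ 2 ∧
      HasDerivAt z (z' t) t := by
    have h1 : ∀ᶠ t in 𝓝 (0 : ℝ), 0 < z' t := hzc.eventually_const_lt hz1
    obtain ⟨δ, hδ, hb⟩ := Metric.eventually_nhds_iff.1 (hz.and h1)
    have hmem : ∀ t ∈ Ico (0 : ℝ) δ, dist t 0 < δ := fun t ht => by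
      simpa [abs_of_nonneg ht.1] using ht.2
    refine ⟨δ, hδ, fun t ht => ⟨?_, (hb (hmem t ⟨ht.1.le, ht.2⟩)).1⟩⟩
    have hm : StrictMonoOn z (Ico 0 δ) := by
      refine strictMonoOn_of_deriv_pos (convex_Ico 0 δ)
        (fun s hs => (hb (hmem s hs)).1.2.continuousAt.continuousWithinAt) fun s hs => ?_
      have hs' := hmem s (interior_subset hs)
      rw [(hb hs').1.2.deriv]
      exact (hb hs').2
    rw [← hz0]
    exact hm ⟨le_rfl, hδ⟩ ⟨ht.1.le, ht.2⟩ ht.1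
  by_contra hneg
  have hYt : Y t = 0 := le_antisymm (not_lt.1 hneg) (hY0 t)
  have hδt : δ ≤ t := by
    by_contra hlt
    have := hball t ⟨ht.1, not_le.1 hlt⟩
    rw [this.2.1] at hYt
    exact absurd hYt (pow_pos this.1 2).ne'
  -- `t₁` is the first positive zero of Y; before it, the root y = √Y coincides locally with z or -z
  -- and satisfies y'' = -κ y.
  obtain ⟨t₁, ⟨⟨ht₁δ, ht₁t⟩, hYt₁⟩, hmin⟩ : ∃ t₁ ∈ Icc δ t ∩ Y ⁻¹' {0}, ∀ s ∈ Icc δ t ∩ Y ⁻¹' {0}, t₁ ≤ s :=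
    (isCompact_Icc.inter_right (isClosed_singleton.preimage hYc)).exists_isLeast
      ⟨t, ⟨hδt, le_rfl⟩, hYt⟩
  have ht₁0 : 0 < t₁ := hδ.trans_le ht₁δ
  have hpos : ∀ s ∈ Ioo 0 t₁, 0 < Y s := fun s hs => by
    rcases lt_or_ge s δ with hlt | hge
    · have := hball s ⟨hs.1, hlt⟩
      rw [this.2.1]; exact pow_pos this.1 2
    · refine (hY0 s).lt_of_ne' fun h => ?_
      exact absurd (hmin s ⟨⟨hge, hs.2.le.trans ht₁t⟩, h⟩) (not_le.2 hs.2)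
  set y : ℝ → ℝ := fun s => √(Y s) with hy
  have hypos : ∀ s ∈ Ioo 0 t₁, 0 < y s := fun s hs => Real.sqrt_pos.2 (hpos s hs)
  have hyd : ∀ s ∈ Ioo 0 t₁, HasDerivAt y (deriv y s) s ∧
      ∃ κ ≤ k, HasDerivAt (deriv y) (-(κ * y s)) s := by
    intro s hs
    obtain ⟨w, w', hw, κ, hκ, hw'⟩ := h s
    have hws : w s ≠ 0 := fun h0 => by
      have := hw.self_of_nhds.1
      rw [h0] at this
      exact absurd (hpos s hs) (by rw [this]; simp)
    have hwc := hw.self_of_nhds.2.continuousAt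
    rcases hws.lt_or_gt with hlt | hgt
    · have hev : ∀ᶠ r in 𝓝 s, y r = -w r ∧ HasDerivAt w (w' r) r := by
        filter_upwards [hw, hwc.eventually_lt_const hlt] with r hr hr'
        exact ⟨by rw [hy]; simp only [hr.1, Real.sqrt_sq_eq_abs, abs_of_neg hr'], hr.2⟩
      have hev2 : ∀ᶠ r in 𝓝 s, HasDerivAt y (-w' r) r := by
        filter_upwards [hev.eventually_nhds] with r hr
        exact hr.self_of_nhds.2.neg.congr_of_eventuallyEq (hr.mono fun q hq => hq.1)
      refine ⟨hev2.self_of_nhds.differentiableAt.hasDerivAt, κ, hκ, ?_⟩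
      refine (hw'.neg.congr_of_eventuallyEq (hev2.mono fun r hr => hr.deriv)).congr_deriv ?_
      rw [hev.self_of_nhds.1]; ring
    · have hev : ∀ᶠ r in 𝓝 s, y r = w r ∧ HasDerivAt w (w' r) r := by
        filter_upwards [hw, hwc.eventually_const_lt hgt] with r hr hr'
        exact ⟨by rw [hy]; simp only [hr.1, Real.sqrt_sq_eq_abs, abs_of_pos hr'], hr.2⟩
      have hev2 : ∀ᶠ r in 𝓝 s, HasDerivAt y (w' r) r := by
        filter_upwards [hev.eventually_nhds] with r hr
        exact hr.self_of_nhds.2.congr_of_eventuallyEq (hr.mono fun q hq => hq.1)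
      refine ⟨hev2.self_of_nhds.differentiableAt.hasDerivAt, κ, hκ, ?_⟩
      refine (hw'.congr_of_eventuallyEq (hev2.mono fun r hr => hr.deriv)).congr_deriv ?_
      rw [hev.self_of_nhds.1]
  set m := √k with hmdef
  have hm0 : 0 < m := Real.sqrt_pos.2 hk
  have hmm : m * m = k := Real.mul_self_sqrt hk.le
  have hS : ∀ s, HasDerivAt (fun s => Real.sin (m * s)) (m * Real.cos (m * s)) s := fun s => by
    have := ((hasDerivAt_id s).const_mul m).sin
    refine this.congr_deriv ?_
    simp [mul_comm]
  have hS' : ∀ s, HasDerivAt (fun s => m * Real.cos (m * s)) (-(k * Real.sin (m * s))) s :=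
    fun s => by
      have := ((hasDerivAt_id s).const_mul m).cos.const_mul m
      refine this.congr_deriv ?_
      rw [← hmm]; simp; ring
  have hSpos : ∀ s, 0 < s → s ≤ t₁ → 0 < Real.sin (m * s) := fun s hs hst => by
    refine Real.sin_pos_of_pos_of_lt_pi (mul_pos hm0 hs) ?_
    have : s < Real.pi / m := (hst.trans ht₁t).trans_lt ht.2
    rw [lt_div_iff₀ hm0] at this
    linarith
  -- The Wronskian of y and the comparison solution sin(m s). Its derivative is (k - κ) y sin(m s) ≥
  -- 0, and it tends to 0 at 0, so it is nonnegative.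
  set W : ℝ → ℝ := fun s => deriv y s * Real.sin (m * s) - y s * (m * Real.cos (m * s)) with hW
  have hWd : ∀ s ∈ Ioo 0 t₁, ∃ d, 0 ≤ d ∧ HasDerivAt W d s := fun s hs => by
    obtain ⟨hd1, κ, hκ, hd2⟩ := hyd s hs
    refine ⟨_, ?_, (hd2.mul (hS s)).sub (hd1.mul (hS' s))⟩
    have := mul_nonneg (mul_nonneg (sub_nonneg.2 hκ) (hypos s hs).le) (hSpos s hs.1 hs.2.le).le
    nlinarith [this]
  have hWmono : MonotoneOn W (Ioo 0 t₁) := by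
    refine monotoneOn_of_deriv_nonneg (convex_Ioo _ _) (fun s hs => ?_) (fun s hs => ?_)
      fun s hs => ?_
    · obtain ⟨d, -, hd⟩ := hWd s hs
      exact hd.continuousAt.continuousWithinAt
    · obtain ⟨d, -, hd⟩ := hWd s (interior_subset hs)
      exact hd.differentiableAt.differentiableWithinAt
    · obtain ⟨d, hd0, hd⟩ := hWd s (interior_subset hs)
      rw [hd.deriv]; exact hd0
  have hWlim : Filter.Tendsto W (𝓝[>] 0) (𝓝 0) := by
    have hev : ∀ᶠ s in 𝓝[>] (0 : ℝ), W s = z' s * Real.sin (m * s) - z s * (m * Real.cos (m * s)) := by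
      filter_upwards [Ioo_mem_nhdsGT hδ] with s hs
      have hyz : ∀ r ∈ Ioo 0 δ, y r = z r := fun r hr => by
        rw [hy]; simp only [(hball r hr).2.1, Real.sqrt_sq (hball r hr).1.le]
      have : deriv y s = z' s := by
        refine ((hball s hs).2.2.congr_of_eventuallyEq ?_).deriv
        filter_upwards [isOpen_Ioo.mem_nhds hs] with r hr using hyz r hr
      rw [hW]; simp only [this, hyz s hs]
    have hlim : ContinuousAt (fun s => z' s * Real.sin (m * s) - z s * (m * Real.cos (m * s))) 0 :=
      (hzc.mul (hS 0).continuousAt).sub (hz.self_of_nhds.2.continuousAt.mul (hS' 0).continuousAt)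
    have h2 := hlim.tendsto
    simp only [hz0, mul_zero, Real.sin_zero, zero_mul, sub_zero] at h2
    exact (h2.mono_left nhdsWithin_le_nhds).congr' (hev.mono fun s hs => hs.symm)
  have hWnn : ∀ s ∈ Ioo 0 t₁, 0 ≤ W s := fun s hs => by
    refine le_of_tendsto hWlim ?_
    filter_upwards [Ioo_mem_nhdsGT hs.1] with r hr
    exact hWmono ⟨hr.1, hr.2.trans hs.2⟩ hs hr.2.le
  -- The derivative of the quotient is W / sin². A positive nondecreasing quotient cannot tend to 0
  -- at `t₁`, where y vanishes and the sine is still positive.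
  have hmono : MonotoneOn (fun s => y s / Real.sin (m * s)) (Ioo 0 t₁) := by
    have hd : ∀ s ∈ Ioo 0 t₁, HasDerivAt (fun s => y s / Real.sin (m * s))
        (W s / Real.sin (m * s) ^ 2) s := fun s hs =>
      (hyd s hs).1.div (hS s) (hSpos s hs.1 hs.2.le).ne'
    refine monotoneOn_of_deriv_nonneg (convex_Ioo _ _)
      (fun s hs => (hd s hs).continuousAt.continuousWithinAt)
      (fun s hs => (hd s (interior_subset hs)).differentiableAt.differentiableWithinAt)
      fun s hs => ?_
    rw [(hd s (interior_subset hs)).deriv]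
    exact div_nonneg (hWnn s (interior_subset hs)) (sq_nonneg _)
  have hm : t₁ / 2 ∈ Ioo 0 t₁ := ⟨by linarith, by linarith⟩
  set c := y (t₁ / 2) / Real.sin (m * (t₁ / 2)) with hc
  have hcpos : 0 < c := div_pos (hypos _ hm) (hSpos _ hm.1 hm.2.le)
  have hle : c ≤ y t₁ / Real.sin (m * t₁) := by
    have hcont : ContinuousAt (fun s => y s / Real.sin (m * s)) t₁ :=
      ((Real.continuous_sqrt.comp hYc).continuousAt).div (hS t₁).continuousAt
        (hSpos t₁ ht₁0 le_rfl).ne'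
    refine ge_of_tendsto (hcont.tendsto.mono_left (nhdsWithin_le_nhds (s := Iio t₁))) ?_
    filter_upwards [Ioo_mem_nhdsLT (by linarith : t₁ / 2 < t₁)] with r hr
    exact hmono hm ⟨hm.1.trans hr.1, hr.2⟩ hr.1.le
  have : y t₁ = 0 := by rw [hy]; simp only [show Y t₁ = 0 from hYt₁, Real.sqrt_zero]
  rw [this, zero_div] at hle
  exact absurd hcpos (not_lt.2 hle)

/-- Lagrange's identity. Unlike the area form, whose sign depends on the chart, its square is
intrinsic, so no orientation of the surface is needed. -/
lemma IsSmoothMetricOn.areaForm_sq {G : Plane → Matrix (Fin 2) (Fin 2) ℝ} {Ω : Set Plane}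
    (hG : IsSmoothMetricOn G Ω) {u : Plane} (hu : u ∈ Ω) (a b : Plane) :
    areaForm G u a b ^ 2 =
      metricForm G u a a * metricForm G u b b - metricForm G u a b ^ 2 := by
  unfold areaForm metricForm
  rw [mul_pow, Real.sq_sqrt (hG.det_pos hu).le, hG.det_eq hu]
  simp only [Fin.sum_univ_two, hG.symm u hu 1 0]
  ring

end Comparison

/-! ### Chain rule in the model plane -/

section ChainRule

variable {F : Type*} [TopologicalSpace F] [ChartedSpace Plane F]
variable {E : Type*} [NormedAddCommGroup E] [NormedSpace ℝ E]

/-- Chain rule for `flatDeriv`. -/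
lemma flatDeriv_comp {E' : Type*} [NormedAddCommGroup E'] [NormedSpace ℝ E'] {f : E → F}
    {g : E' → E} {p : E'} {g' : E' →L[ℝ] E} (hf : MDifferentiableAt 𝓘(ℝ, E) 𝓘(ℝ, Plane) f (g p))
    (hg : HasFDerivAt g g' p) : flatDeriv (fun q => f (g q)) p = (flatDeriv f (g p)).comp g' := by
  have h2 := mfderiv_comp (I := 𝓘(ℝ, E')) (I' := 𝓘(ℝ, E)) (I'' := 𝓘(ℝ, Plane)) p hf
    hg.differentiableAt.mdifferentiableAt
  rw [mfderiv_eq_fderiv, hg.fderiv] at h2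
  exact h2

lemma velocity_comp {f : E → F} {g : ℝ → E} {t : ℝ} {g' : E}
    (hf : MDifferentiableAt 𝓘(ℝ, E) 𝓘(ℝ, Plane) f (g t)) (hg : HasDerivAt g g' t) :
    velocity (fun q => f (g q)) t = flatDeriv f (g t) g' := by
  unfold velocity
  rw [flatDeriv_comp hf hg.hasFDerivAt]
  simp

end ChainRule

/-! ### Gram determinants -/

section Gram

variable {F : Type*} [TopologicalSpace F] [ChartedSpace Plane F]
  [RiemannianBundle (fun x : F => TangentSpace 𝓘(ℝ, Plane) x)]

/-- The Gram determinant of two tangent vectors. -/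
def riemGram (q : F) (a b : Plane) : ℝ :=
  riemForm q a a * riemForm q b b - riemForm q a b ^ 2

/-- The equality case of Cauchy–Schwarz: the component of b orthogonal to a has squared length Gram
/ |a|². -/
lemma eq_smul_of_riemGram_eq_zero {q : F} {a b : Plane} (ha : a ≠ 0) (h : riemGram q a b = 0) :
    ∃ c : ℝ, b = c • a := by
  have hpos := riemForm_pos q ha
  refine ⟨riemForm q a b / riemForm q a a, ?_⟩
  by_contra hne
  have h1 := riemForm_pos q (sub_ne_zero.2 hne)
  have h2 : ∀ c : ℝ, riemForm q (b - c • a) (b - c • a) =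
      riemForm q b b - 2 * c * riemForm q a b + c ^ 2 * riemForm q a a := fun c => by
    rw [sub_eq_add_neg, ← neg_smul, riemForm_add_left, riemForm_add_right, riemForm_add_right,
      riemForm_smul_left, riemForm_smul_left, riemForm_smul_right, riemForm_smul_right,
      riemForm_comm q b a]
    ring
  rw [h2] at h1
  have h3 : riemForm q b b - 2 * (riemForm q a b / riemForm q a a) * riemForm q a b
      + (riemForm q a b / riemForm q a a) ^ 2 * riemForm q a a = riemGram q a b / riemForm q a a := by
    unfold riemGram; field_simp; ring
  rw [h3, h, zero_div] at h1
  exact lt_irrefl _ h1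

end Gram

/-! ### The Gauss lemma and the absence of conjugate points -/

section Gauss
open Topology

variable {F : Type*} [EMetricSpace F] [ChartedSpace Plane F]
  [IsManifold 𝓘(ℝ, Plane) ∞ F]
  [RiemannianBundle (fun x : F => TangentSpace 𝓘(ℝ, Plane) x)]
  [IsContMDiffRiemannianBundle 𝓘(ℝ, Plane) ∞ Plane (fun x : F => TangentSpace 𝓘(ℝ, Plane) x)]
variable [IsRiemannianManifold 𝓘(ℝ, Plane) F] [CompleteSpace F]

/-- The exponential map at `x`, on the model plane. -/
def rawExp (x : F) (v : Plane) : F := geodesicFrom x v 1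

lemma contMDiff_rawExp (x : F) : ContMDiff 𝓘(ℝ, Plane) 𝓘(ℝ, Plane) ∞ (rawExp x) :=
  (contMDiff_geodesicFrom x).comp (contDiff_const.prodMk contDiff_id).contMDiff

lemma mdifferentiable_rawExp (x : F) : MDifferentiable 𝓘(ℝ, Plane) 𝓘(ℝ, Plane) (rawExp x) :=
  (contMDiff_rawExp x).mdifferentiable (by simp)

lemma rawExp_zero (x : F) : rawExp x 0 = x := by
  have := geodesicFrom_smul x 0 0 1
  simpa [rawExp] using this

lemma flatDeriv_rawExp_zero (x : F) (w : Plane) : flatDeriv (rawExp x) 0 w = w := by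
  have h1 : (fun r : ℝ => rawExp x (r • w)) = geodesicFrom x w := by
    funext r; unfold rawExp; rw [geodesicFrom_smul, mul_one]
  have h2 : HasDerivAt (fun r : ℝ => r • w) w 0 := by
    simpa using (hasDerivAt_id (0 : ℝ)).smul_const w
  have h3 := velocity_comp (f := rawExp x) (mdifferentiable_rawExp x _) h2
  rw [h1, velocity_geodesicFrom, zero_smul] at h3
  exact h3.symm

/-- The variation `(s, t) ↦ γ_{v + s w}(t)` through geodesics. -/
def geodesicVariation (x : F) (v w : Plane) (q : ℝ × ℝ) : F := geodesicFrom x (v + q.1 • w) q.2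

lemma contMDiff_geodesicVariation (x : F) (v w : Plane) :
    ContMDiff 𝓘(ℝ, ℝ × ℝ) 𝓘(ℝ, Plane) ∞ (geodesicVariation x v w) := by
  have h : ContDiff ℝ ∞ (fun q : ℝ × ℝ => ((q.2, v + q.1 • w) : ℝ × Plane)) := by fun_prop
  exact (contMDiff_geodesicFrom x).comp h.contMDiff

lemma mdifferentiable_geodesicVariation (x : F) (v w : Plane) :
    MDifferentiable 𝓘(ℝ, ℝ × ℝ) 𝓘(ℝ, Plane) (geodesicVariation x v w) :=
  (contMDiff_geodesicVariation x v w).mdifferentiable (by simp)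

lemma geodesicVariation_time (x : F) (v w : Plane) (s t : ℝ) :
    flatDeriv (geodesicVariation x v w) (s, t) (0, 1) = velocity (geodesicFrom x (v + s • w)) t :=
  (velocity_comp (f := geodesicVariation x v w) (g := fun τ : ℝ => (s, τ))
    (mdifferentiable_geodesicVariation x v w _)
    ((hasDerivAt_const t s).prodMk (hasDerivAt_id t))).symm

lemma geodesicVariation_space (x : F) (v w : Plane) (s t : ℝ) :
    flatDeriv (geodesicVariation x v w) (s, t) (1, 0) =
      velocity (fun σ => geodesicFrom x (v + σ • w) t) s :=
  (velocity_comp (f := geodesicVariation x v w) (g := fun σ : ℝ => (σ, t))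
    (mdifferentiable_geodesicVariation x v w _)
    ((hasDerivAt_id s).prodMk (hasDerivAt_const s t))).symm

lemma geodesicVariation_space_zero (x : F) (v w : Plane) (s : ℝ) :
    flatDeriv (geodesicVariation x v w) (s, 0) (1, 0) = 0 := by
  rw [geodesicVariation_space]
  simp only [geodesicFrom_zero]
  unfold velocity flatDeriv
  rw [mfderiv_const]
  rfl

lemma geodesicVariation_space_one (x : F) (v w : Plane) :
    flatDeriv (geodesicVariation x v w) (0, 1) (1, 0) = flatDeriv (rawExp x) v w := by
  rw [geodesicVariation_space]
  have h2 : HasDerivAt (fun r : ℝ => v + r • w) w 0 := by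
    simpa using ((hasDerivAt_id (0 : ℝ)).smul_const w).const_add v
  have h3 := velocity_comp (f := rawExp x) (mdifferentiable_rawExp x _) h2
  simp only [zero_smul, add_zero] at h3
  exact h3

lemma riemForm_velocity_geodesicFrom (x : F) (v : Plane) (t : ℝ) :
    riemForm (geodesicFrom x v t) (velocity (geodesicFrom x v) t) (velocity (geodesicFrom x v) t) =
      riemForm x v v := by
  rw [(isGeodesicOn_geodesicFrom x v).speed_const isOpen_univ isPreconnected_univ (mem_univ t)
    (mem_univ (0 : ℝ)), velocity_geodesicFrom, geodesicFrom_zero]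

/-- The Gauss lemma along a geodesic variation. -/
lemma gauss_variation (x : F) (v w : Plane) (t : ℝ) :
    riemForm (geodesicFrom x v t) (flatDeriv (geodesicVariation x v w) (0, t) (0, 1))
      (flatDeriv (geodesicVariation x v w) (0, t) (1, 0)) = t * riemForm x v w := by
  set U := geodesicVariation x v w with hU
  set f : ℝ → ℝ := fun τ => riemForm (U (0, τ)) (flatDeriv U (0, τ) (0, 1))
    (flatDeriv U (0, τ) (1, 0)) with hf
  have hd : ∀ τ, HasDerivAt f (riemForm x v w) τ := by
    intro τ
    have he : chartAt Plane (U (0, τ)) ∈ atlas Plane F := chart_mem_atlas _ _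
    obtain ⟨A, B, hA, hB, hAB⟩ := first_variation_surface he isOpen_univ
      (contMDiff_geodesicVariation x v w).contMDiffOn (mem_univ (0, τ)) (mem_chart_source _ _)
    have h1 : geodesicDefect (chartAt Plane (U (0, τ))) (fun r => U (0, r)) τ = 0 :=
      (isGeodesicOn_geodesicFrom x _).defect _ he τ (mem_univ _) (mem_chart_source _ _)
    -- Each geodesic of the family has constant squared speed |v + s w|², whose s-derivative at 0 is
    -- 2⟨v, w⟩.
    have h2 : B = 2 * riemForm x v w := by
      refine hB.unique ?_
      have h3 : ∀ σ : ℝ, riemForm (U (σ, τ)) (flatDeriv U (σ, τ) (0, 1))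
          (flatDeriv U (σ, τ) (0, 1)) =
          riemForm x v v + σ * (2 * riemForm x v w) + σ * σ * riemForm x w w := fun σ => by
        rw [hU, geodesicVariation_time]
        refine (riemForm_velocity_geodesicFrom x (v + σ • w) τ).trans ?_
        rw [riemForm_add_left, riemForm_add_right, riemForm_add_right, riemForm_smul_left,
          riemForm_smul_left, riemForm_smul_right, riemForm_smul_right, riemForm_comm x w v]
        ring
      simp only [← hU, h3]
      have h4 := (((hasDerivAt_id (0 : ℝ)).mul_const (2 * riemForm x v w)).const_add
        (riemForm x v v)).fun_add (((hasDerivAt_id (0 : ℝ)).mul (hasDerivAt_id (0 : ℝ))).mul_const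
        (riemForm x w w))
      simpa using h4
    rw [← hU, h1] at hAB
    -- The geodesic equation kills the right side of the first variation identity, so A = B / 2.
    have h5 : A = riemForm x v w := by
      have h6 : metricForm (chartMetric (chartAt Plane (U (0, τ)))) (chartAt Plane (U (0, τ)) (U (0, τ)))
        0 (partialS (fun q => chartAt Plane (U (0, τ)) (U q)) (0, τ)) = 0 := by simp [metricForm]
      rw [h6, h2] at hAB
      linarith
    exact h5 ▸ hA
  have h0 : f 0 = 0 := by
    rw [hf]
    simp only [hU, geodesicVariation_space_zero]
    have := riemForm_smul_right (geodesicVariation x v w (0, 0)) 0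
      (flatDeriv (geodesicVariation x v w) (0, 0) (0, 1)) 0
    simpa using this
  have h1 : ∀ τ, HasDerivAt (fun τ => f τ - τ * riemForm x v w) 0 τ := fun τ => by
    simpa using (hd τ).fun_sub ((hasDerivAt_id τ).mul_const (riemForm x v w))
  have h2 := is_const_of_deriv_eq_zero (fun τ => (h1 τ).differentiableAt) (fun τ => (h1 τ).deriv) t 0
  simp only [h0, zero_mul, sub_zero] at h2
  have h3 : f t = t * riemForm x v w := by linarith
  rw [hf] at h3
  simp only [hU] at h3
  have h4 : geodesicVariation x v w (0, t) = geodesicFrom x v t := by simp [geodesicVariation]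
  rw [h4] at h3
  exact h3

/-- Consequence of the Gauss lemma: the exponential map does not decrease radial components. -/
lemma riemForm_sq_le_rawExp (x : F) (v w : Plane) :
    riemForm x v w ^ 2 ≤ riemForm x v v *
      riemForm (rawExp x v) (flatDeriv (rawExp x) v w) (flatDeriv (rawExp x) v w) := by
  have h := gauss_variation x v w 1
  -- At time 1 the variation field is the derivative of exp at v applied to w. Cauchy–Schwarz
  -- against the velocity, of length |v|, gives the bound.
  rw [geodesicVariation_time, geodesicVariation_space_one, one_mul, zero_smul, add_zero] at h
  have h1 := riemForm_sq_le (geodesicFrom x v 1) (velocity (geodesicFrom x v) 1)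
    (flatDeriv (rawExp x) v w)
  rw [h, riemForm_velocity_geodesicFrom] at h1
  rw [sq]
  exact h1

/-- The Gram determinant of the variation fields is a square whose root satisfies the Jacobi
equation. -/
lemma jacobi_local (x : F) (v w : Plane) (t₀ : ℝ) :
    ∃ z z' : ℝ → ℝ, (∀ᶠ t in 𝓝 t₀,
      riemGram (geodesicFrom x v t) (flatDeriv (geodesicVariation x v w) (0, t) (0, 1))
        (flatDeriv (geodesicVariation x v w) (0, t) (1, 0)) = z t ^ 2 ∧ HasDerivAt z (z' t) t) ∧
      HasDerivAt z' (-(surfaceCurvature (geodesicFrom x v t₀) * riemForm x v v * z t₀)) t₀ ∧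
      (t₀ = 0 → z 0 = 0 ∧ z' 0 ^ 2 = riemGram x v w) := by
  set U := geodesicVariation x v w with hU
  have hU0 : ∀ t, U (0, t) = geodesicFrom x v t := fun t => by simp [hU, geodesicVariation]
  -- The preferred chart at the point of time `t₀` is the one in which `surfaceCurvature` is
  -- computed there. For this reason z is local and the second derivative is asserted only at `t₀`;
  -- invariance of the curvature under change of chart is not needed.
  set e := chartAt Plane (geodesicFrom x v t₀) with he'
  have he : e ∈ atlas Plane F := chart_mem_atlas _ _
  have hte : geodesicFrom x v t₀ ∈ e.source := mem_chart_source _ _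
  have hG := isSmoothMetricOn_chartMetric he
  set W : Set (ℝ × ℝ) := U ⁻¹' e.source with hWdef
  have hUs : ContMDiff 𝓘(ℝ, ℝ × ℝ) 𝓘(ℝ, Plane) ∞ U := contMDiff_geodesicVariation x v w
  have hUd := mdifferentiable_geodesicVariation x v w
  have hW : IsOpen W := e.open_source.preimage hUs.continuous
  set u : ℝ × ℝ → Plane := fun q => e (U q) with hu
  have hus : ContDiffOn ℝ ∞ u W := contDiffOn_chart_comp he hUs.contMDiffOn fun q hq => hq
  have huΩ : MapsTo u W e.target := fun q hq => e.map_source hq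
  have hgeo : ∀ p ∈ W, partialT (partialT u) p =
      -christoffelForm (chartMetric e) (u p) (partialT u p) (partialT u p) := by
    rintro ⟨s, t⟩ hp
    rw [partialT_eq_deriv hW hus hp, partialT_partialT_eq_deriv hW hus hp]
    exact eq_neg_of_add_eq_zero_left
      ((isGeodesicOn_geodesicFrom x (v + s • w)).defect e he t (mem_univ _) hp)
  have hsq : ∀ t, (0, t) ∈ W → riemGram (geodesicFrom x v t) (flatDeriv U (0, t) (0, 1))
      (flatDeriv U (0, t) (1, 0)) =
      areaForm (chartMetric e) (u (0, t)) (partialT u (0, t)) (partialS u (0, t)) ^ 2 := by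
    intro t ht
    rw [hG.areaForm_sq (huΩ ht), riemGram, ← hU0, riemForm_flatDeriv he (hUd _) ht,
      riemForm_flatDeriv he (hUd _) ht, riemForm_flatDeriv he (hUd _) ht]
    rfl
  have hmem : ((0 : ℝ), t₀) ∈ W := by rw [hWdef, mem_preimage, hU0]; exact hte
  have hev : ∀ᶠ t in 𝓝 t₀, ((0 : ℝ), t) ∈ W :=
    (by fun_prop : Continuous fun r : ℝ => ((0 : ℝ), r)).continuousAt.eventually_mem
      (hW.mem_nhds hmem)
  refine ⟨_, _, hev.mono fun t ht => ⟨hsq t ht,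
    (hG.hasDerivAt_areaForm_variation e.open_target hW hus huΩ hgeo ht).1⟩,
    (hG.hasDerivAt_areaForm_variation e.open_target hW hus huΩ hgeo hmem).2.congr_deriv ?_, ?_⟩
  · have h1 : metricForm (chartMetric e) (u (0, t₀)) (partialT u (0, t₀)) (partialT u (0, t₀)) =
        riemForm x v v := by
      have h2 := riemForm_flatDeriv he (hUd (0, t₀)) hmem (0, 1) (0, 1)
      refine h2.symm.trans ?_
      rw [geodesicVariation_time, ← hU, hU0, zero_smul, add_zero, riemForm_velocity_geodesicFrom]
    have h3 : planeCurvature (chartMetric e) (u (0, t₀)) =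
        surfaceCurvature (geodesicFrom x v t₀) := by
      rw [hu]; simp only [hU0]; rfl
    rw [h1, h3]
  · rintro rfl
    have hx : x ∈ e.source := by simpa using hte
    have hS0 : partialS u (0, 0) = 0 := by
      have h1 := fderiv_chart_comp he (hUd (0, 0)) hmem
      have h2 : partialS u (0, 0) =
          chartDeriv e (U (0, 0)) (flatDeriv U (0, 0) (1, 0)) :=
        congrArg (fun L : ℝ × ℝ →L[ℝ] Plane => L (1, 0)) h1
      rw [h2, hU, geodesicVariation_space_zero, map_zero]
    have hW0 : ∀ s, (s, (0 : ℝ)) ∈ W := fun s => by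
      rw [hWdef, mem_preimage, hU]; simpa [geodesicVariation] using hx
    have hT : ∀ s, partialT u (s, 0) = chartDeriv e x (v + s • w) := fun s => by
      have h1 := fderiv_chart_comp he (hUd (s, 0)) (hW0 s)
      have h2 : partialT u (s, 0) = chartDeriv e (U (s, 0)) (flatDeriv U (s, 0) (0, 1)) :=
        congrArg (fun L : ℝ × ℝ →L[ℝ] Plane => L (0, 1)) h1
      rw [h2, geodesicVariation_time, velocity_geodesicFrom]
      simp [hU, geodesicVariation]
    have hTS : partialT (partialS u) (0, 0) = chartDeriv e x w := by
      rw [← partialS_partialT_comm hW hus hmem]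
      have h1 := hasDerivAt_partialS ((hus.partialT hW).differentiableAt_of_isOpen hW hmem)
      simp only [hT] at h1
      have h2 : HasDerivAt (fun r : ℝ => v + r • w) w 0 := by
        simpa using ((hasDerivAt_id (0 : ℝ)).smul_const w).const_add v
      exact h1.unique ((chartDeriv e x).hasFDerivAt.comp_hasDerivAt 0 h2)
    have hu0 : u (0, 0) = e x := by simp [hu, hU, geodesicVariation]
    have hchart : ∀ a b : Plane, metricForm (chartMetric e) (e x) (chartDeriv e x a)
        (chartDeriv e x b) = riemForm x a b := by
      intro a b
      have hE0 : rawExp x 0 = x := rawExp_zero x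
      have h1 := riemForm_flatDeriv he (mdifferentiable_rawExp x 0) (by rw [hE0]; exact hx) a b
      have h2 := fderiv_chart_comp he (mdifferentiable_rawExp x 0) (by rw [hE0]; exact hx)
      rw [h2] at h1
      simp only [ContinuousLinearMap.comp_apply, flatDeriv_rawExp_zero, hE0] at h1
      exact h1.symm
    refine ⟨by simp [hS0, areaForm], ?_⟩
    rw [hG.areaForm_sq (huΩ hmem), hS0, hTS, hT, hu0]
    have hz : christoffelForm (chartMetric e) (e x) (chartDeriv e x (v + (0 : ℝ) • w)) 0 = 0 := by
      ext k; simp [christoffelForm_apply]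
    rw [hz, add_zero, zero_smul, add_zero, hchart, hchart, hchart]
    rfl

/-- The exponential map is an immersion on the ball of radius `π / √K₀`. -/
theorem injective_flatDeriv_rawExp {K₀ : ℝ} (hK₀ : 0 < K₀)
    (hcurv : ∀ p : F, surfaceCurvature p ≤ K₀) (x : F) {v : Plane}
    (hv : √(riemForm x v v) < Real.pi / √K₀) : Function.Injective (flatDeriv (rawExp x) v) := by
  refine (injective_iff_map_eq_zero _).2 fun w hw => ?_
  rcases eq_or_ne v 0 with rfl | hv0
  · rwa [flatDeriv_rawExp_zero] at hw
  have hvpos := riemForm_pos x hv0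
  have hzero : ∀ q : F, ∀ a : Plane, riemForm q a 0 = 0 := fun q a => by
    simpa using riemForm_smul_right q 0 a 0
  -- Were v and w independent, the Gram determinant of velocity and Jacobi field would satisfy the
  -- comparison hypothesis with k = K₀ |v|² and be positive at time 1 < π / √k; but w is in the
  -- kernel at time 1.
  have hgram : riemGram x v w = 0 := by
    by_contra hne
    have hk : 0 < K₀ * riemForm x v v := mul_pos hK₀ hvpos
    have h1 : (1 : ℝ) ∈ Ioo 0 (Real.pi / √(K₀ * riemForm x v v)) := by
      refine ⟨one_pos, ?_⟩
      rw [lt_div_iff₀ (Real.sqrt_pos.2 hk), one_mul, Real.sqrt_mul hK₀.le]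
      rw [lt_div_iff₀ (Real.sqrt_pos.2 hK₀)] at hv
      linarith
    have h2 := sturm_comparison_pos hk (Y := fun t => riemGram (geodesicFrom x v t)
      (flatDeriv (geodesicVariation x v w) (0, t) (0, 1))
      (flatDeriv (geodesicVariation x v w) (0, t) (1, 0))) (fun t₀ => ?_) ?_ h1
    · simp only [geodesicVariation_space_one, hw, riemGram, hzero] at h2
      simp at h2
    · obtain ⟨z, z', hz, hz', -⟩ := jacobi_local x v w t₀
      exact ⟨z, z', hz, _, mul_le_mul_of_nonneg_right (hcurv _) hvpos.le, hz'⟩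
    · obtain ⟨z, z', hz, hz', h0⟩ := jacobi_local x v w 0
      obtain ⟨h3, h4⟩ := h0 rfl
      refine ⟨z, z', hz, hz'.continuousAt, h3, fun h5 => hne ?_⟩
      rw [← h4, h5]; simp
  -- It remains to exclude radial w, on which the Gauss lemma gives 0 = c |v|².
  obtain ⟨c, rfl⟩ := eq_smul_of_riemGram_eq_zero hv0 hgram
  have h := gauss_variation x v (c • v) 1
  rw [geodesicVariation_space_one, hw, hzero, one_mul, riemForm_smul_right] at h
  rcases mul_eq_zero.1 h.symm with h | h
  · rw [h, zero_smul]
  · exact absurd h hvpos.ne'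

end Gauss
end

noncomputable section
-- The exponential map in isometric coordinates
section ExpPlane
open Topology

variable {F : Type*} [EMetricSpace F] [ChartedSpace Plane F]
  [IsManifold 𝓘(ℝ, Plane) ∞ F]
  [RiemannianBundle (fun x : F => TangentSpace 𝓘(ℝ, Plane) x)]
  [IsContMDiffRiemannianBundle 𝓘(ℝ, Plane) ∞ Plane (fun x : F => TangentSpace 𝓘(ℝ, Plane) x)]
  [IsRiemannianManifold 𝓘(ℝ, Plane) F] [CompleteSpace F]

/-- The exponential map in isometric linear coordinates on the tangent plane: it is smooth, does not
decrease radial components, and is an immersion on the disc of radius `π / √K₀`. -/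
theorem exists_exp_coordinates {K₀ : ℝ} (hK₀ : 0 < K₀)
    (hcurv : ∀ p : F, surfaceCurvature p ≤ K₀) (x : F) :
    ∃ A : Plane ≃ₗᵢ[ℝ] TangentSpace 𝓘(ℝ, Plane) x,
      ContMDiff 𝓘(ℝ, Plane) 𝓘(ℝ, Plane) ∞ (fun a => surfaceExp x (A a)) ∧
      surfaceExp x (A 0) = x ∧
      (∀ a b : Plane, (inner ℝ a b : ℝ) ^ 2 ≤ ‖a‖ ^ 2 *
        riemForm (surfaceExp x (A a)) (flatDeriv (fun a => surfaceExp x (A a)) a b)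
          (flatDeriv (fun a => surfaceExp x (A a)) a b)) ∧
      ∀ a : Plane, ‖a‖ < Real.pi / √K₀ →
        Function.Injective (flatDeriv (fun a => surfaceExp x (A a)) a) := by
  have hfr : Module.finrank ℝ (TangentSpace 𝓘(ℝ, Plane) x) = 2 :=
    (finrank_euclideanSpace (𝕜 := ℝ) (ι := Fin 2)).trans (by simp)
  have : FiniteDimensional ℝ (TangentSpace 𝓘(ℝ, Plane) x) :=
    inferInstanceAs (FiniteDimensional ℝ Plane)
  let A : Plane ≃ₗᵢ[ℝ] TangentSpace 𝓘(ℝ, Plane) x :=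
    ((stdOrthonormalBasis ℝ (TangentSpace 𝓘(ℝ, Plane) x)).reindex (finCongr hfr)).repr.symm
  let L : Plane →L[ℝ] Plane := A.toContinuousLinearEquiv.toContinuousLinearMap
  have hLA : ∀ a, (A a : Plane) = L a := fun a => rfl
  have hexp : (fun a => surfaceExp x (A a)) = fun a => rawExp x (L a) :=
    funext fun a => surfaceExp_eq x (A a)
  have hin : ∀ a b : Plane, riemForm x (L a) (L b) = inner ℝ a b := fun a b =>
    A.inner_map_map a b
  have hd : ∀ a b, flatDeriv (fun a => rawExp x (L a)) a b = flatDeriv (rawExp x) (L a) (L b) :=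
    fun a b => by
      rw [flatDeriv_comp (mdifferentiable_rawExp x _) L.hasFDerivAt]; rfl
  refine ⟨A, ?_, ?_, fun a b => ?_, fun a ha => ?_⟩
  · rw [hexp]
    exact (contMDiff_rawExp x).comp L.contDiff.contMDiff
  · rw [congrFun hexp 0, map_zero, rawExp_zero]
  · rw [hexp, hd, congrFun hexp a, ← hin, ← real_inner_self_eq_norm_sq, ← hin]
    exact riemForm_sq_le_rawExp x (L a) (L b)
  · rw [hexp]
    have h1 : √(riemForm x (L a) (L a)) = ‖a‖ := by
      rw [hin, real_inner_self_eq_norm_sq, Real.sqrt_sq (norm_nonneg _)]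
    have h2 := injective_flatDeriv_rawExp hK₀ hcurv x (v := L a) (by rw [h1]; exact ha)
    intro b c hbc
    rw [hd, hd] at hbc
    exact A.injective (h2 hbc)

end ExpPlane

/-! ### Cohomology modulo 2 of the grid -/

section Grid

/-- The end point of an edge of the grid `ℕ × ℕ`: the edge `(b, p)` starts at `p` and is vertical if
`b` is true, horizontal otherwise. -/
def edgeEnd : Bool × ℕ × ℕ → ℕ × ℕ
  | (false, i, j) => (i + 1, j)
  | (true, i, j) => (i, j + 1)

/-- The four edges of the unit square of the grid with lower left vertex `f`. -/
def faceEdges (f : ℕ × ℕ) : Finset (Bool × ℕ × ℕ) :=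
  {(false, f.1, f.2), (false, f.1, f.2 + 1), (true, f.1, f.2), (true, f.1 + 1, f.2)}

/-- The edges of the grid `{0, …, N}²`. -/
def gridEdges (N : ℕ) : Set (Bool × ℕ × ℕ) := {e | (edgeEnd e).1 ≤ N ∧ (edgeEnd e).2 ≤ N}

lemma sum_faceEdges (f : ℕ × ℕ) (z : Bool × ℕ × ℕ → ZMod 2) :
    ∑ e ∈ faceEdges f, z e = z (false, f.1, f.2) + z (false, f.1, f.2 + 1) + z (true, f.1, f.2)
      + z (true, f.1 + 1, f.2) := by
  unfold faceEdges
  rw [Finset.sum_insert (by simp [Prod.ext_iff]), Finset.sum_insert (by simp),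
    Finset.sum_insert (by simp [Prod.ext_iff]), Finset.sum_singleton]
  ring

/-- A cocycle modulo two on the grid is a coboundary. -/
lemma exists_potential {N : ℕ} (z : Bool × ℕ × ℕ → ZMod 2)
    (hz : ∀ i < N, ∀ j < N, ∑ e ∈ faceEdges (i, j), z e = 0) :
    ∃ u : ℕ × ℕ → ZMod 2, ∀ e ∈ gridEdges N, u (edgeEnd e) = u e.2 + z e := by
  -- The potential sums z along the bottom row and then up the column. Vertical edges are immediate;
  -- horizontal ones follow by adding the faces below them.
  refine ⟨fun p => ∑ a ∈ Finset.range p.1, z (false, a, 0) + ∑ b ∈ Finset.range p.2, z (true, p.1, b),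
    ?_⟩
  rintro ⟨_ | _, i, j⟩ ⟨h1, h2⟩ <;> simp only [edgeEnd] at h1 h2 ⊢
  · have key : ∀ j ≤ N, ∑ b ∈ Finset.range j, z (true, i + 1, b) =
        ∑ b ∈ Finset.range j, z (true, i, b) + z (false, i, 0) + z (false, i, j) := by
      intro j
      induction j with
      | zero => intro _; simp [CharTwo.add_self_eq_zero]
      | succ j ih =>
        intro hj
        have hf := hz i (by omega) j (by omega)
        rw [sum_faceEdges] at hf
        simp only at hf
        rw [Finset.sum_range_succ, Finset.sum_range_succ, ih (by omega)]
        have h2 : (2 : ZMod 2) = 0 := rfl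
        linear_combination hf - (z (false, i, j + 1) + z (true, i, j)) * h2
    rw [Finset.sum_range_succ, key j h2]
    have h2 : (2 : ZMod 2) = 0 := rfl
    linear_combination z (false, i, 0) * h2
  · rw [Finset.sum_range_succ]; ring

lemma card_filter_faceEdges_le (e : Bool × ℕ × ℕ) (s : Finset (ℕ × ℕ)) :
    (s.filter fun f => e ∈ faceEdges f).card ≤ 2 := by
  obtain ⟨_ | _, i, j⟩ := e
  · refine (Finset.card_le_card (t := {(i, j), (i, j - 1)}) ?_).trans Finset.card_le_two
    rintro ⟨a, b⟩ h
    simp [faceEdges] at h ⊢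
    omega
  · refine (Finset.card_le_card (t := {(i, j), (i - 1, j)}) ?_).trans Finset.card_le_two
    rintro ⟨a, b⟩ h
    simp [faceEdges] at h ⊢
    omega

/-- If no face of the grid has exactly one edge in `bad`, then `bad` contains a nonempty cocycle. -/
lemma exists_cocycle {N : ℕ} (bad : Finset (Bool × ℕ × ℕ)) (hne : bad.Nonempty)
    (hface : ∀ i < N, ∀ j < N, (bad ∩ faceEdges (i, j)).card ≠ 1) :
    ∃ z : Bool × ℕ × ℕ → ZMod 2, (∀ e ∉ bad, z e = 0) ∧ (∃ e ∈ bad, z e ≠ 0) ∧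
      ∀ i < N, ∀ j < N, ∑ e ∈ faceEdges (i, j), z e = 0 := by
  classical
  set Fc := (Finset.range N ×ˢ Finset.range N).filter fun f => (bad ∩ faceEdges f).Nonempty with hFc
  have hmemFc : ∀ i < N, ∀ j < N, (i, j) ∉ Fc → bad ∩ faceEdges (i, j) = ∅ := by
    intro i hi j hj h
    simpa [hFc, hi, hj, Finset.not_nonempty_iff_eq_empty] using h
  have hsum : ∀ z : Bool × ℕ × ℕ → ZMod 2, (∀ e ∉ bad, z e = 0) → ∀ f,
      ∑ e ∈ faceEdges f, z e = ∑ e ∈ bad ∩ faceEdges f, z e := fun z hz f =>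
    (Finset.sum_subset Finset.inter_subset_right fun e he hne =>
      hz e fun hb => hne (Finset.mem_inter.2 ⟨hb, he⟩)).symm
  rcases lt_or_ge Fc.card bad.card with hlt | hge
  -- Fewer face equations than bad edges: the homogeneous linear system over ℤ/2 has a nonzero
  -- solution.
  · let L : (bad → ZMod 2) →ₗ[ZMod 2] (Fc → ZMod 2) :=
      { toFun := fun x f => ∑ b : bad, if b.1 ∈ faceEdges f.1 then x b else 0
        map_add' := fun x y => by
          funext f
          simp only [Pi.add_apply, ← Finset.sum_add_distrib]
          exact Finset.sum_congr rfl fun b _ => by split_ifs <;> simp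
        map_smul' := fun c x => by
          funext f
          simp only [Pi.smul_apply, RingHom.id_apply, Finset.smul_sum]
          exact Finset.sum_congr rfl fun b _ => by split_ifs <;> simp }
    have hker : LinearMap.ker L ≠ ⊥ := LinearMap.ker_ne_bot_of_finrank_lt (by simpa using hlt)
    obtain ⟨x, hx, hx0⟩ := (Submodule.ne_bot_iff _).1 hker
    let z : Bool × ℕ × ℕ → ZMod 2 := fun e => if h : e ∈ bad then x ⟨e, h⟩ else 0
    have hz0 : ∀ e ∉ bad, z e = 0 := fun e he => by simp [z, he]
    refine ⟨z, hz0, ?_, fun i hi j hj => ?_⟩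
    · obtain ⟨b, hb⟩ := Function.ne_iff.1 hx0
      exact ⟨b.1, b.2, by simpa [z] using hb⟩
    · rw [hsum z hz0]
      by_cases hf : (i, j) ∈ Fc
      · have h1 := congrFun (LinearMap.mem_ker.1 hx) ⟨(i, j), hf⟩
        have h2 : ∑ b : bad, (if b.1 ∈ faceEdges (i, j) then z b.1 else 0) = 0 := by
          refine Eq.trans ?_ (show L x ⟨(i, j), hf⟩ = 0 from h1)
          exact Finset.sum_congr rfl fun b _ => by simp [z]
        rw [Finset.sum_coe_sort bad fun e => if e ∈ faceEdges (i, j) then z e else 0,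
          ← Finset.sum_filter, Finset.filter_mem_eq_inter] at h2
        exact h2
      · rw [hmemFc i hi j hj hf, Finset.sum_empty]
  -- Otherwise count incidences. Each face meeting `bad` has at least two bad edges and each edge
  -- lies on at most two faces, so 2 |Fc| ≤ 2 |bad| ≤ 2 |Fc|. Equality forces exactly two bad edges
  -- on each such face, and the indicator of `bad` is a cocycle.
  · have hz0 : ∀ e ∉ bad, (if e ∈ bad then (1 : ZMod 2) else 0) = 0 := fun e he => by simp [he]
    refine ⟨fun e => if e ∈ bad then 1 else 0, hz0, hne.imp fun e he => ⟨he, by simp [he]⟩, ?_⟩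
    have hdouble : ∑ f ∈ Fc, (bad ∩ faceEdges f).card =
        ∑ e ∈ bad, (Fc.filter fun f => e ∈ faceEdges f).card := by
      have h := Finset.sum_card_bipartiteAbove_eq_sum_card_bipartiteBelow
        (s := Fc) (t := bad) (fun f e => e ∈ faceEdges f)
      simpa [Finset.bipartiteAbove, Finset.bipartiteBelow, Finset.filter_mem_eq_inter] using h
    have hle : ∑ f ∈ Fc, (bad ∩ faceEdges f).card ≤ ∑ f ∈ Fc, 2 := by
      rw [hdouble]
      refine (Finset.sum_le_card_nsmul _ _ 2 fun e _ => card_filter_faceEdges_le e Fc).trans ?_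
      simpa using hge
    have htwo : ∀ f ∈ Fc, 2 ≤ (bad ∩ faceEdges f).card := by
      rintro ⟨i, j⟩ hf
      simp only [hFc, Finset.mem_filter, Finset.mem_product, Finset.mem_range] at hf
      have h1 := Finset.card_pos.2 hf.2
      have h2 := hface i hf.1.1 j hf.1.2
      omega
    have heq := (Finset.sum_eq_sum_iff_of_le htwo).1 (le_antisymm (Finset.sum_le_sum htwo) hle)
    intro i hi j hj
    rw [hsum _ hz0, Finset.sum_congr rfl (g := fun _ => (1 : ZMod 2))
      fun e he => if_pos (Finset.mem_inter.1 he).1, Finset.sum_const, nsmul_one]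
    by_cases hf : (i, j) ∈ Fc
    · rw [← heq _ hf]; rfl
    · rw [hmemFc i hi j hj hf]; rfl

/-- A set of edges of the grid is empty if it meets no face in exactly one edge, and if its
complement connects the grid. -/
lemma grid_edges_eq_empty {N : ℕ} (bad : Finset (Bool × ℕ × ℕ)) (hbad : ↑bad ⊆ gridEdges N)
    (hface : ∀ i < N, ∀ j < N, (bad ∩ faceEdges (i, j)).card ≠ 1)
    (hconn : ∀ u : ℕ × ℕ → ZMod 2, (∀ e ∈ gridEdges N, e ∉ bad → u (edgeEnd e) = u e.2) →
      ∀ e ∈ gridEdges N, u (edgeEnd e) = u e.2) : bad = ∅ := by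
  by_contra hne
  obtain ⟨z, hz0, ⟨e, heb, hez⟩, hz⟩ := exists_cocycle bad (Finset.nonempty_iff_ne_empty.2 hne) hface
  obtain ⟨u, hu⟩ := exists_potential z hz
  -- The potential does not change along edges outside `bad`, hence along no edge at all,
  -- contradicting z ≠ 0.
  have h1 := hconn u (fun e he heb => by rw [hu e he, hz0 e heb, add_zero]) e (hbad heb)
  rw [hu e (hbad heb)] at h1
  exact hez (by simpa using h1)

end Grid
end

noncomputable section
-- Retraction of the grid to nearest vertices
section NearestVertex

/-- The graph distance of two vertices of the grid `ℕ × ℕ`. -/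
def gridDist (p q : ℕ × ℕ) : ℕ := (p.1 - q.1) + (q.1 - p.1) + ((p.2 - q.2) + (q.2 - p.2))

/-- The vertices of the grid `{0, …, N}²`. -/
def gridVertices (N : ℕ) : Finset (ℕ × ℕ) := Finset.range (N + 1) ×ˢ Finset.range (N + 1)

lemma mem_gridVertices {N : ℕ} {v : ℕ × ℕ} : v ∈ gridVertices N ↔ v.1 ≤ N ∧ v.2 ≤ N := by
  simp [gridVertices]

lemma exists_edge_decreasing {N : ℕ} {v m : ℕ × ℕ} (hv : v ∈ gridVertices N)
    (hm : m ∈ gridVertices N) (h : gridDist v m ≠ 0) :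
    ∃ e ∈ gridEdges N, ∃ v' ∈ gridVertices N, gridDist v m = gridDist v' m + 1 ∧
      (e.2 = v ∧ edgeEnd e = v' ∨ e.2 = v' ∧ edgeEnd e = v) := by
  obtain ⟨i, j⟩ := v
  obtain ⟨k, l⟩ := m
  simp only [mem_gridVertices, gridDist] at *
  rcases lt_trichotomy i k with hik | rfl | hik
  · exact ⟨(false, i, j), ⟨by simp [edgeEnd]; omega, by simp [edgeEnd]; omega⟩, (i + 1, j),
      by simp; omega, by simp; omega, Or.inl ⟨rfl, rfl⟩⟩
  · rcases lt_trichotomy j l with hjl | rfl | hjl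
    · exact ⟨(true, i, j), ⟨by simp [edgeEnd]; omega, by simp [edgeEnd]; omega⟩, (i, j + 1),
        by simp; omega, by simp; omega, Or.inl ⟨rfl, rfl⟩⟩
    · simp at h
    · obtain ⟨j, rfl⟩ : ∃ j', j = j' + 1 := ⟨j - 1, by omega⟩
      exact ⟨(true, i, j), ⟨by simp [edgeEnd]; omega, by simp [edgeEnd]; omega⟩, (i, j),
        by simp; omega, by simp; omega, Or.inr ⟨rfl, rfl⟩⟩
  · obtain ⟨i, rfl⟩ : ∃ i', i = i' + 1 := ⟨i - 1, by omega⟩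
    exact ⟨(false, i, j), ⟨by simp [edgeEnd]; omega, by simp [edgeEnd]; omega⟩, (i, j),
      by simp; omega, by simp; omega, Or.inr ⟨rfl, rfl⟩⟩

/-- A retraction of the grid to a nonempty set of vertices, to a nearest vertex with a tie-breaking
rule such that the fibres are connected. -/
lemma exists_nearest_vertex {N : ℕ} (P : Set (ℕ × ℕ)) (hP : ∃ v ∈ gridVertices N, v ∈ P) :
    ∃ n : ℕ × ℕ → ℕ × ℕ, (∀ v, n v ∈ gridVertices N ∧ n v ∈ P) ∧
      (∀ v ∈ gridVertices N, v ∈ P → n v = v) ∧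
      (∀ v, ∀ m ∈ gridVertices N, m ∈ P → gridDist v (n v) ≤ gridDist v m) ∧
      ∀ u : ℕ × ℕ → ZMod 2, (∀ e ∈ gridEdges N, n e.2 = n (edgeEnd e) → u (edgeEnd e) = u e.2) →
        ∀ v ∈ gridVertices N, u v = u (n v) := by
  classical
  set M := (N + 1) * (N + 1) with hM
  let idx : ℕ × ℕ → ℕ := fun v => v.1 * (N + 1) + v.2
  have hidx : ∀ v ∈ gridVertices N, idx v < M := fun v hv => by
    rw [mem_gridVertices] at hv
    simp only [idx, hM]
    nlinarith [hv.1, hv.2]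
  have hinj : ∀ v ∈ gridVertices N, ∀ w ∈ gridVertices N, idx v = idx w → v = w := by
    intro v hv w hw h
    rw [mem_gridVertices] at hv hw
    simp only [idx] at h
    have h1 : v.1 = w.1 := by
      have e1 : (v.1 * (N + 1) + v.2) / (N + 1) = v.1 := by
        rw [Nat.mul_comm, Nat.mul_add_div (Nat.succ_pos N), Nat.div_eq_of_lt (by omega), add_zero]
      have e2 : (w.1 * (N + 1) + w.2) / (N + 1) = w.1 := by
        rw [Nat.mul_comm, Nat.mul_add_div (Nat.succ_pos N), Nat.div_eq_of_lt (by omega), add_zero]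
      rw [← e1, ← e2, h]
    exact Prod.ext h1 (by rw [h1] at h; omega)
  -- As `idx` is less than M on the grid, this orders candidates lexicographically by distance and
  -- then by index; the minimiser is unique.
  let key : ℕ × ℕ → ℕ × ℕ → ℕ := fun v m => gridDist v m * M + idx m
  set s := (gridVertices N).filter (· ∈ P) with hs
  have hsne : s.Nonempty := by
    obtain ⟨v, hv, hvP⟩ := hP
    exact ⟨v, Finset.mem_filter.2 ⟨hv, hvP⟩⟩
  have hch : ∀ v, ∃ m ∈ s, ∀ m' ∈ s, key v m ≤ key v m' := fun v =>
    Finset.exists_min_image s (key v) hsne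
  choose n hn hmin using hch
  have hns : ∀ v, n v ∈ gridVertices N ∧ n v ∈ P := fun v => Finset.mem_filter.1 (hn v)
  have hle : ∀ v, ∀ m ∈ gridVertices N, m ∈ P → gridDist v (n v) ≤ gridDist v m := by
    intro v m hm hmP
    have h1 := hmin v m (Finset.mem_filter.2 ⟨hm, hmP⟩)
    have h2 := hidx m hm
    simp only [key] at h1
    by_contra hlt
    have : (gridDist v m + 1) * M ≤ gridDist v (n v) * M := Nat.mul_le_mul_right _ (by omega)
    rw [add_mul, one_mul] at this
    omega
  have hzero : ∀ v m : ℕ × ℕ, gridDist v m = 0 → v = m := fun v m h => by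
    simp only [gridDist] at h
    exact Prod.ext (by omega) (by omega)
  have huniq : ∀ v, ∀ m ∈ s, (∀ m' ∈ s, key v m ≤ key v m') → n v = m := by
    intro v m hm h
    have h1 : key v (n v) = key v m := le_antisymm (hmin v m hm) (h _ (hn v))
    have hm' := Finset.mem_filter.1 hm
    refine hinj _ (hns v).1 _ hm'.1 ?_
    have h2 := hidx _ (hns v).1
    have h3 := hidx _ hm'.1
    simp only [key] at h1
    have h4 := congrArg (· % M) h1
    simpa [Nat.mul_add_mod', Nat.mod_eq_of_lt h2, Nat.mod_eq_of_lt h3] using h4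
  refine ⟨n, hns, fun v hv hvP => ?_, hle, fun u hu => ?_⟩
  · have h1 := hle v v hv hvP
    refine (hzero _ _ (Nat.le_zero.1 (h1.trans ?_))).symm
    simp [gridDist]
  · have key2 : ∀ d, ∀ v ∈ gridVertices N, gridDist v (n v) = d → u v = u (n v) := by
      intro d
      induction d with
      | zero => intro v _ h; rw [← hzero _ _ h]
      | succ d ih =>
        intro v hv hd
        obtain ⟨e, he, v', hv', hdist, hor⟩ := exists_edge_decreasing hv (hns v).1 (by omega)
        -- A step towards n v lowers its distance by one and that of any other candidate by at most
        -- one, so n v remains the minimiser. Thus the whole path to n v lies in one fibre.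
        have hnn : n v' = n v := by
          refine huniq v' _ (hn v) fun m' hm' => ?_
          have h1 := hmin v m' hm'
          have h2 : gridDist v m' ≤ gridDist v' m' + 1 := by
            have hadj : gridDist v v' ≤ 1 := by
              obtain ⟨_ | _, i, j⟩ := e <;> rcases hor with ⟨rfl, rfl⟩ | ⟨rfl, rfl⟩ <;>
                simp [gridDist, edgeEnd]
            simp only [gridDist] at hadj ⊢
            omega
          have h3 : gridDist v m' * M ≤ (gridDist v' m' + 1) * M := Nat.mul_le_mul_right _ h2
          simp only [key, hdist] at h1 ⊢
          rw [add_mul, one_mul] at h1 h3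
          omega
        have huv : u v = u v' := by
          rcases hor with ⟨h1, h2⟩ | ⟨h1, h2⟩
          · have := hu e he (by rw [h1, h2, hnn])
            rw [h1, h2] at this
            exact this.symm
          · have := hu e he (by rw [h1, h2, hnn])
            rwa [h1, h2] at this
        rw [huv, ih v' hv' (by rw [hnn]; omega), hnn]
    exact fun v hv => key2 _ v hv rfl

end NearestVertex

/-! ### Grid points in the unit square -/

section GridPoints

/-- The vertices of the grid of mesh `1 / N` in the unit square. -/
def gridPoint (N : ℕ) (v : ℕ × ℕ) : ℝ × ℝ := ((v.1 : ℝ) / N, (v.2 : ℝ) / N)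

/-- The unit square. -/
def unitSquare : Set (ℝ × ℝ) := Icc 0 1 ×ˢ Icc 0 1

lemma gridPoint_mem {N : ℕ} {v : ℕ × ℕ} (hv : v ∈ gridVertices N) : gridPoint N v ∈ unitSquare := by
  rw [mem_gridVertices] at hv
  exact ⟨⟨by simp [gridPoint]; positivity, div_le_one_of_le₀ (by exact_mod_cast hv.1) (by positivity)⟩,
    ⟨by simp [gridPoint]; positivity, div_le_one_of_le₀ (by exact_mod_cast hv.2) (by positivity)⟩⟩

lemma exists_round {N : ℕ} (hN : 0 < N) {x : ℝ} (hx : x ∈ Icc (0 : ℝ) 1) :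
    ∃ k ≤ N, |(k : ℝ) / N - x| ≤ 1 / N / 2 := by
  have hN' : (0 : ℝ) < N := by exact_mod_cast hN
  have h0 : 0 ≤ x * N + 1 / 2 := by have := hx.1; positivity
  refine ⟨⌊x * N + 1 / 2⌋₊, ?_, ?_⟩
  · rw [← Nat.lt_succ_iff, Nat.floor_lt h0]
    have := mul_le_mul_of_nonneg_right hx.2 hN'.le
    push_cast
    linarith
  · have h1 := Nat.floor_le h0
    have h2 := Nat.lt_floor_add_one (x * N + 1 / 2)
    set k : ℝ := (⌊x * N + 1 / 2⌋₊ : ℝ)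
    have e : k / N - x = (k - x * N) / N := by field_simp
    rw [e, abs_div, abs_of_pos hN', div_div, one_div, mul_inv_rev, div_eq_mul_inv]
    refine mul_le_mul_of_nonneg_right ?_ (by positivity)
    rw [abs_le]
    constructor <;> linarith

lemma exists_gridPoint_near {N : ℕ} (hN : 0 < N) {z : ℝ × ℝ} (hz : z ∈ unitSquare) :
    ∃ v ∈ gridVertices N, dist (gridPoint N v) z ≤ 1 / N / 2 := by
  obtain ⟨k, hk, hk'⟩ := exists_round hN hz.1
  obtain ⟨l, hl, hl'⟩ := exists_round hN hz.2
  exact ⟨(k, l), mem_gridVertices.2 ⟨hk, hl⟩, max_le hk' hl'⟩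

lemma abs_natCast_sub (a b : ℕ) : |(a : ℝ) - b| = ((a - b) + (b - a) : ℕ) := by
  rcases le_total a b with h | h
  · rw [Nat.sub_eq_zero_of_le h, zero_add, Nat.cast_sub h, abs_sub_comm]
    exact abs_of_nonneg (sub_nonneg.2 (by exact_mod_cast h))
  · rw [Nat.sub_eq_zero_of_le h, add_zero, Nat.cast_sub h]
    exact abs_of_nonneg (sub_nonneg.2 (by exact_mod_cast h))

lemma dist_gridPoint (N : ℕ) (v w : ℕ × ℕ) : dist (gridPoint N v) (gridPoint N w) =
    max (|(v.1 : ℝ) - w.1| / N) (|(v.2 : ℝ) - w.2| / N) := by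
  rw [Prod.dist_eq, Real.dist_eq, Real.dist_eq]
  simp only [gridPoint, ← sub_div, abs_div, Nat.abs_cast]

lemma dist_gridPoint_le (N : ℕ) (v w : ℕ × ℕ) :
    dist (gridPoint N v) (gridPoint N w) ≤ gridDist v w / N := by
  rw [dist_gridPoint, abs_natCast_sub, abs_natCast_sub]
  refine max_le ?_ ?_ <;> refine div_le_div_of_nonneg_right ?_ (Nat.cast_nonneg N) <;>
    exact_mod_cast (by simp only [gridDist]; omega)

lemma gridDist_le (N : ℕ) (v w : ℕ × ℕ) :
    (gridDist v w : ℝ) / N ≤ 2 * dist (gridPoint N v) (gridPoint N w) := by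
  rw [dist_gridPoint, gridDist, Nat.cast_add, ← abs_natCast_sub, ← abs_natCast_sub, add_div]
  linarith [le_max_left (|(v.1 : ℝ) - w.1| / N) (|(v.2 : ℝ) - w.2| / N),
    le_max_right (|(v.1 : ℝ) - w.1| / N) (|(v.2 : ℝ) - w.2| / N)]

lemma dist_edge_le (N : ℕ) (e : Bool × ℕ × ℕ) :
    dist (gridPoint N e.2) (gridPoint N (edgeEnd e)) ≤ 1 / N := by
  refine (dist_gridPoint_le N _ _).trans (div_le_div_of_nonneg_right ?_ (Nat.cast_nonneg N))
  obtain ⟨_ | _, i, j⟩ := e <;> simp [gridDist, edgeEnd]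

lemma adjacent_of_dist_lt {N : ℕ} (hN : 0 < N) {v w : ℕ × ℕ}
    (h : dist (gridPoint N v) (gridPoint N w) < 2 * (1 / N)) :
    (v.1 ≤ w.1 + 1 ∧ w.1 ≤ v.1 + 1) ∧ v.2 ≤ w.2 + 1 ∧ w.2 ≤ v.2 + 1 := by
  have hN' : (0 : ℝ) < N := by exact_mod_cast hN
  rw [dist_gridPoint, max_lt_iff, abs_natCast_sub, abs_natCast_sub, mul_one_div,
    div_lt_div_iff_of_pos_right hN', div_lt_div_iff_of_pos_right hN'] at h
  have h1 : (v.1 - w.1) + (w.1 - v.1) < 2 := by exact_mod_cast h.1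
  have h2 : (v.2 - w.2) + (w.2 - v.2) < 2 := by exact_mod_cast h.2
  omega

/-- A function on the vertices of the grid that is constant along the edges with both ends near `z`
is constant near `z`. -/
lemma constant_near {N : ℕ} {z : ℝ × ℝ} {ρ : ℝ} {u : ℕ × ℕ → ZMod 2}
    (hu : ∀ e ∈ gridEdges N, dist (gridPoint N e.2) z ≤ ρ → dist (gridPoint N (edgeEnd e)) z ≤ ρ →
      u (edgeEnd e) = u e.2) {v w : ℕ × ℕ} (hv : v ∈ gridVertices N) (hw : w ∈ gridVertices N)
    (hvz : dist (gridPoint N v) z ≤ ρ) (hwz : dist (gridPoint N w) z ≤ ρ) : u v = u w := by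
  -- In the supremum distance the vertices close to z form a rectangle, so two of them are joined
  -- inside it by a horizontal and a vertical path.
  have hmid : ∀ {a b c : ℕ} {x : ℝ}, a ≤ b → b ≤ c → |(a : ℝ) / N - x| ≤ ρ →
      |(c : ℝ) / N - x| ≤ ρ → |(b : ℝ) / N - x| ≤ ρ := by
    intro a b c x hab hbc ha hc
    have h1 : (a : ℝ) / N ≤ b / N :=
      div_le_div_of_nonneg_right (by exact_mod_cast hab) (Nat.cast_nonneg N)
    have h2 : (b : ℝ) / N ≤ c / N :=
      div_le_div_of_nonneg_right (by exact_mod_cast hbc) (Nat.cast_nonneg N)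
    rw [abs_le] at *
    constructor <;> linarith
  have hz : ∀ v : ℕ × ℕ, dist (gridPoint N v) z ≤ ρ ↔
      |(v.1 : ℝ) / N - z.1| ≤ ρ ∧ |(v.2 : ℝ) / N - z.2| ≤ ρ := fun v => by
    rw [Prod.dist_eq, max_le_iff, Real.dist_eq, Real.dist_eq]; rfl
  simp only [hz] at *
  rw [mem_gridVertices] at hv hw
  have hor : ∀ j ≤ N, |(j : ℝ) / N - z.2| ≤ ρ → ∀ a b : ℕ, a ≤ b → b ≤ N →
      |(a : ℝ) / N - z.1| ≤ ρ → |(b : ℝ) / N - z.1| ≤ ρ → u (a, j) = u (b, j) := by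
    intro j hj hjz a b hab
    induction b, hab using Nat.le_induction with
    | base => intros; rfl
    | succ b hab ih =>
      intro hb ha hb'
      have hm := hmid hab (Nat.le_succ b) ha hb'
      rw [ih (by omega) ha hm]
      exact (hu (false, b, j) ⟨hb, hj⟩ ⟨hm, hjz⟩ ⟨hb', hjz⟩).symm
  have ver : ∀ i ≤ N, |(i : ℝ) / N - z.1| ≤ ρ → ∀ a b : ℕ, a ≤ b → b ≤ N →
      |(a : ℝ) / N - z.2| ≤ ρ → |(b : ℝ) / N - z.2| ≤ ρ → u (i, a) = u (i, b) := by
    intro i hi hiz a b hab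
    induction b, hab using Nat.le_induction with
    | base => intros; rfl
    | succ b hab ih =>
      intro hb ha hb'
      have hm := hmid hab (Nat.le_succ b) ha hb'
      rw [ih (by omega) ha hm]
      exact (hu (true, i, b) ⟨hi, hb⟩ ⟨hiz, hm⟩ ⟨hiz, hb'⟩).symm
  have h1 : u (v.1, v.2) = u (w.1, v.2) := by
    rcases le_total v.1 w.1 with h | h
    · exact hor _ hv.2 hvz.2 _ _ h hw.1 hvz.1 hwz.1
    · exact (hor _ hv.2 hvz.2 _ _ h hv.1 hwz.1 hvz.1).symm
  have h2 : u (w.1, v.2) = u (w.1, w.2) := by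
    rcases le_total v.2 w.2 with h | h
    · exact ver _ hw.1 hwz.1 _ _ h hw.2 hvz.2 hwz.2
    · exact (ver _ hw.1 hwz.1 _ _ h hv.2 hwz.2 hvz.2).symm
  exact h1.trans h2

end GridPoints
end

noncomputable section
-- Extension of a section from a dense connected set
section SectionOfTree
open Topology

variable {V : Type*} [NormedAddCommGroup V]

/-- Let `X` be a family of subsets of `V` over the unit square, whose points are `r`-separated in
each fibre and can be transported to nearby fibres. Then a bounded continuous section of `X` on a
connected compact set `T` that is sufficiently dense in the square extends to the whole square. -/
theorem exists_section_of_dense {X : ℝ × ℝ → Set V} {R r : ℝ} (hr : 0 < r) (hrR : r ≤ R)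
    (hU : ∀ z ∈ unitSquare, ∀ v ∈ X z, ∀ w ∈ X z, ‖v‖ ≤ 2 * R → dist v w < r → v = w)
    (hL : ∀ r' > 0, ∃ δ > 0, ∀ z ∈ unitSquare, ∀ z' ∈ unitSquare, dist z z' < δ → ∀ v ∈ X z,
      ‖v‖ ≤ 2 * R → ∃ w ∈ X z', dist w v < r') :
    ∃ δ₁ > 0, ∀ T ⊆ unitSquare, IsCompact T → IsPreconnected T → ∀ e : ℝ × ℝ → V,
      ContinuousOn e T → (∀ t ∈ T, e t ∈ X t ∧ ‖e t‖ ≤ R) →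
      (∀ z ∈ unitSquare, ∃ t ∈ T, dist z t < δ₁) →
      ∃ S : ℝ × ℝ → V, ContinuousOn S unitSquare ∧ (∀ z ∈ unitSquare, S z ∈ X z ∧ ‖S z‖ ≤ 2 * R) ∧
        ∀ t ∈ T, S t = e t := by
  classical
  obtain ⟨δ, hδ, hδL⟩ := hL (r / 8) (by positivity)
  refine ⟨δ / 8, by positivity, fun T hTQ hTc hTp e hec heX hdense => ?_⟩
  obtain ⟨η, hη, hηe⟩ := Metric.uniformContinuousOn_iff.1
    (hTc.uniformContinuousOn_of_continuous hec) (r / 8) (by positivity)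
  obtain ⟨N, hNs⟩ : ∃ N : ℕ, 1 / ((N : ℝ) + 1) < min (δ / 8) (η / 4) :=
    exists_nat_one_div_lt (lt_min (by positivity) (by positivity))
  obtain ⟨M, hM0, hMs⟩ : ∃ M : ℕ, 0 < M ∧ 1 / (M : ℝ) < min (δ / 8) (η / 4) :=
    ⟨N + 1, N.succ_pos, by exact_mod_cast hNs⟩
  set s : ℝ := 1 / (M : ℝ) with hs
  have hs0 : 0 < s := by positivity
  have hsδ : s < δ / 8 := hMs.trans_le (min_le_left _ _)
  have hsη : s < η / 4 := hMs.trans_le (min_le_right _ _)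
  let P : Set (ℕ × ℕ) := {v | ∃ t ∈ T, dist (gridPoint M v) t ≤ s}
  have hnear : ∀ t ∈ T, ∃ v ∈ gridVertices M, dist (gridPoint M v) t ≤ s / 2 := fun t ht =>
    exists_gridPoint_near hM0 (hTQ ht)
  have hPne : ∃ v ∈ gridVertices M, v ∈ P := by
    obtain ⟨t, ht, -⟩ := hdense (0, 0) ⟨by simp, by simp⟩
    obtain ⟨v, hv, hvt⟩ := hnear t ht
    exact ⟨v, hv, t, ht, by linarith⟩
  obtain ⟨n, hn, hnP, hnle, hnu⟩ := exists_nearest_vertex P hPne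
  have hτ : ∀ m ∈ P, ∃ t ∈ T, dist (gridPoint M m) t ≤ s := fun m hm => hm
  choose! τ' hτT' hτs' using hτ
  obtain ⟨τ, hττ⟩ : ∃ τ : ℕ × ℕ → ℝ × ℝ, ∀ v, τ v = τ' (n v) := ⟨_, fun _ => rfl⟩
  have hτT : ∀ v, τ v ∈ T := fun v => hττ v ▸ hτT' _ (hn v).2
  have hτs : ∀ v, dist (gridPoint M (n v)) (τ v) ≤ s := fun v => hττ v ▸ hτs' _ (hn v).2
  -- the values at the vertices
  have hdn : ∀ v ∈ gridVertices M, dist (τ v) (gridPoint M v) < δ := by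
    intro v hv
    obtain ⟨t, ht, hvt⟩ := hdense _ (gridPoint_mem hv)
    obtain ⟨m, hm, hmt⟩ := hnear t ht
    have h1 := hnle v m hm ⟨t, ht, by linarith⟩
    have h2 := dist_gridPoint_le M v (n v)
    have h3 : (gridDist v (n v) : ℝ) / M ≤ gridDist v m / M :=
      div_le_div_of_nonneg_right (by exact_mod_cast h1) (Nat.cast_nonneg M)
    have h4 := gridDist_le M v m
    have h5 := dist_triangle_right (gridPoint M v) (gridPoint M m) t
    have h6 := dist_triangle (gridPoint M v) (gridPoint M (n v)) (τ v)
    rw [dist_comm]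
    linarith [hτs v]
  have hval : ∀ v, ∃ w : V, v ∈ gridVertices M → w ∈ X (gridPoint M v) ∧ dist w (e (τ v)) < r / 8 := by
    intro v
    by_cases hv : v ∈ gridVertices M
    · obtain ⟨w, hw⟩ := hδL _ (hTQ (hτT v)) _ (gridPoint_mem hv) (hdn v hv) _ (heX _ (hτT v)).1
        ((heX _ (hτT v)).2.trans (by linarith))
      exact ⟨w, fun _ => hw⟩
    · exact ⟨0, fun h => absurd h hv⟩
  choose val hval using hval
  have hnorm : ∀ v ∈ gridVertices M, ‖val v‖ ≤ R + r / 8 := fun v hv => by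
    have h1 := (hval v hv).2
    rw [dist_eq_norm] at h1
    have h2 := norm_le_norm_add_norm_sub' (val v) (e (τ v))
    linarith [(heX _ (hτT v)).2]
  -- Transporting the value at v to w gives a point of the fibre at w within r / 8; if the value at
  -- w is within r / 2, separation of the fibre identifies the two.
  have hrigid : ∀ v ∈ gridVertices M, ∀ w ∈ gridVertices M,
      dist (gridPoint M v) (gridPoint M w) < δ → dist (val v) (val w) < r / 2 →
      dist (val v) (val w) < r / 8 := by
    intro v hv w hw hvw hlt
    obtain ⟨a, ha, hav⟩ := hδL _ (gridPoint_mem hv) _ (gridPoint_mem hw) hvw _ (hval v hv).1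
      ((hnorm v hv).trans (by linarith))
    have : val w = a := hU _ (gridPoint_mem hw) _ (hval w hw).1 _ ha
      ((hnorm w hw).trans (by linarith)) (by
        have := dist_triangle_left (val w) a (val v)
        rw [dist_comm a] at hav
        linarith)
    rw [this, dist_comm]
    exact hav
  have hends : ∀ e ∈ gridEdges M, e.2 ∈ gridVertices M ∧ edgeEnd e ∈ gridVertices M := by
    rintro ⟨_ | _, i, j⟩ ⟨h1, h2⟩ <;> simp only [edgeEnd, mem_gridVertices] at * <;>
      refine ⟨⟨?_, ?_⟩, ?_, ?_⟩ <;> omega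
  have hsame : ∀ v ∈ gridVertices M, ∀ w ∈ gridVertices M, dist (τ v) (τ w) < η →
      dist (val v) (val w) < r / 2 := by
    intro v hv w hw h
    have h1 := hηe _ (hτT v) _ (hτT w) h
    have h2 := (hval v hv).2
    have h3 := (hval w hw).2
    have h4 := dist_triangle4 (val v) (e (τ v)) (e (τ w)) (val w)
    rw [dist_comm (e (τ w))] at h4
    linarith
  have hnear' : ∀ t ∈ T, ∀ v ∈ gridVertices M, dist (gridPoint M v) t ≤ s →
      n v = v ∧ dist (τ v) t ≤ 2 * s := by
    intro t ht v hv hvt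
    have h1 := hnP v hv ⟨t, ht, hvt⟩
    have h2 := hτs v
    rw [h1] at h2
    have h3 := dist_triangle_left (τ v) t (gridPoint M v)
    exact ⟨h1, by linarith⟩
  set bad : Finset (Bool × ℕ × ℕ) := (({false, true} : Finset Bool) ×ˢ gridVertices M).filter
    fun e => e ∈ gridEdges M ∧ ¬ dist (val e.2) (val (edgeEnd e)) < r / 2 with hbad
  have hbad_iff : ∀ e ∈ gridEdges M, e ∉ bad → dist (val e.2) (val (edgeEnd e)) < r / 2 := by
    intro e he heb
    by_contra hlt
    refine heb (Finset.mem_filter.2 ⟨Finset.mem_product.2 ⟨?_, (hends e he).1⟩, he, hlt⟩)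
    cases e.1 <;> simp
  have hgood : ∀ e ∈ gridEdges M, dist (val e.2) (val (edgeEnd e)) < r / 2 →
      dist (val e.2) (val (edgeEnd e)) < r / 8 := fun e he =>
    hrigid _ (hends e he).1 _ (hends e he).2 ((dist_edge_le M e).trans_lt (by linarith))
  have hbad0 : bad = ∅ := by
    refine grid_edges_eq_empty bad (fun e he => (Finset.mem_filter.1 he).2.1) ?_ ?_
    -- Three good edges of a face change the value by less than 3r / 8 < r / 2 in total, so the
    -- fourth is good as well.
    · intro i hi j hj hcard
      obtain ⟨e₀, he₀⟩ := Finset.card_eq_one.1 hcard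
      have hmem : e₀ ∈ bad ∩ faceEdges (i, j) := by rw [he₀]; exact Finset.mem_singleton_self _
      obtain ⟨hb, hf⟩ := Finset.mem_inter.1 hmem
      have hnot := (Finset.mem_filter.1 hb).2.2
      have hother : ∀ e ∈ faceEdges (i, j), e ∈ gridEdges M → e ≠ e₀ →
          dist (val e.2) (val (edgeEnd e)) < r / 8 := by
        intro e hef heg hne
        refine hgood e heg (hbad_iff e heg fun heb => hne ?_)
        have : e ∈ bad ∩ faceEdges (i, j) := Finset.mem_inter.2 ⟨heb, hef⟩
        rwa [he₀, Finset.mem_singleton] at this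
      have h1 := hother (false, i, j) (by simp [faceEdges]) ⟨hi, hj.le⟩
      have h2 := hother (false, i, j + 1) (by simp [faceEdges]) ⟨hi, hj⟩
      have h3 := hother (true, i, j) (by simp [faceEdges]) ⟨hi.le, hj⟩
      have h4 := hother (true, i + 1, j) (by simp [faceEdges]) ⟨hi, hj⟩
      simp only [edgeEnd] at h1 h2 h3 h4
      apply hnot
      simp only [faceEdges, Finset.mem_insert, Finset.mem_singleton] at hf
      rcases hf with rfl | rfl | rfl | rfl <;> simp only [edgeEnd]
      · have := dist_triangle4 (val (i, j)) (val (i, j + 1)) (val (i + 1, j + 1)) (val (i + 1, j))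
        rw [dist_comm (val (i + 1, j + 1))] at this
        linarith [h2 (by simp), h3 (by simp), h4 (by simp)]
      · have := dist_triangle4 (val (i, j + 1)) (val (i, j)) (val (i + 1, j)) (val (i + 1, j + 1))
        rw [dist_comm (val (i, j + 1)) (val (i, j))] at this
        linarith [h1 (by simp), h3 (by simp), h4 (by simp)]
      · have := dist_triangle4 (val (i, j)) (val (i + 1, j)) (val (i + 1, j + 1)) (val (i, j + 1))
        rw [dist_comm (val (i + 1, j + 1))] at this
        linarith [h1 (by simp), h2 (by simp), h4 (by simp)]
      · have := dist_triangle4 (val (i + 1, j)) (val (i, j)) (val (i, j + 1)) (val (i + 1, j + 1))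
        rw [dist_comm (val (i + 1, j)) (val (i, j))] at this
        linarith [h1 (by simp), h2 (by simp), h3 (by simp)]
    · intro u hu
      have hu' : ∀ e ∈ gridEdges M, dist (τ e.2) (τ (edgeEnd e)) < η → u (edgeEnd e) = u e.2 := by
        intro e he h
        refine hu e he fun heb => (Finset.mem_filter.1 heb).2.2 ?_
        exact hsame _ (hends e he).1 _ (hends e he).2 h
      -- Vertices with the same nearest vertex take their values from the same point of T, so edges
      -- inside a fibre of n are good; the fibres are connected.
      have hun : ∀ v ∈ gridVertices M, u v = u (n v) := by
        refine hnu u fun e he hne => hu' e he ?_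
        rw [hττ, hττ, hne, dist_self]
        exact hη
      have hlocal : ∀ t ∈ T, ∀ v ∈ gridVertices M, ∀ w ∈ gridVertices M,
          dist (gridPoint M v) t ≤ s → dist (gridPoint M w) t ≤ s → u v = u w := by
        intro t ht v hv w hw hvt hwt
        refine constant_near (ρ := s) (fun e he h1 h2 => hu' e he ?_) hv hw hvt hwt
        have h3 := (hnear' t ht _ (hends e he).1 h1).2
        have h4 := (hnear' t ht _ (hends e he).2 h2).2
        have h5 := dist_triangle_right (τ e.2) (τ (edgeEnd e)) t
        linarith
      choose! ρ hρV hρs using hnear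
      -- Vertices close to a point of T have sources within 2s of it, and 4s < η, so edges between
      -- them are good. Hence u read near T is locally constant on T, and T is connected.
      have hconst : ∀ t ∈ T, ∀ t' ∈ T, (u (ρ t)).val = (u (ρ t')).val := by
        intro t ht t' ht'
        refine hTp.constant (f := fun t => (u (ρ t)).val) (fun a ha => ?_) ht ht'
        refine tendsto_const_nhds.congr' ?_
        filter_upwards [self_mem_nhdsWithin,
          mem_nhdsWithin_of_mem_nhds (Metric.ball_mem_nhds a (half_pos hs0))] with b hb hba
        have h1 : dist (gridPoint M (ρ b)) a ≤ s := by
          have := dist_triangle (gridPoint M (ρ b)) b a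
          have h2 := Metric.mem_ball.1 hba
          linarith [hρs b hb]
        rw [hlocal a ha _ (hρV a ha) _ (hρV b hb) (by linarith [hρs a ha]) h1]
      have hτu : ∀ v ∈ gridVertices M, u v = u (ρ (τ v)) := fun v hv => by
        rw [hun v hv]
        exact hlocal (τ v) (hτT v) _ (hn v).1 _ (hρV _ (hτT v)) (hτs v)
          (by linarith [hρs _ (hτT v)])
      intro e he
      rw [hτu _ (hends e he).1, hτu _ (hends e he).2]
      exact ZMod.val_injective 2 (hconst _ (hτT _) _ (hτT _))
  have hedge : ∀ e ∈ gridEdges M, dist (val e.2) (val (edgeEnd e)) < r / 8 := fun e he =>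
    hgood e he (hbad_iff e he (by simp [hbad0]))
  have hadj : ∀ v ∈ gridVertices M, ∀ w ∈ gridVertices M,
      dist (gridPoint M v) (gridPoint M w) < 2 * s → dist (val v) (val w) ≤ r / 4 := by
    rintro ⟨i, j⟩ hv ⟨k, l⟩ hw hvw
    obtain ⟨⟨h1, h2⟩, h3, h4⟩ := adjacent_of_dist_lt hM0 hvw
    rw [mem_gridVertices] at hv hw
    simp only at h1 h2 h3 h4 hv hw
    have e1 : dist (val (i, j)) (val (k, j)) ≤ r / 8 := by
      rcases lt_trichotomy i k with h | rfl | h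
      · obtain rfl : k = i + 1 := by omega
        exact (hedge (false, i, j) ⟨hw.1, hv.2⟩).le
      · simp; positivity
      · obtain rfl : i = k + 1 := by omega
        rw [dist_comm]
        exact (hedge (false, k, j) ⟨hv.1, hv.2⟩).le
    have e2 : dist (val (k, j)) (val (k, l)) ≤ r / 8 := by
      rcases lt_trichotomy j l with h | rfl | h
      · obtain rfl : l = j + 1 := by omega
        exact (hedge (true, k, j) ⟨hw.1, hw.2⟩).le
      · simp; positivity
      · obtain rfl : j = l + 1 := by omega
        rw [dist_comm]
        exact (hedge (true, k, l) ⟨hw.1, hv.2⟩).le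
    linarith [dist_triangle (val (i, j)) (val (k, j)) (val (k, l))]
  -- the section
  have hS : ∀ z, ∃ v ∈ gridVertices M, ∃ w : V, z ∈ unitSquare → dist (gridPoint M v) z ≤ s / 2 ∧
      w ∈ X z ∧ dist w (val v) < r / 8 := by
    intro z
    by_cases hz : z ∈ unitSquare
    · obtain ⟨v, hv, hvz⟩ := exists_gridPoint_near hM0 hz
      obtain ⟨w, hw, hwv⟩ := hδL _ (gridPoint_mem hv) _ hz (by linarith) _ (hval v hv).1
        ((hnorm v hv).trans (by linarith))
      exact ⟨v, hv, w, fun _ => ⟨hvz, hw, hwv⟩⟩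
    · obtain ⟨v, hv, -⟩ := hPne
      exact ⟨v, hv, 0, fun h => absurd h hz⟩
  choose ν hνV S hS using hS
  have hSnorm : ∀ z ∈ unitSquare, ‖S z‖ ≤ 2 * R := fun z hz => by
    have h1 := (hS z hz).2.2
    rw [dist_eq_norm] at h1
    have h2 := norm_le_norm_add_norm_sub' (S z) (val (ν z))
    linarith [hnorm _ (hνV z)]
  refine ⟨S, ?_, fun z hz => ⟨(hS z hz).2.1, hSnorm z hz⟩, fun t ht => ?_⟩
  · rw [Metric.continuousOn_iff]
    intro z hz ε hε
    obtain ⟨δ', hδ', hδL'⟩ := hL (min ε (r / 4)) (lt_min hε (by positivity))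
    refine ⟨min δ' (s / 2), lt_min hδ' (by positivity), fun z' hz' hd => ?_⟩
    obtain ⟨w, hw, hwz⟩ := hδL' z hz z' hz' (by rw [dist_comm]; exact hd.trans_le (min_le_left _ _)) _
      (hS z hz).2.1 (hSnorm z hz)
    have h1 : dist (S z) (S z') ≤ r / 2 := by
      have h2 := hadj _ (hνV z) _ (hνV z') (by
        have h3 := dist_triangle4 (gridPoint M (ν z)) z z' (gridPoint M (ν z'))
        rw [dist_comm z z', dist_comm z' (gridPoint M (ν z'))] at h3
        linarith [(hS z hz).1, (hS z' hz').1, hd.trans_le (min_le_right _ _)])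
      have h3 := dist_triangle4 (S z) (val (ν z)) (val (ν z')) (S z')
      rw [dist_comm (val (ν z'))] at h3
      linarith [(hS z hz).2.2, (hS z' hz').2.2]
    -- The values at z and z' come from adjacent vertices and are within r / 2, so the transport of
    -- S z to z' is forced to be S z'. Continuity is thereby reduced to that of transport.
    have h2 : S z' = w := hU _ hz' _ (hS z' hz').2.1 _ hw (hSnorm z' hz') (by
      have h3 := dist_triangle_left (S z') w (S z)
      rw [dist_comm w] at hwz
      linarith [hwz.trans_le (min_le_right _ _)])
    rw [h2]
    exact hwz.trans_le (min_le_left _ _)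
  -- Over T the constructed value and the given one are within 3r / 8 in the same fibre, hence
  -- equal.
  · have hz := hTQ ht
    refine hU t hz _ (hS t hz).2.1 _ (heX t ht).1 (hSnorm t hz) ?_
    have h1 := (hnear' t ht _ (hνV t) (by linarith [(hS t hz).1])).2
    have h2 := hηe _ (hτT (ν t)) _ ht (by linarith)
    have h3 := dist_triangle4 (S t) (val (ν t)) (e (τ (ν t))) (e t)
    linarith [(hS t hz).2.2, (hval _ (hνV t)).2]

end SectionOfTree
end

noncomputable section
-- Radial immersions: local inverses, uniform lifting, regularity of lifts
section RadialImmersion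
open Topology

variable {F : Type*} [TopologicalSpace F] [ChartedSpace Plane F]
  [RiemannianBundle (fun x : F => TangentSpace 𝓘(ℝ, Plane) x)]

/-- A smooth map of the plane to a Riemannian surface that does not decrease the radial components
of vectors, and that is an immersion on the disc of radius `ρ`. -/
structure IsRadialImmersion (Φ : Plane → F) (ρ : ℝ) : Prop where
  smooth : ContMDiff 𝓘(ℝ, Plane) 𝓘(ℝ, Plane) ∞ Φ
  radial : ∀ a b : Plane, (inner ℝ a b : ℝ) ^ 2 ≤
    ‖a‖ ^ 2 * riemForm (Φ a) (flatDeriv Φ a b) (flatDeriv Φ a b)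
  injective : ∀ a : Plane, ‖a‖ < ρ → Function.Injective (flatDeriv Φ a)

variable [IsManifold 𝓘(ℝ, Plane) ∞ F] {Φ : Plane → F} {ρ : ℝ}

namespace IsRadialImmersion

/-- In dimension two an injective derivative is invertible, so the inverse function theorem in a
chart applies. -/
lemma exists_local_inverse (h : IsRadialImmersion Φ ρ) {a : Plane} (ha : ‖a‖ < ρ) :
    ∃ ψ : F → Plane, ContMDiffAt 𝓘(ℝ, Plane) 𝓘(ℝ, Plane) ∞ ψ (Φ a) ∧ ψ (Φ a) = a ∧
      (∀ᶠ q in 𝓝 (Φ a), Φ (ψ q) = q) ∧ ∀ᶠ b in 𝓝 a, ψ (Φ b) = b := by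
  set e := chartAt Plane (Φ a) with hedef
  have he : e ∈ atlas Plane F := chart_mem_atlas _ _
  have hte : Φ a ∈ e.source := mem_chart_source _ _
  have hd : MDifferentiableAt 𝓘(ℝ, Plane) 𝓘(ℝ, Plane) Φ a :=
    (h.smooth a).mdifferentiableAt (by simp)
  have hes := contMDiffOn_chart_of_mem_atlas he
  have hg : ContDiffAt ℝ ∞ (fun b => e (Φ b)) a :=
    (ContMDiffAt.comp a (hes.contMDiffAt (e.open_source.mem_nhds hte)) (h.smooth a)).contDiffAt
  have hinj : Function.Injective (fderiv ℝ (fun b => e (Φ b)) a) := by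
    rw [fderiv_chart_comp he hd hte]
    exact (chartDeriv_injective he hte).comp (h.injective a ha)
  let L : Plane ≃L[ℝ] Plane :=
    (LinearEquiv.ofInjectiveEndo (fderiv ℝ (fun b => e (Φ b)) a).toLinearMap
      hinj).toContinuousLinearEquiv
  have hL : HasFDerivAt (fun b => e (Φ b)) (L : Plane →L[ℝ] Plane) a :=
    (hg.differentiableAt (by simp)).hasFDerivAt
  have hn : (∞ : WithTop ℕ∞) ≠ 0 := by simp
  let g := hg.toOpenPartialHomeomorph _ hL hn
  have hga : a ∈ g.source := hg.mem_toOpenPartialHomeomorph_source hL hn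
  have hgc : ∀ b, g b = e (Φ b) := fun b => rfl
  have hgs : ContDiffAt ℝ ∞ g.symm (e (Φ a)) := hg.to_localInverse hL hn
  have hψs : ContMDiffAt 𝓘(ℝ, Plane) 𝓘(ℝ, Plane) ∞ (fun q => g.symm (e q)) (Φ a) :=
    ContMDiffAt.comp (Φ a) hgs.contMDiffAt (hes.contMDiffAt (e.open_source.mem_nhds hte))
  have hψa : g.symm (e (Φ a)) = a := by rw [← hgc]; exact g.left_inv hga
  refine ⟨fun q => g.symm (e q), hψs, hψa, ?_, ?_⟩
  · have h1 : ∀ᶠ q in 𝓝 (Φ a), q ∈ e.source := e.open_source.mem_nhds hte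
    have h2 : ∀ᶠ q in 𝓝 (Φ a), e q ∈ g.target :=
      (e.continuousAt hte).eventually_mem (g.open_target.mem_nhds (by
        rw [← hgc]; exact g.map_source hga))
    have h3 : ∀ᶠ q in 𝓝 (Φ a), Φ (g.symm (e q)) ∈ e.source := by
      refine (ContinuousAt.comp (f := fun q => g.symm (e q)) (x := Φ a)
        h.smooth.continuous.continuousAt hψs.continuousAt).eventually_mem
        (e.open_source.mem_nhds ?_)
      change Φ (g.symm (e (Φ a))) ∈ e.source
      rw [hψa]; exact hte
    filter_upwards [h1, h2, h3] with q hq1 hq2 hq3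
    refine e.injOn hq3 hq1 ?_
    rw [← hgc]
    exact g.right_inv hq2
  · filter_upwards [g.open_source.mem_nhds hga] with b hb
    rw [← hgc]
    exact g.left_inv hb

/-- A Lebesgue number of a cover of the closed disc by open sets on which Φ is injective. Only one
of the two points has to lie in that disc. -/
lemma exists_injectivity_radius (h : IsRadialImmersion Φ ρ) {R : ℝ} (hR : R < ρ) :
    ∃ r > 0, ∀ a b, ‖a‖ ≤ R → dist a b < r → Φ a = Φ b → a = b := by
  have hloc : ∀ a : Metric.closedBall (0 : Plane) R, ∃ U : Set Plane, IsOpen U ∧ (a : Plane) ∈ U ∧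
      InjOn Φ U := by
    intro a
    obtain ⟨ψ, -, -, -, h4⟩ := h.exists_local_inverse
      ((mem_closedBall_zero_iff.1 a.2).trans_lt hR)
    obtain ⟨U, hU, hUo, haU⟩ := eventually_nhds_iff.1 h4
    exact ⟨U, hUo, haU, fun b hb c hc hbc => by rw [← hU b hb, hbc, hU c hc]⟩
  choose U hUo hUa hUi using hloc
  obtain ⟨r, hr, hrU⟩ := lebesgue_number_lemma_of_metric (isCompact_closedBall (0 : Plane) R) hUo
    fun a ha => mem_iUnion.2 ⟨⟨a, ha⟩, hUa ⟨a, ha⟩⟩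
  refine ⟨r, hr, fun a b ha hab heq => ?_⟩
  obtain ⟨i, hi⟩ := hrU a (mem_closedBall_zero_iff.2 ha)
  exact hUi i (hi (Metric.mem_ball_self hr)) (hi (by rwa [Metric.mem_ball, dist_comm])) heq

/-- Compactness of pairs (z, a). Near a pair with Φ a = f z the local inverse composed with f
provides the lifts; near any other pair the condition Φ a = f z fails throughout. -/
lemma exists_uniform_lifting [T2Space F] (h : IsRadialImmersion Φ ρ) {R : ℝ} (hR : R < ρ)
    {Z : Type*} [PseudoMetricSpace Z] {K : Set Z} (hK : IsCompact K) {f : Z → F}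
    (hf : ContinuousOn f K) {r : ℝ} (hr : 0 < r) :
    ∃ δ > 0, ∀ z ∈ K, ∀ z' ∈ K, dist z z' < δ → ∀ a, ‖a‖ ≤ R → Φ a = f z →
      ∃ b, dist b a < r ∧ Φ b = f z' := by
  have key : ∃ δ > 0, ∀ p ∈ K ×ˢ Metric.closedBall (0 : Plane) R, ∀ z' ∈ K, dist p.1 z' < δ →
      Φ p.2 = f p.1 → ∃ b, dist b p.2 < r ∧ Φ b = f z' := by
    refine (hK.prod (isCompact_closedBall (0 : Plane) R)).induction_on
      (p := fun s => ∃ δ > 0, ∀ p ∈ s, ∀ z' ∈ K, dist p.1 z' < δ →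
      Φ p.2 = f p.1 → ∃ b, dist b p.2 < r ∧ Φ b = f z') ⟨1, one_pos, by simp⟩ ?_ ?_ ?_
    · rintro s t hst ⟨δ, hδ, ht⟩
      exact ⟨δ, hδ, fun p hp => ht p (hst hp)⟩
    · rintro s t ⟨δ, hδ, hs⟩ ⟨δ', hδ', ht⟩
      refine ⟨min δ δ', lt_min hδ hδ', fun p hp z' hz' hd => ?_⟩
      rcases hp with hp | hp
      · exact hs p hp z' hz' (hd.trans_le (min_le_left _ _))
      · exact ht p hp z' hz' (hd.trans_le (min_le_right _ _))
    · rintro ⟨z₀, a₀⟩ ⟨hz₀, ha₀⟩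
      by_cases heq : Φ a₀ = f z₀
      · obtain ⟨ψ, hψ, hψa, hψ1, -⟩ := h.exists_local_inverse
          ((mem_closedBall_zero_iff.1 ha₀).trans_lt hR)
        have h1 : ∀ᶠ q in 𝓝 (Φ a₀), Φ (ψ q) = q ∧ dist (ψ q) a₀ < r / 2 := by
          have h0 : ∀ᶠ b in 𝓝 (ψ (Φ a₀)), dist b a₀ < r / 2 := by
            rw [hψa]
            exact Metric.ball_mem_nhds a₀ (half_pos hr)
          exact hψ1.and (hψ.continuousAt.tendsto.eventually h0)
        rw [heq] at h1
        obtain ⟨η, hη, hη'⟩ := Metric.mem_nhdsWithin_iff.1 ((hf z₀ hz₀).eventually h1)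
        refine ⟨Metric.ball (z₀, a₀) (min (η / 2) (r / 2)),
          mem_nhdsWithin_of_mem_nhds (Metric.ball_mem_nhds _ (by positivity)), η / 2,
          half_pos hη, fun p hp z' hz' hd _ => ?_⟩
        rw [Metric.mem_ball, Prod.dist_eq, max_lt_iff] at hp
        have h3 : dist z' z₀ < η := by
          have := dist_triangle_left z' z₀ p.1
          linarith [hp.1.trans_le (min_le_left _ _)]
        obtain ⟨h4, h5⟩ := hη' ⟨h3, hz'⟩
        refine ⟨ψ (f z'), ?_, h4⟩
        have := dist_triangle_right (ψ (f z')) p.2 a₀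
        linarith [hp.2.trans_le (min_le_right _ _)]
      · have h1 : Filter.Tendsto (fun p : Z × Plane => Φ p.2)
            (𝓝[K ×ˢ Metric.closedBall (0 : Plane) R] (z₀, a₀)) (𝓝 (Φ a₀)) :=
          (h.smooth.continuous.comp continuous_snd).continuousAt.continuousWithinAt
        have h2 : Filter.Tendsto (fun p : Z × Plane => f p.1)
            (𝓝[K ×ˢ Metric.closedBall (0 : Plane) R] (z₀, a₀)) (𝓝 (f z₀)) :=
          ContinuousWithinAt.comp (x := (z₀, a₀)) (f := Prod.fst) (g := f) (t := K) (hf z₀ hz₀)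
            continuousWithinAt_fst fun p hp => hp.1
        have h3 := (h1.prodMk_nhds h2).eventually (isClosed_diagonal.isOpen_compl.mem_nhds heq)
        exact ⟨_, h3, 1, one_pos, fun p hp z' _ _ hpe => absurd hpe hp⟩
  obtain ⟨δ, hδ, hδ'⟩ := key
  exact ⟨δ, hδ, fun z hz z' hz' hd a ha hfa =>
    hδ' (z, a) ⟨hz, mem_closedBall_zero_iff.2 ha⟩ z' hz' hd hfa⟩

/-- Continuous lifts are as smooth as the map that is lifted. -/
lemma contDiffWithinAt_lift (h : IsRadialImmersion Φ ρ) {E : Type*} [NormedAddCommGroup E]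
    [NormedSpace ℝ E] {n : WithTop ℕ∞} (hn : n ≤ ((⊤ : ℕ∞) : WithTop ℕ∞)) {f : E → F} {s : Set E}
    {p : E} (hf : ContMDiffWithinAt 𝓘(ℝ, E) 𝓘(ℝ, Plane) n f s p) {l : E → Plane}
    (hl : ContinuousWithinAt l s p) (hlf : ∀ q ∈ s, Φ (l q) = f q) (hp : p ∈ s) (hlp : ‖l p‖ < ρ) :
    ContDiffWithinAt ℝ n l s p := by
  obtain ⟨ψ, hψ, hψa, -, hψ2⟩ := h.exists_local_inverse hlp
  rw [hlf p hp] at hψ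
  have h1 : ContMDiffWithinAt 𝓘(ℝ, E) 𝓘(ℝ, Plane) n (ψ ∘ f) s p :=
    (hψ.of_le hn).comp_contMDiffWithinAt p hf
  refine h1.contDiffWithinAt.congr_of_eventuallyEq ?_ ?_
  · filter_upwards [hl.eventually hψ2, self_mem_nhdsWithin] with q hq hqs
    rw [Function.comp_apply, ← hlf q hqs, hq]
  · rw [Function.comp_apply, ← hlf p hp, hψa]

/-- Lifts that take values in a small disc are continuous. -/
lemma continuousOn_lift [T2Space F] (h : IsRadialImmersion Φ ρ) {R r : ℝ} (hR : R < ρ) (hr : 0 < r)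
    (hinj : ∀ a b, ‖a‖ ≤ R → dist a b < r → Φ a = Φ b → a = b) {Z : Type*} [PseudoMetricSpace Z]
    {K : Set Z} (hK : IsCompact K) {f : Z → F} (hf : ContinuousOn f K) {l : Z → Plane} {a : Plane}
    (hl : ∀ z ∈ K, ‖l z‖ ≤ R ∧ Φ (l z) = f z ∧ dist (l z) a < r / 4) : ContinuousOn l K := by
  rw [Metric.continuousOn_iff]
  intro z hz ε hε
  obtain ⟨δ, hδ, hδL⟩ := h.exists_uniform_lifting hR hK hf (lt_min hε (half_pos hr))
  refine ⟨δ, hδ, fun z' hz' hd => ?_⟩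
  obtain ⟨b, hb, hbf⟩ := hδL z hz z' hz' (by rwa [dist_comm]) _ (hl z hz).1 (hl z hz).2.1
  have : l z' = b := by
    refine hinj _ _ (hl z' hz').1 ?_ ((hl z' hz').2.1.trans hbf.symm)
    have h1 := dist_triangle4 (l z') a (l z) b
    rw [dist_comm a, dist_comm (l z) b] at h1
    linarith [(hl z' hz').2.2, (hl z hz).2.2, hb.trans_le (min_le_right _ _)]
  rw [this]
  exact hb.trans_le (min_le_left _ _)

end IsRadialImmersion

end RadialImmersion

/-! ### Lengths of curves and growth of lifts -/

section CurveLength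
open Topology

variable {F : Type*} [TopologicalSpace F] [ChartedSpace Plane F]
  [RiemannianBundle (fun x : F => TangentSpace 𝓘(ℝ, Plane) x)]

/-- The length of a curve in the disc, with the derivative at the ends of the interval ignored. -/
def curveELength (ι : Plane → F) (c : ℝ → Plane) (a b : ℝ) : ℝ≥0∞ :=
  ∫⁻ t in Ioc a b, pullbackENorm ι (c t) (deriv c t)

lemma curveELength_eq (ι : Plane → F) (c : ℝ → Plane) (a b : ℝ) :
    curveELength ι c a b = pullbackELength ι c a b := by
  unfold curveELength pullbackELength
  rw [← restrict_Ioo_eq_restrict_Ioc, ← restrict_Ioo_eq_restrict_Icc]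
  refine setLIntegral_congr_fun measurableSet_Ioo fun t ht => ?_
  simp only [derivWithin_of_mem_nhds (Icc_mem_nhds ht.1 ht.2)]

/-- Exact additivity is the reason for `deriv` in place of `derivWithin`: the integrand does not
depend on the interval. -/
lemma curveELength_add (ι : Plane → F) (c : ℝ → Plane) {a b d : ℝ} (hab : a ≤ b) (hbd : b ≤ d) :
    curveELength ι c a b + curveELength ι c b d = curveELength ι c a d := by
  unfold curveELength
  rw [← Ioc_union_Ioc_eq_Ioc hab hbd, lintegral_union measurableSet_Ioc
    (Ioc_disjoint_Ioc_of_le le_rfl)]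

variable [IsManifold 𝓘(ℝ, Plane) ∞ F] {Φ : Plane → F} {ρ : ℝ}

/-- The norm of a lift grows at most by the length of the curve that is lifted. -/
theorem IsRadialImmersion.norm_lift_le (h : IsRadialImmersion Φ ρ) {ι : Plane → F}
    (hι : ContMDiffOn 𝓘(ℝ, Plane) 𝓘(ℝ, Plane) ∞ ι unitDisc) {c : ℝ → Plane} {a b m : ℝ}
    (hab : a ≤ b) (hc : ContDiffOn ℝ 1 c (Icc a b)) (hcB : MapsTo c (Icc a b) unitDisc)
    {l : ℝ → Plane} (hl : ContinuousOn l (Icc a b)) (hlc : ∀ t ∈ Icc a b, Φ (l t) = ι (c t))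
    (hlρ : ∀ t ∈ Icc a b, ‖l t‖ < ρ) (hm0 : 0 ≤ m) (hm : curveELength ι c a b ≤ ENNReal.ofReal m) :
    ‖l b‖ ≤ ‖l a‖ + m := by
  rcases hab.eq_or_lt with rfl | hlt
  · linarith
  have h1 : (1 : WithTop ℕ∞) ≤ ((⊤ : ℕ∞) : WithTop ℕ∞) := by
    exact_mod_cast (le_top : (1 : ℕ∞) ≤ ⊤)
  have hιc : ContMDiffOn 𝓘(ℝ, ℝ) 𝓘(ℝ, Plane) 1 (fun t => ι (c t)) (Icc a b) :=
    (hι.of_le h1).comp hc.contMDiffOn hcB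
  have hls : ContDiffOn ℝ 1 l (Icc a b) := fun t ht =>
    h.contDiffWithinAt_lift h1 (hιc t ht) (hl t ht) hlc ht (hlρ t ht)
  have hspeed : ∀ t ∈ Ioo a b, HasDerivAt l (deriv l t) t ∧ pullbackENorm ι (c t) (deriv c t) =
      ENNReal.ofReal √(riemForm (Φ (l t)) (flatDeriv Φ (l t) (deriv l t))
        (flatDeriv Φ (l t) (deriv l t))) := by
    intro t ht
    have hnhds : Icc a b ∈ 𝓝 t := Icc_mem_nhds ht.1 ht.2
    have ht' : t ∈ Icc a b := Ioo_subset_Icc_self ht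
    have dl : HasDerivAt l (deriv l t) t :=
      ((hls t ht').contDiffAt hnhds).differentiableAt (by simp) |>.hasDerivAt
    have dc : HasDerivAt c (deriv c t) t :=
      ((hc t ht').contDiffAt hnhds).differentiableAt (by simp) |>.hasDerivAt
    refine ⟨dl, ?_⟩
    have e1 : (fun t => ι (c t)) =ᶠ[𝓝 t] fun t => Φ (l t) := by
      filter_upwards [hnhds] with τ hτ using (hlc τ hτ).symm
    have e2 : velocity (fun t => Φ (l t)) t = flatDeriv Φ (l t) (deriv l t) :=
      velocity_comp ((h.smooth (l t)).mdifferentiableAt (by simp)) dl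
    have e3 : HasMFDerivWithinAt 𝓘(ℝ, ℝ) 𝓘(ℝ, Plane) (fun t => ι (c t)) (Icc a b) t
        ((mfderivWithin 𝓘(ℝ, Plane) 𝓘(ℝ, Plane) ι unitDisc (c t)).comp
          (ContinuousLinearMap.toSpanSingleton ℝ (deriv c t))) :=
      HasMFDerivWithinAt.comp t
        ((hι (c t) (hcB ht')).mdifferentiableWithinAt (by simp)).hasMFDerivWithinAt
        dc.hasFDerivAt.hasFDerivWithinAt.hasMFDerivWithinAt hcB
    have e4 := (e3.hasMFDerivAt hnhds).mfderiv
    have e5 : velocity (fun t => ι (c t)) t =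
        (mfderivWithin 𝓘(ℝ, Plane) 𝓘(ℝ, Plane) ι unitDisc (c t) (deriv c t) : Plane) := by
      have := congrArg (fun L : ℝ →L[ℝ] Plane => L 1) e4
      refine this.trans ?_
      change mfderivWithin 𝓘(ℝ, Plane) 𝓘(ℝ, Plane) ι unitDisc (c t)
        (ContinuousLinearMap.toSpanSingleton ℝ (deriv c t) 1) = _
      rw [ContinuousLinearMap.toSpanSingleton_apply, one_smul]
      rfl
    have e6 : velocity (fun t => ι (c t)) t = velocity (fun t => Φ (l t)) t := by
      unfold velocity flatDeriv
      exact congrArg (fun L : ℝ →L[ℝ] Plane => L 1) e1.mfderiv_eq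
    unfold pullbackENorm
    rw [enorm_tangentSpace_eq, hlc t ht', ← e2, ← e6, e5]
    rfl
  have key : ∀ η > 0, ‖l b‖ ≤ ‖l a‖ + m + η := by
    intro η hη
    -- A smooth substitute for the norm, which is not differentiable at 0. Its derivative ⟨l, l'⟩ /
    -- g is bounded by the speed of the lifted curve, by the radial inequality and |l| ≤ g.
    set g : ℝ → ℝ := fun t => √(η ^ 2 + ‖l t‖ ^ 2) with hg
    have hpos : ∀ t, 0 < η ^ 2 + ‖l t‖ ^ 2 := fun t => by positivity
    have hgs : ContDiffOn ℝ 1 g (Icc a b) :=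
      (contDiffOn_const.add (hls.norm_sq ℝ)).sqrt fun t _ => (hpos t).ne'
    have hgd : ∀ t ∈ Ioo a b, HasDerivAt g (derivWithin g (Icc a b) t) t := fun t ht => by
      have hnhds : Icc a b ∈ 𝓝 t := Icc_mem_nhds ht.1 ht.2
      rw [derivWithin_of_mem_nhds hnhds]
      exact ((hgs t (Ioo_subset_Icc_self ht)).contDiffAt hnhds).differentiableAt
        (by simp) |>.hasDerivAt
    have hcont : ContinuousOn (derivWithin g (Icc a b)) (Icc a b) :=
      hgs.continuousOn_derivWithin (uniqueDiffOn_Icc hlt) le_rfl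
    have hftc := intervalIntegral.integral_eq_sub_of_hasDerivAt_of_le hab hgs.continuousOn hgd
      (hcont.intervalIntegrable_of_Icc hab)
    have hle : ‖∫ t in a..b, derivWithin g (Icc a b) t‖ₑ ≤ ENNReal.ofReal m := by
      refine le_trans ?_ hm
      rw [intervalIntegral.integral_of_le hab]
      refine (enorm_integral_le_lintegral_enorm _).trans ?_
      unfold curveELength
      rw [← restrict_Ioo_eq_restrict_Ioc]
      refine setLIntegral_mono' measurableSet_Ioo fun t ht => ?_
      obtain ⟨dl, hs⟩ := hspeed t ht
      rw [hs, ← ofReal_norm]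
      refine ENNReal.ofReal_le_ofReal ?_
      have hd : derivWithin g (Icc a b) t = (inner ℝ (l t) (deriv l t) : ℝ) / g t := by
        have h2 := ((dl.norm_sq).const_add (η ^ 2)).sqrt (hpos t).ne'
        rw [(hgd t ht).unique h2, hg]
        rw [mul_div_mul_left _ _ two_ne_zero]
      have hgt : 0 < g t := Real.sqrt_pos.2 (hpos t)
      rw [hd, Real.norm_eq_abs, abs_div, abs_of_pos hgt, div_le_iff₀ hgt]
      have h3 := h.radial (l t) (deriv l t)
      set q := riemForm (Φ (l t)) (flatDeriv Φ (l t) (deriv l t)) (flatDeriv Φ (l t) (deriv l t))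
      have h4 : |(inner ℝ (l t) (deriv l t) : ℝ)| ≤ ‖l t‖ * √q := by
        have h5 := Real.abs_le_sqrt h3
        rwa [Real.sqrt_mul (sq_nonneg _), Real.sqrt_sq (norm_nonneg _)] at h5
      have h5 : ‖l t‖ ≤ g t := Real.le_sqrt_of_sq_le (by nlinarith [sq_nonneg η])
      calc |(inner ℝ (l t) (deriv l t) : ℝ)| ≤ ‖l t‖ * √q := h4
        _ ≤ g t * √q := mul_le_mul_of_nonneg_right h5 (Real.sqrt_nonneg _)
        _ = √q * g t := mul_comm _ _
    rw [hftc, ← ofReal_norm, ENNReal.ofReal_le_ofReal_iff hm0, Real.norm_eq_abs] at hle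
    have h2 := (abs_le.1 hle).2
    have h3 : ‖l b‖ ≤ g b := Real.le_sqrt_of_sq_le (by nlinarith [sq_nonneg η])
    have h4 : g a ≤ η + ‖l a‖ := by
      refine Real.sqrt_le_iff.2 ⟨by positivity, ?_⟩
      nlinarith [mul_nonneg hη.le (norm_nonneg (l a))]
    linarith
  exact le_of_forall_pos_le_add key

end CurveLength
end

noncomputable section

/-! ### Square and disc -/

section SquareDisc
open Topology

/-- The unit square is homeomorphic to the unit disc. -/
lemma exists_homeomorph_square_disc : ∃ H : (ℝ × ℝ) ≃ₜ Plane, H '' unitSquare = unitDisc := by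
  let L : (ℝ × ℝ) ≃L[ℝ] Plane := ContinuousLinearEquiv.ofFinrankEq (by simp)
  have hc : Convex ℝ unitSquare := (convex_Icc 0 1).prod (convex_Icc 0 1)
  have hk : IsCompact unitSquare := isCompact_Icc.prod isCompact_Icc
  have hk' : IsCompact (L '' unitSquare) := hk.image L.continuous
  obtain ⟨h, -, h2, -⟩ := exists_homeomorph_image_interior_closure_frontier_eq_unitBall
    (s := L '' unitSquare) (hc.linear_image L.toLinearMap) (by
      have h1 : (interior unitSquare).Nonempty := by
        rw [unitSquare, interior_prod_eq, interior_Icc]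
        exact ⟨(1 / 2, 1 / 2), by norm_num, by norm_num⟩
      have h2 := L.toHomeomorph.image_interior unitSquare
      have h3 : (L.toHomeomorph '' interior unitSquare).Nonempty := h1.image _
      rw [h2] at h3
      exact h3) hk'.isBounded
  refine ⟨L.toHomeomorph.trans h, ?_⟩
  rw [hk'.isClosed.closure_eq, image_image] at h2
  exact h2

end SquareDisc

/-! ### Chains of short curves in the disc -/

section Reach
open Topology

variable {F : Type*} [TopologicalSpace F] [ChartedSpace Plane F]
  [RiemannianBundle (fun x : F => TangentSpace 𝓘(ℝ, Plane) x)]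

/-- `DiscReach ι δ y z ℓ`: the points `y` and `z` of the disc can be joined by a chain of `C¹` curves
of diameter less than `δ`, of total length at most `ℓ` for the pullback metric. -/
inductive DiscReach (ι : Plane → F) (δ : ℝ) (y : Plane) : Plane → ℝ → Prop
  | refl : DiscReach ι δ y y 0
  | step {p : Plane} {ℓ : ℝ} (c : ℝ → Plane) (a b m : ℝ) : DiscReach ι δ y p ℓ → a ≤ b →
      ContDiffOn ℝ 1 c (Icc a b) → MapsTo c (Icc a b) unitDisc → c a = p →
      (∀ t ∈ Icc a b, ∀ t' ∈ Icc a b, dist (c t) (c t') < δ) → 0 ≤ m →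
      curveELength ι c a b ≤ ENNReal.ofReal m → DiscReach ι δ y (c b) (ℓ + m)

variable {ι : Plane → F} {δ : ℝ} {y : Plane}

lemma DiscReach.nonneg {z : Plane} {ℓ : ℝ} (h : DiscReach ι δ y z ℓ) : 0 ≤ ℓ := by
  induction h with
  | refl => exact le_rfl
  | step c a b m _ _ _ _ _ _ hm _ ih => exact add_nonneg ih hm

/-- The m of a step is only an upper bound for its length, so a constant curve can absorb the
surplus. -/
lemma DiscReach.mono {z : Plane} {ℓ ℓ' : ℝ} (hδ : 0 < δ) (h : DiscReach ι δ y z ℓ)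
    (hz : z ∈ unitDisc) (hle : ℓ ≤ ℓ') : DiscReach ι δ y z ℓ' := by
  have h1 := DiscReach.step (fun _ => z) 0 0 (ℓ' - ℓ) h le_rfl contDiffOn_const (fun _ _ => hz) rfl
    (fun _ _ _ _ => by simpa using hδ) (by linarith) (by simp [curveELength])
  rwa [add_sub_cancel] at h1

lemma ofReal_toReal_curveELength {c : ℝ → Plane} {a b m : ℝ}
    (h : curveELength ι c a b ≤ ENNReal.ofReal m) :
    curveELength ι c a b ≤ ENNReal.ofReal (curveELength ι c a b).toReal :=
  (ENNReal.ofReal_toReal (ne_top_of_le_ne_top ENNReal.ofReal_ne_top h)).ge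

/-- Curves can be cut in short pieces. -/
lemma DiscReach.trans_curve (hδ : 0 < δ) {c : ℝ → Plane} {a b m ℓ : ℝ} (hab : a ≤ b)
    (hc : ContDiffOn ℝ 1 c (Icc a b)) (hcB : MapsTo c (Icc a b) unitDisc) (hm : 0 ≤ m)
    (hlen : curveELength ι c a b ≤ ENNReal.ofReal m) (h : DiscReach ι δ y (c a) ℓ) :
    DiscReach ι δ y (c b) (ℓ + m) := by
  obtain ⟨η, hη, hηc⟩ := Metric.uniformContinuousOn_iff.1
    (isCompact_Icc.uniformContinuousOn_of_continuous hc.continuousOn) δ hδ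
  obtain ⟨n, hn⟩ := exists_nat_gt ((b - a) / η)
  have hn0 : (0 : ℝ) < n := lt_of_le_of_lt (div_nonneg (sub_nonneg.2 hab) hη.le) hn
  set s := (b - a) / n with hs
  have hs0 : 0 ≤ s := div_nonneg (sub_nonneg.2 hab) hn0.le
  have hsη : s < η := by
    rw [hs, div_lt_iff₀ hn0]; rw [div_lt_iff₀ hη] at hn; linarith
  have hsn : a + n * s = b := by rw [hs]; field_simp; ring
  have hpart : ∀ u v, a ≤ u → u ≤ v → v ≤ b → curveELength ι c u v ≤ curveELength ι c a b := by
    intro u v hu huv hv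
    rw [← curveELength_add ι c (hu.trans huv) hv, ← curveELength_add ι c hu huv]
    exact le_add_self.trans le_self_add
  have key : ∀ k : ℕ, k ≤ n →
      DiscReach ι δ y (c (a + k * s)) (ℓ + (curveELength ι c a (a + k * s)).toReal) := by
    intro k
    induction k with
    | zero => intro _; simpa [curveELength] using h
    | succ k ih =>
      intro hk
      have hkb : a + ((k + 1 : ℕ) : ℝ) * s ≤ b := by
        rw [← hsn]
        have : ((k + 1 : ℕ) : ℝ) ≤ n := by exact_mod_cast hk
        nlinarith
      have hka : a ≤ a + k * s := by have : (0 : ℝ) ≤ k * s := by positivity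
                                     linarith
      have hkk : a + k * s ≤ a + ((k + 1 : ℕ) : ℝ) * s := by push_cast; linarith
      have hsub : Icc (a + k * s) (a + ((k + 1 : ℕ) : ℝ) * s) ⊆ Icc a b := Icc_subset_Icc hka hkb
      have h1 := DiscReach.step c (a + k * s) (a + ((k + 1 : ℕ) : ℝ) * s)
        (curveELength ι c (a + k * s) (a + ((k + 1 : ℕ) : ℝ) * s)).toReal (ih (by omega)) hkk
        (hc.mono hsub) (hcB.mono_left hsub) rfl (fun t ht t' ht' => ?_) ENNReal.toReal_nonneg
        (ofReal_toReal_curveELength ((hpart _ _ hka hkk hkb).trans hlen))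
      · rw [add_assoc, ← ENNReal.toReal_add, curveELength_add ι c hka hkk] at h1
        · exact h1
        · exact ne_top_of_le_ne_top ENNReal.ofReal_ne_top
            ((hpart _ _ le_rfl hka (hkk.trans hkb)).trans hlen)
        · exact ne_top_of_le_ne_top ENNReal.ofReal_ne_top ((hpart _ _ hka hkk hkb).trans hlen)
      · refine hηc t (hsub ht) t' (hsub ht') ?_
        rw [Real.dist_eq, abs_lt]
        have h2 : a + ((k + 1 : ℕ) : ℝ) * s = a + k * s + s := by push_cast; ring
        rw [h2] at ht ht'
        constructor <;> linarith [ht.1, ht.2, ht'.1, ht'.2]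
  have h1 := key n le_rfl
  rw [hsn] at h1
  exact h1.mono hδ (hcB ⟨hab, le_rfl⟩) (by
    have := ENNReal.toReal_mono ENNReal.ofReal_ne_top hlen
    rw [ENNReal.toReal_ofReal hm] at this
    linarith)

lemma pullbackENorm_neg (ι : Plane → F) (p v : Plane) :
    pullbackENorm ι p (-v) = pullbackENorm ι p v :=
  (congrArg _ (ContinuousLinearMap.map_neg
    (mfderivWithin 𝓘(ℝ, Plane) 𝓘(ℝ, Plane) ι unitDisc p) v)).trans (enorm_neg _)

lemma curveELength_reverse (ι : Plane → F) (c : ℝ → Plane) (a b : ℝ) :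
    curveELength ι (fun t => c (a + b - t)) a b = curveELength ι c a b := by
  unfold curveELength
  rw [← restrict_Ioo_eq_restrict_Ioc, ← lintegral_indicator measurableSet_Ioo,
    ← lintegral_indicator measurableSet_Ioo, ← lintegral_sub_left_eq_self
    (fun t => (Ioo a b).indicator (fun t => pullbackENorm ι (c t) (deriv c t)) t) (a + b)]
  refine lintegral_congr fun t => ?_
  have hd : deriv (fun t => c (a + b - t)) t = -deriv c (a + b - t) := deriv_comp_const_sub c (a + b) t
  by_cases ht : t ∈ Ioo a b
  · rw [indicator_of_mem ht, indicator_of_mem (show a + b - t ∈ Ioo a b from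
      ⟨by linarith [ht.2], by linarith [ht.1]⟩), hd]
    exact pullbackENorm_neg ι _ _
  · rw [indicator_of_notMem ht, indicator_of_notMem fun h => ht
      ⟨by linarith [h.2], by linarith [h.1]⟩]

lemma DiscReach.trans_curve_reverse (hδ : 0 < δ) {c : ℝ → Plane} {a b m ℓ : ℝ} (hab : a ≤ b)
    (hc : ContDiffOn ℝ 1 c (Icc a b)) (hcB : MapsTo c (Icc a b) unitDisc) (hm : 0 ≤ m)
    (hlen : curveELength ι c a b ≤ ENNReal.ofReal m) (h : DiscReach ι δ y (c b) ℓ) :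
    DiscReach ι δ y (c a) (ℓ + m) := by
  have hmaps : MapsTo (fun t => a + b - t) (Icc a b) (Icc a b) := fun t ht =>
    ⟨by linarith [ht.2], by linarith [ht.1]⟩
  have h1 := DiscReach.trans_curve (c := fun t => c (a + b - t)) hδ hab
    (hc.comp (by fun_prop) hmaps) (hcB.comp hmaps) hm ((curveELength_reverse ι c a b).trans_le hlen)
    (ℓ := ℓ) (by simpa using h)
  simpa using h1

/-- Every point of the disc is reached from every other one, by a chain of controlled length. -/
lemma exists_discReach (hδ : 0 < δ) {ε η : ℝ} (hε : 0 ≤ ε) (hη : 0 < η)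
    (hlength : pullbackBoundaryELength ι ≤ ENNReal.ofReal ε)
    (hdist : ∀ p ∈ unitDisc, pullbackBoundaryEDist ι p ≤ ENNReal.ofReal ε)
    (hy : y ∈ unitDisc) {z : Plane} (hz : z ∈ unitDisc) :
    DiscReach ι δ y z (3 * ε + 2 * η) := by
  -- The infimum defining the distance to the boundary need not be attained; η is the allowance. The
  -- chain from y to z then costs ε + η to the boundary, at most ε along an arc, and ε + η back.
  have hbd : ∀ p ∈ unitDisc, ∃ θ ∈ Icc 0 (2 * Real.pi), ∃ c : ℝ → Plane,
      ContDiffOn ℝ 1 c (Icc 0 1) ∧ MapsTo c (Icc 0 1) unitDisc ∧ c 0 = p ∧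
      c 1 = !₂[Real.cos θ, Real.sin θ] ∧ curveELength ι c 0 1 ≤ ENNReal.ofReal (ε + η) := by
    intro p hp
    have h1 : pullbackBoundaryEDist ι p < ENNReal.ofReal (ε + η) :=
      (hdist p hp).trans_lt ((ENNReal.ofReal_lt_ofReal_iff (by linarith)).2 (by linarith))
    unfold pullbackBoundaryEDist pullbackEDist at h1
    simp only [iInf_lt_iff] at h1
    obtain ⟨q, hq, c, hc1, hc2, hc3, hc4, hlt⟩ := h1
    have hq1 : q 0 ^ 2 + q 1 ^ 2 = 1 := by
      rw [← norm_sq_plane, mem_sphere_zero_iff_norm.1 hq, one_pow]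
    obtain ⟨θ, hθ, hθ1, hθ2⟩ : ∃ θ ∈ Icc 0 (2 * Real.pi), Real.cos θ = q 0 ∧ Real.sin θ = q 1 := by
      have hn : ‖(⟨q 0, q 1⟩ : ℂ)‖ = 1 := by
        rw [Complex.norm_def, Complex.normSq_mk, ← sq, ← sq, hq1, Real.sqrt_one]
      have hne : (⟨q 0, q 1⟩ : ℂ) ≠ 0 := by rw [← norm_ne_zero_iff, hn]; exact one_ne_zero
      have hc := Complex.cos_arg hne
      have hs := Complex.sin_arg (⟨q 0, q 1⟩ : ℂ)
      rw [hn, div_one] at hc hs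
      have h2 := Complex.neg_pi_lt_arg (⟨q 0, q 1⟩ : ℂ)
      have h3 := Complex.arg_le_pi (⟨q 0, q 1⟩ : ℂ)
      rcases le_or_gt 0 (Complex.arg (⟨q 0, q 1⟩ : ℂ)) with h4 | h4
      · exact ⟨_, ⟨h4, by linarith⟩, hc, hs⟩
      · refine ⟨Complex.arg (⟨q 0, q 1⟩ : ℂ) + 2 * Real.pi, ⟨by linarith, by linarith⟩, ?_, ?_⟩
        · rw [Real.cos_add_two_pi, hc]
        · rw [Real.sin_add_two_pi, hs]
    refine ⟨θ, hθ, c, hc1, hc2, hc3, ?_, (curveELength_eq ι c 0 1).trans_le hlt.le⟩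
    rw [hc4, hθ1, hθ2]
    ext i; fin_cases i <;> rfl
  obtain ⟨θ₁, hθ₁, c₁, h11, h12, h13, h14, h15⟩ := hbd y hy
  obtain ⟨θ₂, hθ₂, c₂, h21, h22, h23, h24, h25⟩ := hbd z hz
  have hεη : 0 ≤ ε + η := by linarith
  have r1 : DiscReach ι δ y (c₁ 1) (0 + (ε + η)) :=
    DiscReach.trans_curve hδ zero_le_one h11 h12 hεη h15 (by rw [h13]; exact DiscReach.refl)
  set κ : ℝ → Plane := fun θ => !₂[Real.cos θ, Real.sin θ] with hκ
  have hκs : ContDiff ℝ 1 κ := by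
    rw [contDiff_piLp]
    intro i
    fin_cases i
    · exact Real.contDiff_cos
    · exact Real.contDiff_sin
  have hκB : ∀ s, MapsTo κ s unitDisc := fun s θ _ => by
    rw [unitDisc, mem_closedBall_zero_iff, ← sq_le_one_iff₀ (norm_nonneg _), norm_sq_plane]
    simp [hκ]
  have hκlen : ∀ u v, 0 ≤ u → u ≤ v → v ≤ 2 * Real.pi →
      curveELength ι κ u v ≤ ENNReal.ofReal ε := by
    intro u v hu huv hv
    refine le_trans ?_ hlength
    unfold pullbackBoundaryELength
    rw [← curveELength_eq, ← curveELength_add ι _ (hu.trans huv) hv, ← curveELength_add ι _ hu huv]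
    exact le_add_self.trans le_self_add
  have r2 : DiscReach ι δ y (κ θ₂) (0 + (ε + η) + ε) := by
    rw [h14] at r1
    rcases le_total θ₁ θ₂ with hle | hle
    · exact DiscReach.trans_curve hδ hle hκs.contDiffOn (hκB _) hε (hκlen _ _ hθ₁.1 hle hθ₂.2) r1
    · exact DiscReach.trans_curve_reverse hδ hle hκs.contDiffOn (hκB _) hε
        (hκlen _ _ hθ₂.1 hle hθ₁.2) r1
  have r3 := DiscReach.trans_curve_reverse hδ zero_le_one h21 h22 hεη h25
    (ℓ := 0 + (ε + η) + ε) (by rw [h24]; exact r2)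
  rw [h23] at r3
  convert r3 using 1
  ring

/-- The infimum of the lengths of chains from `y` to `z`. -/
def reachDist (ι : Plane → F) (δ : ℝ) (y z : Plane) : ℝ := sInf {ℓ | DiscReach ι δ y z ℓ}

lemma bddBelow_discReach (z : Plane) : BddBelow {ℓ | DiscReach ι δ y z ℓ} :=
  ⟨0, fun _ h => h.nonneg⟩

lemma reachDist_nonneg (z : Plane) : 0 ≤ reachDist ι δ y z :=
  Real.sInf_nonneg fun _ h => h.nonneg

lemma DiscReach.reachDist_le {z : Plane} {ℓ : ℝ} (h : DiscReach ι δ y z ℓ) :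
    reachDist ι δ y z ≤ ℓ := csInf_le (bddBelow_discReach z) h

lemma reachDist_self : reachDist ι δ y y = 0 :=
  le_antisymm DiscReach.refl.reachDist_le (reachDist_nonneg y)

/-- Any chain ending at c s can be prolonged by the piece of c up to c t. -/
lemma reachDist_curve_le (hreach : ∀ z ∈ unitDisc, ∃ ℓ, DiscReach ι δ y z ℓ) {c : ℝ → Plane}
    {a b s t m : ℝ} (hc : ContDiffOn ℝ 1 c (Icc a b)) (hcB : MapsTo c (Icc a b) unitDisc)
    (hcδ : ∀ t ∈ Icc a b, ∀ t' ∈ Icc a b, dist (c t) (c t') < δ) (has : a ≤ s) (hst : s ≤ t)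
    (htb : t ≤ b) (hm : 0 ≤ m) (hlen : curveELength ι c s t ≤ ENNReal.ofReal m) :
    reachDist ι δ y (c t) ≤ reachDist ι δ y (c s) + m := by
  have hsub : Icc s t ⊆ Icc a b := Icc_subset_Icc has htb
  rw [← sub_le_iff_le_add]
  refine le_csInf (hreach _ (hcB ⟨has, hst.trans htb⟩)) fun ℓ hℓ => ?_
  rw [sub_le_iff_le_add]
  exact (DiscReach.step c s t m hℓ hst (hc.mono hsub) (hcB.mono_left hsub) rfl
    (fun u hu v hv => hcδ u (hsub hu) v (hsub hv)) hm hlen).reachDist_le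

end Reach

/-! ### Lifts over finite trees of curves -/

section Tree
open Topology

variable {F : Type*} [TopologicalSpace F] [ChartedSpace Plane F]
  [RiemannianBundle (fun x : F => TangentSpace 𝓘(ℝ, Plane) x)]

/-- A lift `e` of `ι` through `Φ` on a connected compact set `T ∋ y`, with `e y = 0`, whose norm is
bounded by the distance to `y` up to the error `σ`. -/
structure IsTreeLift (Φ ι : Plane → F) (δ : ℝ) (y : Plane) (T : Set Plane) (e : Plane → Plane)
    (σ : ℝ) : Prop where
  subset : T ⊆ unitDisc
  compact : IsCompact T
  preconnected : IsPreconnected T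
  mem : y ∈ T
  zero : e y = 0
  continuousOn : ContinuousOn e T
  lift : ∀ z ∈ T, Φ (e z) = ι z
  norm_le : ∀ z ∈ T, ‖e z‖ ≤ reachDist ι δ y z + σ

variable [IsManifold 𝓘(ℝ, Plane) ∞ F] [T2Space F] {Φ ι : Plane → F} {ρ δ R r : ℝ} {y : Plane}

/-- A tree lift can be extended along a short curve. -/
lemma IsTreeLift.extend (h : IsRadialImmersion Φ ρ)
    (hι : ContMDiffOn 𝓘(ℝ, Plane) 𝓘(ℝ, Plane) ∞ ι unitDisc) (hr : 0 < r) (hrR : r ≤ R)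
    (hR : 2 * R < ρ) (hinj : ∀ a b, ‖a‖ ≤ 2 * R → dist a b < r → Φ a = Φ b → a = b)
    (hδ : ∀ z ∈ unitDisc, ∀ z' ∈ unitDisc, dist z z' < δ → ∀ a, ‖a‖ ≤ 2 * R → Φ a = ι z →
      ∃ b, dist b a < r / 4 ∧ Φ b = ι z')
    (hreach : ∀ z ∈ unitDisc, ∃ ℓ, DiscReach ι δ y z ℓ) {T : Set Plane} {e : Plane → Plane} {σ : ℝ}
    (hT : IsTreeLift Φ ι δ y T e σ) (hσ : ∀ z ∈ unitDisc, reachDist ι δ y z + σ ≤ R)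
    {c : ℝ → Plane} {a b m : ℝ} (hab : a ≤ b) (hc : ContDiffOn ℝ 1 c (Icc a b))
    (hcB : MapsTo c (Icc a b) unitDisc)
    (hcδ : ∀ t ∈ Icc a b, ∀ t' ∈ Icc a b, dist (c t) (c t') < δ) (hm : 0 ≤ m)
    (hlen : curveELength ι c a b ≤ ENNReal.ofReal m) (hca : c a ∈ T) :
    ∃ T' e', T ⊆ T' ∧ c b ∈ T' ∧ IsTreeLift Φ ι δ y T' e'
      (σ + m + reachDist ι δ y (c a) - reachDist ι δ y (c b)) := by
  classical
  set D := reachDist ι δ y with hD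
  have hpart : ∀ u v, a ≤ u → u ≤ v → v ≤ b → curveELength ι c u v ≤ ENNReal.ofReal m := by
    intro u v hu huv hv
    refine le_trans ?_ hlen
    rw [← curveELength_add ι c (hu.trans huv) hv, ← curveELength_add ι c hu huv]
    exact le_add_self.trans le_self_add
  -- `t₀` is the last time at which the curve is in T. Only the piece after it is added, and this
  -- meets T in c t₀ alone, so the old and the new lift cannot conflict.
  obtain ⟨t₀, ⟨ht₀, ht₀T⟩, hmax⟩ : ∃ t₀ ∈ Icc a b ∩ c ⁻¹' T, ∀ t ∈ Icc a b ∩ c ⁻¹' T, t ≤ t₀ := by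
    have hk : IsCompact (Icc a b ∩ c ⁻¹' T) :=
      isCompact_Icc.of_isClosed_subset
        (hc.continuousOn.preimage_isClosed_of_isClosed isClosed_Icc hT.compact.isClosed)
        inter_subset_left
    exact hk.exists_isGreatest ⟨a, ⟨le_rfl, hab⟩, hca⟩
  set v₀ := e (c t₀) with hv₀
  have hv₀R : ‖v₀‖ ≤ R := (hT.norm_le _ ht₀T).trans (hσ _ (hcB ht₀))
  have hsub : Icc t₀ b ⊆ Icc a b := Icc_subset_Icc_left ht₀.1
  set A : Set Plane := c '' Icc t₀ b with hA
  have hAc : IsCompact A := isCompact_Icc.image_of_continuousOn (hc.continuousOn.mono hsub)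
  have hAB : A ⊆ unitDisc := by
    rintro _ ⟨t, ht, rfl⟩; exact hcB (hsub ht)
  -- The lift is a function of the point and not of the parameter: all of A is within δ of c t₀, so
  -- every point has a lift close to `v₀`, unique by separation. Self-intersections of the curve
  -- therefore do no harm.
  have hw : ∀ z, ∃ w, z ∈ A → dist w v₀ < r / 4 ∧ Φ w = ι z := by
    intro z
    by_cases hz : z ∈ A
    · obtain ⟨t, ht, rfl⟩ := hz
      obtain ⟨w, hw⟩ := hδ _ (hcB ht₀) _ (hcB (hsub ht)) (hcδ _ ht₀ _ (hsub ht)) v₀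
        (hv₀R.trans (by linarith)) (hT.lift _ ht₀T)
      exact ⟨w, fun _ => hw⟩
    · exact ⟨0, fun h => absurd h hz⟩
  choose w hw using hw
  have hwR : ∀ z ∈ A, ‖w z‖ ≤ 2 * R := fun z hz => by
    have h1 := (hw z hz).1
    rw [dist_eq_norm] at h1
    have h2 := norm_le_norm_add_norm_sub' (w z) v₀
    linarith
  have hwc : ContinuousOn w A := h.continuousOn_lift hR hr hinj hAc (hι.continuousOn.mono hAB)
    fun z hz => ⟨hwR z hz, (hw z hz).2, (hw z hz).1⟩
  have ht₀A : c t₀ ∈ A := ⟨t₀, ⟨le_rfl, ht₀.2⟩, rfl⟩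
  have hw0 : w (c t₀) = v₀ := hinj _ _ (hwR _ ht₀A) ((hw _ ht₀A).1.trans (by linarith))
    ((hw _ ht₀A).2.trans (hT.lift _ ht₀T).symm)
  let e' : Plane → Plane := fun z => if z ∈ T then e z else w z
  have he'T : EqOn e' e T := fun z hz => if_pos hz
  have he'A : EqOn e' w A := by
    rintro _ ⟨t, ht, rfl⟩
    by_cases htT : c t ∈ T
    · have : t = t₀ := le_antisymm (hmax t ⟨hsub ht, htT⟩) ht.1
      rw [he'T htT, this, hw0]
    · exact if_neg htT
  -- The error grows by the excess of the length allowance m over the gain in distance, which is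
  -- nonnegative. At c t the norm is at most D (c a) + σ plus the length from a to t, while D (c b)
  -- is at most D (c t) plus the remaining length.
  set σ' := σ + m + D (c a) - D (c b) with hσ'
  have hDab : D (c b) ≤ D (c a) + m :=
    reachDist_curve_le hreach hc hcB hcδ le_rfl hab le_rfl hm hlen
  refine ⟨T ∪ A, e', subset_union_left, Or.inr ⟨b, ⟨ht₀.2, le_rfl⟩, rfl⟩, ?_⟩
  refine ⟨union_subset hT.subset hAB, hT.compact.union hAc,
    hT.preconnected.union (c t₀) ht₀T ht₀A
      (isPreconnected_Icc.image _ (hc.continuousOn.mono hsub)), Or.inl hT.mem,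
    (he'T hT.mem).trans hT.zero, (hT.continuousOn.congr he'T).union_of_isClosed (hwc.congr he'A)
      hT.compact.isClosed hAc.isClosed, ?_, ?_⟩
  · rintro z (hz | hz)
    · rw [he'T hz, hT.lift z hz]
    · rw [he'A hz, (hw z hz).2]
  · rintro z (hz | hz)
    · rw [he'T hz]
      exact (hT.norm_le z hz).trans (by linarith)
    · rw [he'A hz]
      obtain ⟨t, ht, rfl⟩ := hz
      have htb : t ≤ b := ht.2
      have hst : Icc t₀ t ⊆ Icc t₀ b := Icc_subset_Icc_right htb
      have f1 := hpart a t₀ le_rfl ht₀.1 ht₀.2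
      have f2 := hpart t₀ t ht₀.1 ht.1 htb
      have f3 := hpart t b (ht₀.1.trans ht.1) htb le_rfl
      have hsum : (curveELength ι c a t₀).toReal + (curveELength ι c t₀ t).toReal +
          (curveELength ι c t b).toReal ≤ m := by
        rw [← ENNReal.toReal_add (ne_top_of_le_ne_top ENNReal.ofReal_ne_top f1)
          (ne_top_of_le_ne_top ENNReal.ofReal_ne_top f2), curveELength_add ι c ht₀.1 ht.1,
          ← ENNReal.toReal_add (ne_top_of_le_ne_top ENNReal.ofReal_ne_top
            (hpart a t le_rfl (ht₀.1.trans ht.1) htb))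
          (ne_top_of_le_ne_top ENNReal.ofReal_ne_top f3), curveELength_add ι c
            (ht₀.1.trans ht.1) htb]
        have := ENNReal.toReal_mono ENNReal.ofReal_ne_top hlen
        rwa [ENNReal.toReal_ofReal hm] at this
      have g1 := reachDist_curve_le hreach hc hcB hcδ le_rfl ht₀.1 ht₀.2 ENNReal.toReal_nonneg
        (ofReal_toReal_curveELength f1)
      have g3 := reachDist_curve_le hreach hc hcB hcδ (ht₀.1.trans ht.1) htb le_rfl
        ENNReal.toReal_nonneg (ofReal_toReal_curveELength f3)
      have g2 := h.norm_lift_le hι ht.1 (hc.mono (hst.trans hsub)) (hcB.mono_left (hst.trans hsub))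
        (l := fun t => w (c t)) (hwc.comp (hc.continuousOn.mono (hst.trans hsub))
          fun τ hτ => ⟨τ, hst hτ, rfl⟩) (fun τ hτ => (hw _ ⟨τ, hst hτ, rfl⟩).2)
        (fun τ hτ => (hwR _ ⟨τ, hst hτ, rfl⟩).trans_lt hR) ENNReal.toReal_nonneg
        (ofReal_toReal_curveELength f2)
      simp only [hw0] at g2
      have g0 := hT.norm_le _ ht₀T
      rw [← hv₀] at g0
      linarith

/-- A tree lift can be extended to reach a given point, with small additional error. -/
lemma IsTreeLift.extend_reach (h : IsRadialImmersion Φ ρ)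
    (hι : ContMDiffOn 𝓘(ℝ, Plane) 𝓘(ℝ, Plane) ∞ ι unitDisc) (hr : 0 < r) (hrR : r ≤ R)
    (hR : 2 * R < ρ) (hinj : ∀ a b, ‖a‖ ≤ 2 * R → dist a b < r → Φ a = Φ b → a = b)
    (hδ : ∀ z ∈ unitDisc, ∀ z' ∈ unitDisc, dist z z' < δ → ∀ a, ‖a‖ ≤ 2 * R → Φ a = ι z →
      ∃ b, dist b a < r / 4 ∧ Φ b = ι z')
    (hreach : ∀ z ∈ unitDisc, ∃ ℓ, DiscReach ι δ y z ℓ) {T : Set Plane} {e : Plane → Plane}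
    {σ s : ℝ} (hT : IsTreeLift Φ ι δ y T e σ) (hs : ∀ z ∈ unitDisc, reachDist ι δ y z + s ≤ R)
    {z : Plane} {ℓ : ℝ} (hz : DiscReach ι δ y z ℓ) (hzs : σ + ℓ - reachDist ι δ y z ≤ s) :
    ∃ T' e', T ⊆ T' ∧ z ∈ T' ∧ IsTreeLift Φ ι δ y T' e' (σ + ℓ - reachDist ι δ y z) := by
  induction hz with
  | refl =>
    refine ⟨T, e, Subset.rfl, hT.mem, ?_⟩
    rwa [reachDist_self, add_zero, sub_zero]
  | @step p ℓ c a b m _ hab hc hcB hca hcδ hm hlen ih =>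
    -- The errors telescope along a chain: the total increase is its length bound minus the distance
    -- of its end point.
    have h1 := reachDist_curve_le hreach hc hcB hcδ le_rfl hab le_rfl hm hlen
    rw [hca] at h1
    obtain ⟨T₁, e₁, hTT₁, hp, hT₁⟩ := ih (by linarith)
    obtain ⟨T₂, e₂, hTT₂, hb, hT₂⟩ := hT₁.extend h hι hr hrR hR hinj hδ hreach
      (fun z hz => by linarith [hs z hz]) hab hc hcB hcδ hm hlen (hca ▸ hp)
    refine ⟨T₂, e₂, hTT₁.trans hTT₂, hb, ?_⟩
    rw [hca] at hT₂
    convert hT₂ using 1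
    ring

/-- There are tree lifts through any finite set of points. -/
lemma exists_isTreeLift (h : IsRadialImmersion Φ ρ)
    (hι : ContMDiffOn 𝓘(ℝ, Plane) 𝓘(ℝ, Plane) ∞ ι unitDisc) (hr : 0 < r) (hrR : r ≤ R)
    (hR : 2 * R < ρ) (hinj : ∀ a b, ‖a‖ ≤ 2 * R → dist a b < r → Φ a = Φ b → a = b)
    (hδ : ∀ z ∈ unitDisc, ∀ z' ∈ unitDisc, dist z z' < δ → ∀ a, ‖a‖ ≤ 2 * R → Φ a = ι z →
      ∃ b, dist b a < r / 4 ∧ Φ b = ι z')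
    (hreach : ∀ z ∈ unitDisc, ∃ ℓ, DiscReach ι δ y z ℓ) (hy : y ∈ unitDisc) (hy0 : Φ 0 = ι y)
    (P : Finset Plane) (hP : ↑P ⊆ unitDisc) {s : ℝ} (hs0 : 0 < s)
    (hs : ∀ z ∈ unitDisc, reachDist ι δ y z + s ≤ R) :
    ∃ T e σ, IsTreeLift Φ ι δ y T e σ ∧ σ ≤ s ∧ ↑P ⊆ T := by
  classical
  induction P using Finset.induction generalizing s with
  | empty =>
    refine ⟨{y}, fun _ => 0, 0, ⟨singleton_subset_iff.2 hy, isCompact_singleton,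
      isPreconnected_singleton, rfl, rfl, continuousOn_const, ?_, ?_⟩, hs0.le, by simp⟩
    · rintro z rfl; exact hy0
    · rintro z rfl; simp [reachDist_self]
  | insert z P hz ih =>
    rw [Finset.coe_insert, insert_subset_iff] at hP
    -- Half of the error budget is spent on the earlier points, half on the chain to the new point
    -- z, chosen longer than the infimum by less than s / 2.
    obtain ⟨T, e, σ, hT, hσ, hPT⟩ := ih hP.2 (half_pos hs0) fun z hz => by linarith [hs z hz]
    obtain ⟨ℓ, hℓ, hlt⟩ := exists_lt_of_csInf_lt (hreach z hP.1)
      (show reachDist ι δ y z < reachDist ι δ y z + s / 2 by linarith)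
    obtain ⟨T', e', hTT', hzT', hT'⟩ := hT.extend_reach h hι hr hrR hR hinj hδ hreach hs hℓ
      (by linarith)
    refine ⟨T', e', _, hT', by linarith, ?_⟩
    rw [Finset.coe_insert, insert_subset_iff]
    exact ⟨hzT', hPT.trans hTT'⟩

end Tree
end

noncomputable section

/-! ### Lifting the disc -/

section GlobalLift
open Topology

variable {F : Type*} [TopologicalSpace F] [ChartedSpace Plane F]
  [RiemannianBundle (fun x : F => TangentSpace 𝓘(ℝ, Plane) x)] [IsManifold 𝓘(ℝ, Plane) ∞ F]
  [T2Space F]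

/-- A disc all of whose points are reached from `y` by short chains of curves lifts through a radial
immersion. -/
theorem exists_global_lift {Φ ι : Plane → F} {ρ R s : ℝ} {y : Plane} (h : IsRadialImmersion Φ ρ)
    (hι : ContMDiffOn 𝓘(ℝ, Plane) 𝓘(ℝ, Plane) ∞ ι unitDisc) (hR0 : 0 < R) (hR : 2 * R < ρ)
    (hy : y ∈ unitDisc) (hy0 : Φ 0 = ι y) (hs0 : 0 < s)
    (hreach : ∀ δ > 0, ∀ z ∈ unitDisc, DiscReach ι δ y z (R - s)) :
    ∃ l : Plane → Plane, ContDiffOn ℝ ∞ l unitDisc ∧ (∀ z ∈ unitDisc, Φ (l z) = ι z) ∧ l y = 0 := by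
  obtain ⟨r', hr', hinj'⟩ := h.exists_injectivity_radius hR
  -- The tree lift has norm at most R. Spreading it over the grid and then over the square adds at
  -- most r / 8 twice, so r ≤ R keeps all values in the disc of radius 2R, where Φ is controlled.
  obtain ⟨r, hr, hrR, hrr'⟩ : ∃ r > 0, r ≤ R ∧ r ≤ r' :=
    ⟨min r' R, lt_min hr' hR0, min_le_right _ _, min_le_left _ _⟩
  have hinj : ∀ a b, ‖a‖ ≤ 2 * R → dist a b < r → Φ a = Φ b → a = b := fun a b ha hab =>
    hinj' a b ha (hab.trans_le hrr')
  have hBc : IsCompact unitDisc := isCompact_closedBall _ _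
  obtain ⟨δ, hδ, hδL⟩ := h.exists_uniform_lifting hR hBc hι.continuousOn
    (show 0 < r / 4 by positivity)
  obtain ⟨H, hH⟩ := exists_homeomorph_square_disc
  have hHB : ∀ z ∈ unitSquare, H z ∈ unitDisc := fun z hz => hH ▸ mem_image_of_mem H hz
  have hHQ : ∀ z ∈ unitDisc, H.symm z ∈ unitSquare := fun z hz => by
    rw [← hH] at hz
    obtain ⟨q, hq, rfl⟩ := hz
    rwa [H.symm_apply_apply]
  have hQc : IsCompact unitSquare := isCompact_Icc.prod isCompact_Icc
  have hf : ContinuousOn (fun z => ι (H z)) unitSquare :=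
    hι.continuousOn.comp H.continuous.continuousOn hHB
  -- The required density `δ₁` is fixed before the tree is built, so that a finite net P of that
  -- density can be prescribed for the tree to pass through.
  obtain ⟨δ₁, hδ₁, hext⟩ := exists_section_of_dense (X := fun z => {v : Plane | Φ v = ι (H z)}) hr hrR
    (fun z _ v hv w hw hvR hvw => hinj v w hvR hvw (hv.trans hw.symm))
    (fun r' hr' => by
      obtain ⟨δ', hδ', hL⟩ := h.exists_uniform_lifting hR hQc hf hr'
      exact ⟨δ', hδ', fun z hz z' hz' hd v hv hvR =>
        let ⟨w, hw, hw'⟩ := hL z hz z' hz' hd v hvR hv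
        ⟨w, hw', hw⟩⟩)
  obtain ⟨P, hPQ, hPf, hPcov⟩ := finite_cover_balls_of_compact hQc hδ₁
  have hDR : ∀ z ∈ unitDisc, reachDist ι δ y z + s ≤ R := fun z hz => by
    linarith [(hreach δ hδ z hz).reachDist_le]
  obtain ⟨T, e, σ, hT, hσ, hPT⟩ := exists_isTreeLift h hι hr hrR hR hinj hδL
    (fun z hz => ⟨_, hreach δ hδ z hz⟩) hy hy0 (hPf.image H).toFinset
    (by
      rw [Finite.coe_toFinset]
      rintro _ ⟨p, hp, rfl⟩
      exact hHB p (hPQ hp)) hs0 hDR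
  rw [Finite.coe_toFinset] at hPT
  have hTH : ∀ t ∈ H.symm '' T, H t ∈ T := by
    rintro _ ⟨t, ht, rfl⟩; rwa [H.apply_symm_apply]
  obtain ⟨S, hSc, hSX, hST⟩ := hext (H.symm '' T)
    (by rintro _ ⟨t, ht, rfl⟩; exact hHQ t (hT.subset ht)) (hT.compact.image H.symm.continuous)
    (hT.preconnected.image _ H.symm.continuous.continuousOn) (fun z => e (H z))
    (hT.continuousOn.comp H.continuous.continuousOn hTH)
    (fun t ht => ⟨hT.lift _ (hTH t ht), (hT.norm_le _ (hTH t ht)).trans (by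
      linarith [hDR _ (hT.subset (hTH t ht))])⟩)
    (fun z hz => by
      obtain ⟨p, hp, hzp⟩ := mem_iUnion₂.1 (hPcov hz)
      exact ⟨p, ⟨H p, hPT (mem_image_of_mem H hp), H.symm_apply_apply p⟩, hzp⟩)
  have hlift : ∀ z ∈ unitDisc, Φ (S (H.symm z)) = ι z := fun z hz => by
    have := (hSX _ (hHQ z hz)).1
    rwa [mem_ofPred_eq, H.apply_symm_apply] at this
  have hcont : ContinuousOn (fun z => S (H.symm z)) unitDisc :=
    hSc.comp H.symm.continuous.continuousOn hHQ
  refine ⟨fun z => S (H.symm z), fun z hz => ?_, hlift, ?_⟩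
  · exact h.contDiffWithinAt_lift le_rfl (hι z hz) (hcont z hz) hlift hz
      ((hSX _ (hHQ z hz)).2.trans_lt hR)
  · change S (H.symm y) = 0
    rw [hST _ (mem_image_of_mem _ hT.mem), H.apply_symm_apply, hT.zero]

end GlobalLift
end

theorem mainTheorem9 {F : Type*} [EMetricSpace F] [ChartedSpace Plane F]
    [IsManifold 𝓘(ℝ, Plane) ∞ F]
    [RiemannianBundle (fun x : F => TangentSpace 𝓘(ℝ, Plane) x)]
    [IsContMDiffRiemannianBundle 𝓘(ℝ, Plane) ∞ Plane (fun x : F => TangentSpace 𝓘(ℝ, Plane) x)]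
    [IsRiemannianManifold 𝓘(ℝ, Plane) F] [CompleteSpace F]
    (K₀ : ℝ) (hK₀ : 0 < K₀) (hcurv : ∀ p : F, surfaceCurvature p ≤ K₀)
    (R : ℝ) (hR : R = Real.pi / (3 * √K₀)) (ε : ℝ) (hε : ε < R / 10)
    (ι : Plane → F) (hι : IsImmersedDisc ι)
    (hlength : pullbackBoundaryELength ι ≤ ENNReal.ofReal ε)
    (hdist : ∀ p ∈ unitDisc, pullbackBoundaryEDist ι p ≤ ENNReal.ofReal ε)
    (x : F) (y : Plane) (hy : y ∈ unitDisc) (hxy : x = ι y) :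
    ∃ ιLift : Plane → TangentSpace 𝓘(ℝ, Plane) x,
      ContDiffOn ℝ ∞ ιLift unitDisc ∧
      (∀ p ∈ unitDisc, surfaceExp x (ιLift p) = ι p) ∧
      ιLift y = 0 := by
  obtain ⟨A, hA1, hA2, hA3, hA4⟩ := exists_exp_coordinates hK₀ hcurv x
  have hsqrt : 0 < √K₀ := Real.sqrt_pos.2 hK₀
  have hρ : Real.pi / √K₀ = 3 * R := by rw [hR]; field_simp
  have hR0 : 0 < R := by rw [hR]; positivity
  have hΦ : IsRadialImmersion (fun a => surfaceExp x (A a)) (3 * R) :=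
    ⟨hA1, hA3, fun a ha => hA4 a (by rwa [hρ])⟩
  -- The real number ε is not assumed nonnegative; replacing it by max ε 0 does not change the
  -- bounds in `ℝ≥0∞`.
  have hεe : ENNReal.ofReal (max ε 0) = ENNReal.ofReal ε := by
    rw [ENNReal.ofReal_max, ENNReal.ofReal_zero, max_eq_left zero_le]
  -- With ε ≤ R / 10 and η = R / 20 the chains have length at most 3R / 10 + R / 10, below the R - s
  -- = R / 2 that is needed; and 2R < 3R leaves room for the extension.
  obtain ⟨l, hl1, hl2, hl3⟩ := exists_global_lift (R := R) (s := R / 2) hΦ hι.1 hR0 (by linarith) hy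
    (hA2.trans hxy) (half_pos hR0) fun δ hδ z hz => by
      have h1 := exists_discReach (ε := max ε 0) (η := R / 20) hδ (le_max_right _ _)
        (by positivity) (by rwa [hεe]) (by rwa [hεe]) hy hz
      have h2 : max ε 0 ≤ R / 10 := max_le hε.le (by positivity)
      exact h1.mono hδ hz (by linarith)
  exact ⟨fun p => A (l p), A.toContinuousLinearEquiv.contDiff.comp_contDiffOn hl1, hl2,
    (congrArg A hl3).trans (map_zero A)⟩
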